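/- Let $\Gamma$ be a simply laced Dynkin diagram of affine type, i.e. one of $A_n^{(1)}$ ($n\ge 2$), $D_n^{(1)}$ ($n\ge 4$), $E_6^{(1)}$, $E_7^{(1)}$, $E_8^{(1)}$, with vertex set $\Pi$; let $x_0\in\Pi$ be the vertex labelled $0$ (the extending vertex), $\Pi^0=\Pi\setminus\{x_0\}$, and let $\Gamma^0$ be the finite-type diagram induced on $\Pi^0$. Let $K$ be a field of characteristic different from $2$. Let $\mathcal F$ be the quotient of the free Lie algebra over $K$ on $\Pi$ by the ideal generated by all $[x,y]$ with $x,y\in\Pi$ not adjacent in $\Gamma$, and let $\mathcal L(0)$ be the quotient of $\mathcal F$ by the ideal generated by all $[x,[x,y]]$ with $x\in\Pi$, $y\in\mathcal F$. It is graded by $\mathbb Z^\Pi$: the component $\mathcal L(0)_\mu$ is spanned by the monomials $[x_d,[\ldots,[x_2,x_1]\ldots]]$ with $x_i\in\Pi$ and $\alpha_{x_1}+\dots+\alpha_{x_d}=\mu$, where $\alpha_x$ is the standard basis vector of $\mathbb Z^\Pi$ at $x$. Let $\mathfrak g_{\mathrm{KM}}$ be the complex Lie algebra with generators $E_x,H_x,F_x$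 ($x\in\Pi^0$) and the Serre relations for the Cartan matrix of $\Gamma^0$, graded by $\mathbb Z^{\Pi^0}$ with $E_x,H_x,F_x$ of weight $\alpha_x,0,-\alpha_x$. Let $\Phi^0$ be its set of nonzero weights and $\Phi^0_\pm=\Phi^0\cap(\pm\mathbb N)^{\Pi^0}$. By a Chevalley basis we mean a $\mathbb C$-basis of $\mathfrak g_{\mathrm{KM}}$ consisting of the $H_x$ ($x\in\Pi^0$) and one vector $E_\alpha\in(\mathfrak g_{\mathrm{KM}})_\alpha$ for each $\alpha\in\Phi^0$, such that $E_{\alpha_x}=E_x$, $E_{-\alpha_x}=F_x$, $[H_x,H_y]=0$, $[H_x,E_\alpha]=\langle\alpha_x,\alpha\rangle E_\alpha$ (with $\langle\cdot,\cdot\rangle$ the bilinear form given by the Cartan matrix), $[E_\alpha,E_{-\alpha}]=\sum_x a_xH_x$ for $\alpha=\sum_x a_x\alpha_x$, $[E_\alpha,E_\beta]=\pm E_{\alpha+\beta}$ if $\alpha+\beta\in\Phi^0$, and $[E_\alpha,E_\beta]=0$ if $\alpha+\beta\notin\Phi^0\cup\{0\}$. Then a Chevalley basis exists. Moreover, for every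 Chevalley basis the following holds. Let $\mathfrak g$ be the Chevalley algebra of type $\Gamma^0$ over $K$, i.e. the tensor product with $K$ of the $\mathbb Z$-span of the Chevalley basis; write $E^0_\alpha,H^0_x\in\mathfrak g$ for the images of the basis elements, $\mathfrak g_\alpha=KE_\alpha^0$ for $\alpha\in\Phi^0$, $\mathfrak g_0=\sum_x KH_x^0$, and $\mathfrak n_+=\bigoplus_{\beta\in\Phi^0_+}\mathfrak g_\beta$. Let $\mathfrak u=\mathfrak n_+\ltimes\mathfrak g/\mathfrak n_+$ be the semidirect product in which $\mathfrak g/\mathfrak n_+$ has the trivial bracket and its natural $\mathfrak n_+$-module structure. The kernel of the Cartan matrix of $\Gamma$ on $\mathbb Z^\Pi$ is spanned by a unique primitive vector $\delta\in\mathbb N^\Pi$. Identify $\mathbb Z^{\Pi^0}$ with the vectors in $\mathbb Z^\Pi$ vanishing at $x_0$, and grade $\mathfrak u$ by $\mathbb Z^\Pi$ by giving $\mathfrak g_\beta\subseteq\mathfrak n_+$ weight $\beta$ for $\beta\in\Phi^0_+$, and the image of $\mathfrak g_\beta$ in $\mathfrak g/\mathfrak n_+$ weight $\delta+\beta$ for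 $\beta\in\{0\}\cup\Phi^0_-$. The root system $\Phi^0$ has a lowest root $\theta$ (that is, $\beta-\theta\in\mathbb N^{\Pi^0}$ for all $\beta\in\Phi^0$). The map sending $x\in\Pi^0$ to $E^0_{\alpha_x}\in\mathfrak n_+$ and $x_0$ to the image of $E^0_\theta$ in $\mathfrak g/\mathfrak n_+$ induces an isomorphism of Lie algebras $\mathcal L(0)\to\mathfrak u$ that maps $\mathcal L(0)_\mu$ onto $\mathfrak u_\mu$ for every $\mu\in\mathbb Z^\Pi$. -/

import Mathlib

open scoped TensorProduct

noncomputable section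

namespace Extremal

/-! ### Monomials and the weight grading they define -/

/-- The left-normed monomial `x_d ⋯ x_1 = [x_d, [⋯ [x_2, x_1] ⋯ ]]` attached to the word
`(x_d, …, x_1)` (the empty word gives `0`). -/
def lieMonomial {ι L : Type*} [LieRing L] (g : ι → L) : List ι → L
  | [] => 0
  | [i] => g i
  | i :: j :: w => ⁅g i, lieMonomial g (j :: w)⁆

/-- The span of all monomials of weight `μ` in the elements `g i`, where `g i` has weight
`wt i`.  If the `g i` generate `L`, these are the components of the grading of `L` in which each
`g i` is homogeneous of weight `wt i` (whenever `L` has such a grading). -/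
def weightSpace (R : Type*) {ι L M : Type*} [CommRing R] [LieRing L] [LieAlgebra R L]
    [AddCommMonoid M] (g : ι → L) (wt : ι → M) (μ : M) : Submodule R L :=
  Submodule.span R {z | ∃ w : List ι, (w.map wt).sum = μ ∧ z = lieMonomial g w}

/-! ### The Lie algebras generated by extremal elements -/

/-- The quotient `F` of the free Lie algebra on the vertices of `Γ` by the relations `[x, y] = 0`
for non-adjacent `x`, `y`. -/
abbrev FreeCommuting {V : Type*} (Γ : SimpleGraph V) (K : Type*) [Field K] : Type _ :=
  FreeLieAlgebra K V ⧸
    (LieSubmodule.lieSpan K (FreeLieAlgebra K V)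
      {z | ∃ x y : V, ¬ Γ.Adj x y ∧ z = ⁅FreeLieAlgebra.of K x, FreeLieAlgebra.of K y⁆} :
      LieIdeal K (FreeLieAlgebra K V))

/-- The image of a vertex in `F`. -/
def FreeCommuting.of {V : Type*} (Γ : SimpleGraph V) (K : Type*) [Field K] (x : V) :
    FreeCommuting Γ K :=
  LieSubmodule.Quotient.mk (FreeLieAlgebra.of K x)

/-- The Lie algebra `L(f)`: the quotient of `F` by the ideal generated by all
`[x, [x, y]] - f_x(y) x` with `x` a vertex and `y ∈ F`. -/
abbrev ExtremalAlgebra {V : Type*} (Γ : SimpleGraph V) (K : Type*) [Field K]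
    (f : V → Module.Dual K (FreeCommuting Γ K)) : Type _ :=
  FreeCommuting Γ K ⧸
    (LieSubmodule.lieSpan K (FreeCommuting Γ K)
      {z | ∃ (x : V) (y : FreeCommuting Γ K),
        z = ⁅FreeCommuting.of Γ K x, ⁅FreeCommuting.of Γ K x, y⁆⁆ -
          f x y • FreeCommuting.of Γ K x} :
      LieIdeal K (FreeCommuting Γ K))

/-- The image of a vertex in `L(f)`. -/
def ExtremalAlgebra.of {V : Type*} (Γ : SimpleGraph V) (K : Type*) [Field K]
    (f : V → Module.Dual K (FreeCommuting Γ K)) (x : V) : ExtremalAlgebra Γ K f :=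
  LieSubmodule.Quotient.mk (FreeCommuting.of Γ K x)

/-- The sandwich algebra `L(0)`. -/
abbrev SandwichAlgebra {V : Type*} (Γ : SimpleGraph V) (K : Type*) [Field K] : Type _ :=
  ExtremalAlgebra Γ K 0

/-- The weight-`μ` component of `L(0)`: the span of the monomials of weight `μ`, where a vertex
`x` has weight `α_x`, the `x`-th standard basis vector. -/
def SandwichAlgebra.weightSpace {V : Type*} [DecidableEq V] (Γ : SimpleGraph V)
    (K : Type*) [Field K] (μ : V → ℤ) : Submodule K (SandwichAlgebra Γ K) :=
  Extremal.weightSpace K (ExtremalAlgebra.of Γ K 0) (fun x => Pi.single x (1 : ℤ)) μ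

/-! ### Cartan matrices and the complex Kac-Moody algebra -/

/-- The Cartan matrix of a graph: `2` on the diagonal, `-1` for adjacent vertices, else `0`. -/
def cartanMatrix {I : Type*} [DecidableEq I] (Γ : SimpleGraph I) [DecidableRel Γ.Adj] :
    Matrix I I ℤ :=
  Matrix.of fun x y => if x = y then 2 else if Γ.Adj x y then -1 else 0

/-- The complex Kac-Moody algebra of a graph, presented by the generators `E_x`, `H_x`, `F_x`
and the Serre relations. -/
abbrev KacMoody {I : Type*} [DecidableEq I] (Γ : SimpleGraph I) [DecidableRel Γ.Adj] : Type _ :=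
  Matrix.ToLieAlgebra ℂ (cartanMatrix Γ)

section KacMoody

variable {I : Type*} [DecidableEq I] (Γ : SimpleGraph I) [DecidableRel Γ.Adj]

/-- The image of a generator in the Kac-Moody algebra. -/
def KacMoody.gen (a : CartanMatrix.Generators I) : KacMoody Γ :=
  (LieSubmodule.Quotient.mk (FreeLieAlgebra.of ℂ a) :
    FreeLieAlgebra ℂ (CartanMatrix.Generators I) ⧸
      CartanMatrix.Relations.toIdeal ℂ (cartanMatrix Γ))

/-- The generators `E_x`, `H_x`, `F_x` have weights `α_x`, `0`, `-α_x`. -/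
def genWeight : CartanMatrix.Generators I → (I → ℤ)
  | .H _ => 0
  | .E x => Pi.single x 1
  | .F x => -Pi.single x 1

/-- The component of weight `β` of the Kac-Moody algebra. -/
def KacMoody.weightSpace (β : I → ℤ) : Submodule ℂ (KacMoody Γ) :=
  Extremal.weightSpace ℂ (KacMoody.gen Γ) genWeight β

/-- The root system: the nonzero weights of the Kac-Moody algebra. -/
def rootSystem : Set (I → ℤ) :=
  {β | β ≠ 0 ∧ KacMoody.weightSpace Γ β ≠ ⊥}

/-- A Chevalley basis of the complex Lie algebra of a simply laced Dynkin diagram of finite type.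
It consists of the `H_x` and one root vector `E_α` for every root `α`, where `E_{α_x} = E_x` and
`E_{-α_x} = F_x`.  In the simply laced case the coroot of `α = ∑ a_x α_x` is `∑ a_x H_x`, and the
structure constants `±(p + 1)` of a Chevalley basis are `±1`. -/
structure ChevalleyBasis [Fintype I] where
  /-- The underlying basis. -/
  basis : Module.Basis (I ⊕ rootSystem Γ) ℂ (KacMoody Γ)
  basis_inl (x : I) : basis (Sum.inl x) = KacMoody.gen Γ (.H x)
  mem_weightSpace (α : rootSystem Γ) : basis (Sum.inr α) ∈ KacMoody.weightSpace Γ α.1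
  basis_simple (x : I) (α : rootSystem Γ) (h : α.1 = Pi.single x 1) :
    basis (Sum.inr α) = KacMoody.gen Γ (.E x)
  basis_neg_simple (x : I) (α : rootSystem Γ) (h : α.1 = -Pi.single x 1) :
    basis (Sum.inr α) = KacMoody.gen Γ (.F x)
  lie_H_H (x y : I) : ⁅basis (Sum.inl x), basis (Sum.inl y)⁆ = 0
  lie_H_E (x : I) (α : rootSystem Γ) :
    ⁅basis (Sum.inl x), basis (Sum.inr α)⁆ =
      (cartanMatrix Γ).mulVec α.1 x • basis (Sum.inr α)
  lie_opposite (α β : rootSystem Γ) (h : α.1 + β.1 = 0) :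
    ⁅basis (Sum.inr α), basis (Sum.inr β)⁆ = ∑ x, α.1 x • basis (Sum.inl x)
  lie_root (α β γ : rootSystem Γ) (h : α.1 + β.1 = γ.1) :
    ⁅basis (Sum.inr α), basis (Sum.inr β)⁆ = basis (Sum.inr γ) ∨
      ⁅basis (Sum.inr α), basis (Sum.inr β)⁆ = -basis (Sum.inr γ)
  lie_nonroot (α β : rootSystem Γ) (h0 : α.1 + β.1 ≠ 0) (h : α.1 + β.1 ∉ rootSystem Γ) :
    ⁅basis (Sum.inr α), basis (Sum.inr β)⁆ = 0

end KacMoody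

/-! ### The Chevalley algebra over `K` -/

namespace ChevalleyBasis

variable {I : Type*} [DecidableEq I] [Fintype I] {Γ : SimpleGraph I} [DecidableRel Γ.Adj]
  (B : ChevalleyBasis Γ)

theorem lie_basis_mem (i j : I ⊕ rootSystem Γ) :
    ⁅B.basis i, B.basis j⁆ ∈ Submodule.span ℤ (Set.range B.basis) := by
  have hb : ∀ k, B.basis k ∈ Submodule.span ℤ (Set.range B.basis) :=
    fun k => Submodule.subset_span ⟨k, rfl⟩
  rcases i with x | α <;> rcases j with y | β
  · rw [B.lie_H_H]; exact Submodule.zero_mem _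
  · rw [B.lie_H_E]; exact Submodule.smul_mem _ _ (hb _)
  · rw [← lie_skew, B.lie_H_E]
    exact Submodule.neg_mem _ (Submodule.smul_mem _ _ (hb _))
  · by_cases h0 : α.1 + β.1 = 0
    · rw [B.lie_opposite α β h0]
      exact Submodule.sum_mem _ fun x _ => Submodule.smul_mem _ _ (hb _)
    · by_cases h : α.1 + β.1 ∈ rootSystem Γ
      · rcases B.lie_root α β ⟨_, h⟩ rfl with h' | h' <;> rw [h']
        · exact hb _
        · exact Submodule.neg_mem _ (hb _)
      · rw [B.lie_nonroot α β h0 h]; exact Submodule.zero_mem _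

theorem lie_gen_E_F {I : Type*} [DecidableEq I] (Γ : SimpleGraph I) [DecidableRel Γ.Adj] (x : I) :
    ⁅KacMoody.gen Γ (.E x), KacMoody.gen Γ (.F x)⁆ = KacMoody.gen Γ (.H x) := by
  have h : ⁅FreeLieAlgebra.of ℂ (CartanMatrix.Generators.E x),
      FreeLieAlgebra.of ℂ (CartanMatrix.Generators.F x)⁆ -
      FreeLieAlgebra.of ℂ (CartanMatrix.Generators.H x) ∈
        CartanMatrix.Relations.toIdeal ℂ (cartanMatrix Γ) := by
    apply LieSubmodule.subset_lieSpan
    refine Or.inl (Or.inl (Or.inl (Or.inl (Or.inr ⟨(x, x), ?_⟩))))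
    simp [CartanMatrix.Relations.EF]
  exact (Submodule.Quotient.eq _).mpr h

/-- The simple root `α_x`. -/
def simpleRoot (x : I) : rootSystem Γ :=
  ⟨Pi.single x 1, by
    refine ⟨fun h => ?_, fun h => ?_⟩
    · simpa using congrFun h x
    · have hmem : KacMoody.gen Γ (.E x) ∈ KacMoody.weightSpace Γ (Pi.single x 1) :=
        Submodule.subset_span ⟨[.E x], by simp [genWeight], rfl⟩
      rw [h, Submodule.mem_bot] at hmem
      apply B.basis.ne_zero (Sum.inl x)
      rw [B.basis_inl, ← lie_gen_E_F, hmem, zero_lie]⟩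

/-- The `ℤ`-form spanned by the Chevalley basis, a Lie subring of the complex Lie algebra. -/
def zForm : LieSubalgebra ℤ (KacMoody Γ) where
  toSubmodule := Submodule.span ℤ (Set.range B.basis)
  lie_mem' := by
    intro a b ha hb
    change a ∈ Submodule.span ℤ (Set.range B.basis) at ha
    change b ∈ Submodule.span ℤ (Set.range B.basis) at hb
    change ⁅a, b⁆ ∈ Submodule.span ℤ (Set.range B.basis)
    induction ha using Submodule.span_induction with
    | zero => simp
    | add u v _ _ hu hv => rw [add_lie]; exact Submodule.add_mem _ hu hv
    | smul n u _ hu => rw [smul_lie]; exact Submodule.smul_mem _ _ hu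
    | mem u hu =>
      obtain ⟨i, rfl⟩ := hu
      induction hb using Submodule.span_induction with
      | zero => simp
      | add u v _ _ hu hv => rw [lie_add]; exact Submodule.add_mem _ hu hv
      | smul n u _ hu => rw [lie_smul]; exact Submodule.smul_mem _ _ hu
      | mem v hv =>
        obtain ⟨j, rfl⟩ := hv
        exact B.lie_basis_mem i j

/-- A basis element, as an element of the `ℤ`-form. -/
def zBasis (i : I ⊕ rootSystem Γ) : B.zForm :=
  ⟨B.basis i, Submodule.subset_span ⟨i, rfl⟩⟩

variable (K : Type*) [Field K]

/-- The Chevalley algebra `g` over `K`. -/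
def Algebra : Type _ := K ⊗[ℤ] B.zForm

instance : LieRing (B.Algebra K) := inferInstanceAs (LieRing (K ⊗[ℤ] B.zForm))

instance : LieAlgebra K (B.Algebra K) := inferInstanceAs (LieAlgebra K (K ⊗[ℤ] B.zForm))

/-- The element `1 ⊗ z` of the Chevalley algebra. -/
def ofZForm : B.zForm →ₗ⁅ℤ⁆ B.Algebra K where
  toFun z := (1 : K) ⊗ₜ[ℤ] z
  map_add' := TensorProduct.tmul_add (1 : K)
  map_smul' n z := map_zsmul (TensorProduct.mk ℤ K B.zForm 1) n z
  map_lie' {x y} := by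
    have h := LieAlgebra.ExtendScalars.bracket_tmul ℤ K B.zForm B.zForm (1 : K) (1 : K) x y
    rw [mul_one] at h
    exact h.symm

/-- The image `H_x^0` of `H_x` in the Chevalley algebra. -/
def H (x : I) : B.Algebra K := B.ofZForm K (B.zBasis (Sum.inl x))

/-- The image `E_α^0` of the root vector `E_α` in the Chevalley algebra. -/
def E (α : rootSystem Γ) : B.Algebra K :=
  B.ofZForm K (B.zBasis (Sum.inr α))

/-- The component `g_β` of the Chevalley algebra: it is spanned by `E_β^0` if `β` is a root and
by the `H_x^0` if `β = 0`, and it is zero otherwise. -/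
def weightSpace (β : I → ℤ) : Submodule K (B.Algebra K) :=
  Submodule.span K
    ({z | ∃ α : rootSystem Γ, α.1 = β ∧ z = B.E K α} ∪ {z | β = 0 ∧ ∃ x : I, z = B.H K x})

theorem lie_E_E_mem (α β : rootSystem Γ) (hα : 0 ≤ α.1) (hβ : 0 ≤ β.1) :
    ⁅B.E K α, B.E K β⁆ ∈
      Submodule.span K {z | ∃ α : rootSystem Γ, 0 ≤ α.1 ∧ z = B.E K α} := by
  have e : ⁅B.E K α, B.E K β⁆ =
      B.ofZForm K ⁅B.zBasis (Sum.inr α), B.zBasis (Sum.inr β)⁆ :=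
    (LieHom.map_lie _ _ _).symm
  have h0 : α.1 + β.1 ≠ 0 := by
    intro h
    apply α.2.1
    funext x
    have h1 := congrFun h x
    have h2 := hα x
    have h3 := hβ x
    simp only [Pi.add_apply, Pi.zero_apply] at h1 h2 h3 ⊢
    omega
  rw [e]
  by_cases h : α.1 + β.1 ∈ rootSystem Γ
  · have hm : B.E K ⟨_, h⟩ ∈
        Submodule.span K {z | ∃ α : rootSystem Γ, 0 ≤ α.1 ∧ z = B.E K α} :=
      Submodule.subset_span ⟨⟨_, h⟩, add_nonneg hα hβ, rfl⟩
    rcases B.lie_root α β ⟨_, h⟩ rfl with h' | h'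
    · have : ⁅B.zBasis (Sum.inr α), B.zBasis (Sum.inr β)⁆ = B.zBasis (Sum.inr ⟨_, h⟩) :=
        Subtype.ext h'
      rw [this]; exact hm
    · have : ⁅B.zBasis (Sum.inr α), B.zBasis (Sum.inr β)⁆ = -B.zBasis (Sum.inr ⟨_, h⟩) :=
        Subtype.ext h'
      rw [this, map_neg]; exact Submodule.neg_mem _ hm
  · have : ⁅B.zBasis (Sum.inr α), B.zBasis (Sum.inr β)⁆ = 0 :=
      Subtype.ext (B.lie_nonroot α β h0 h)
    rw [this, map_zero]; exact Submodule.zero_mem _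

/-- The subalgebra `n_+` of the Chevalley algebra: the sum of the root spaces of the positive
roots. -/
def nPos : LieSubalgebra K (B.Algebra K) where
  toSubmodule := Submodule.span K {z | ∃ α : rootSystem Γ, 0 ≤ α.1 ∧ z = B.E K α}
  lie_mem' := by
    intro a b ha hb
    change a ∈ Submodule.span K {z | ∃ α : rootSystem Γ, 0 ≤ α.1 ∧ z = B.E K α} at ha
    change b ∈ Submodule.span K {z | ∃ α : rootSystem Γ, 0 ≤ α.1 ∧ z = B.E K α} at hb
    change ⁅a, b⁆ ∈ Submodule.span K {z | ∃ α : rootSystem Γ, 0 ≤ α.1 ∧ z = B.E K α}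
    induction ha using Submodule.span_induction with
    | zero => simp
    | add u v _ _ hu hv => rw [add_lie]; exact Submodule.add_mem _ hu hv
    | smul n u _ hu => rw [smul_lie]; exact Submodule.smul_mem _ _ hu
    | mem u hu =>
      obtain ⟨α, hα, rfl⟩ := hu
      induction hb using Submodule.span_induction with
      | zero => simp
      | add u v _ _ hu hv => rw [lie_add]; exact Submodule.add_mem _ hu hv
      | smul n u _ hu => rw [lie_smul]; exact Submodule.smul_mem _ _ hu
      | mem v hv =>
        obtain ⟨β, hβ, rfl⟩ := hv
        exact B.lie_E_E_mem K α β hα hβ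

/-- The element `E_x^0 = E_{α_x}^0` of `n_+`. -/
def simpleE (x : I) : B.nPos K :=
  ⟨B.E K (B.simpleRoot x), Submodule.subset_span
    ⟨B.simpleRoot x, Pi.single_nonneg.mpr zero_le_one, rfl⟩⟩

end ChevalleyBasis

/-! ### The semidirect product of a Lie algebra and a module -/

/-- A module regarded as a Lie algebra with the trivial bracket. -/
def TrivialLie (M : Type*) : Type _ := M

namespace TrivialLie

instance (M : Type*) [AddCommGroup M] : AddCommGroup (TrivialLie M) :=
  inferInstanceAs (AddCommGroup M)

instance (R M : Type*) [CommRing R] [AddCommGroup M] [Module R M] : Module R (TrivialLie M) :=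
  inferInstanceAs (Module R M)

/-- The identity map from a module to its copy with the trivial bracket. -/
def of (R M : Type*) [CommRing R] [AddCommGroup M] [Module R M] : M ≃ₗ[R] TrivialLie M :=
  LinearEquiv.refl R M

instance (M : Type*) [AddCommGroup M] : LieRing (TrivialLie M) where
  bracket _ _ := 0
  add_lie _ _ _ := (add_zero _).symm
  lie_add _ _ _ := (add_zero _).symm
  lie_self _ := rfl
  leibniz_lie _ _ _ := (add_zero _).symm

instance (R M : Type*) [CommRing R] [AddCommGroup M] [Module R M] :
    LieAlgebra R (TrivialLie M) where
  lie_smul t _ _ := (smul_zero t).symm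

/-- A Lie algebra acts by derivations on each of its modules, regarded as a Lie algebra with the
trivial bracket. -/
def action (R L M : Type*) [CommRing R] [LieRing L] [LieAlgebra R L] [AddCommGroup M]
    [Module R M] [LieRingModule L M] [LieModule R L M] :
    L →ₗ⁅R⁆ LieDerivation R (TrivialLie M) (TrivialLie M) where
  toFun x :=
    { toLinearMap := (of R M).conj (LieModule.toEnd R L M x)
      leibniz' := fun a b => by
        change (of R M).conj (LieModule.toEnd R L M x) 0 = 0 - 0
        simp }
  map_add' x y := by ext m; simp [LinearEquiv.conj_apply]
  map_smul' t x := by ext m; simp [LinearEquiv.conj_apply]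
  map_lie' {x y} := by
    ext m
    simp [LinearEquiv.conj_apply]

end TrivialLie

/-- The semidirect product `L ⋉ M` of a Lie algebra and an `L`-module with the trivial bracket;
an element has components `left : M` and `right : L`. -/
abbrev SemidirectModule (R L M : Type*) [CommRing R] [LieRing L] [LieAlgebra R L]
    [AddCommGroup M] [Module R M] [LieRingModule L M] [LieModule R L M] : Type _ :=
  LieAlgebra.SemiDirectSum (TrivialLie M) L (TrivialLie.action R L M)

/-! ### Simply laced affine Dynkin diagrams -/

/-- The simply laced affine Dynkin diagrams `A_n^(1)` (`n ≥ 2`), `D_n^(1)` (`n ≥ 4`), `E_6^(1)`,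
`E_7^(1)`, `E_8^(1)`. -/
inductive AffineType
  | A (n : ℕ) (hn : 2 ≤ n)
  | D (n : ℕ) (hn : 4 ≤ n)
  | E6
  | E7
  | E8

/-- The rank; the diagram has the vertices `0, 1, …, rank`. -/
def AffineType.rank : AffineType → ℕ
  | A n _ => n
  | D n _ => n
  | E6 => 6
  | E7 => 7
  | E8 => 8

/-- The diagrams.  `A_n^(1)` is a cycle.  `D_n^(1)` is the path `1, 2, …, n - 1` with `0` attached
to `2` and `n` attached to `n - 2`.  `E_6^(1)` is the path `1, …, 5` with the path `3, 6, 0`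
attached.  `E_7^(1)` is the path `0, …, 6` with `7` attached to `3`.  `E_8^(1)` is the path
`0, …, 7` with `8` attached to `5`. -/
def AffineType.graph : (t : AffineType) → SimpleGraph (Fin (t.rank + 1))
  | A n _ => SimpleGraph.cycleGraph (n + 1)
  | D n _ => SimpleGraph.fromRel fun i j : Fin (n + 1) =>
      (i.val = 0 ∧ j.val = 2) ∨ (1 ≤ i.val ∧ j.val = i.val + 1 ∧ j.val ≤ n - 1) ∨
        (i.val = n - 2 ∧ j.val = n)
  | E6 => SimpleGraph.fromRel fun i j : Fin 7 =>
      (1 ≤ i.val ∧ j.val = i.val + 1 ∧ j.val ≤ 5) ∨ (i.val = 3 ∧ j.val = 6) ∨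
        (i.val = 6 ∧ j.val = 0)
  | E7 => SimpleGraph.fromRel fun i j : Fin 8 =>
      (j.val = i.val + 1 ∧ j.val ≤ 6) ∨ (i.val = 3 ∧ j.val = 7)
  | E8 => SimpleGraph.fromRel fun i j : Fin 9 =>
      (j.val = i.val + 1 ∧ j.val ≤ 7) ∨ (i.val = 5 ∧ j.val = 8)

/-- `Γ` is a simply laced affine Dynkin diagram, in which `x₀` is the vertex labelled `0`. -/
def IsSimplyLacedAffine {V : Type*} (Γ : SimpleGraph V) (x₀ : V) : Prop :=
  ∃ (t : AffineType) (φ : Γ ≃g t.graph), φ x₀ = 0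

/-- The vertex set with the vertex `x₀` removed. -/
abbrev Removed {V : Type*} (x₀ : V) : Type _ := {x : V // x ≠ x₀}

/-- The subdiagram `Γ^0` obtained by removing the vertex `x₀`. -/
abbrev removeVertex {V : Type*} (Γ : SimpleGraph V) (x₀ : V) : SimpleGraph (Removed x₀) :=
  Γ.comap Subtype.val

/-- `δ` is the primitive vector with nonnegative coefficients that spans the kernel of the Cartan
matrix. -/
structure IsNullRoot {V : Type*} [Fintype V] [DecidableEq V] (Γ : SimpleGraph V)
    [DecidableRel Γ.Adj] (δ : V → ℤ) : Prop where
  nonneg : 0 ≤ δ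
  mulVec_eq_zero : (cartanMatrix Γ).mulVec δ = 0
  span (v : V → ℤ) (hv : (cartanMatrix Γ).mulVec v = 0) : ∃ c : ℤ, v = c • δ
  primitive (d : ℤ) (hd : ∀ x, d ∣ δ x) : IsUnit d

/-! ### The target algebra and its grading -/

section Affine

variable {V : Type*} [Fintype V] [DecidableEq V] {Γ : SimpleGraph V} [DecidableRel Γ.Adj]
  {x₀ : V} (B : ChevalleyBasis (removeVertex Γ x₀)) (K : Type*) [Field K]

/-- The `n_+`-module `g/n_+`. -/
abbrev ModNPos : Type _ := B.Algebra K ⧸ (B.nPos K).toLieSubmodule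

/-- The Lie algebra `u = n_+ ⋉ g/n_+`. -/
abbrev AffineTarget : Type _ := SemidirectModule K (B.nPos K) (ModNPos B K)

/-- The inclusion `n_+ → u`. -/
def fromNPos : B.nPos K →ₗ[K] AffineTarget B K :=
  (LieAlgebra.SemiDirectSum.inr (TrivialLie.action K (B.nPos K) (ModNPos B K)) :
    B.nPos K →ₗ[K] AffineTarget B K)

/-- The composite `g → g/n_+ → u`. -/
def fromQuotient : B.Algebra K →ₗ[K] AffineTarget B K :=
  (LieAlgebra.SemiDirectSum.inl (TrivialLie.action K (B.nPos K) (ModNPos B K)) :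
      TrivialLie (ModNPos B K) →ₗ[K] AffineTarget B K) ∘ₗ
    (TrivialLie.of K (ModNPos B K)).toLinearMap ∘ₗ
    ((LieSubmodule.Quotient.mk' (B.nPos K).toLieSubmodule :
      B.Algebra K →ₗ⁅K, B.nPos K⁆ ModNPos B K) : B.Algebra K →ₗ[K] ModNPos B K)

/-- Extension of a weight on the vertices of `Γ^0` by zero at `x₀`. -/
def extendWeight (β : Removed x₀ → ℤ) : V → ℤ :=
  fun x => if h : x ≠ x₀ then β ⟨x, h⟩ else 0

/-- The component of weight `μ` of `u`: the root space of a positive root `β` in `n_+` has weight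
`β`, and the image of `g_β` in `g/n_+`, for `β` zero or a negative root, has weight `δ + β`. -/
def targetWeightSpace (δ μ : V → ℤ) : Submodule K (AffineTarget B K) :=
  (⨆ (β : Removed x₀ → ℤ) (_ : β ∈ rootSystem (removeVertex Γ x₀) ∧ 0 ≤ β)
      (_ : extendWeight β = μ),
    ((B.weightSpace K β).comap (B.nPos K).toSubmodule.subtype).map (fromNPos B K)) ⊔
  (⨆ (β : Removed x₀ → ℤ) (_ : β = 0 ∨ (β ∈ rootSystem (removeVertex Γ x₀) ∧ β ≤ 0))
      (_ : δ + extendWeight β = μ),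
    (B.weightSpace K β).map (fromQuotient B K))

end Affine

end Extremal

end

open scoped TensorProduct

noncomputable section

namespace Extremal

/-! ### The bilinear form of a graph -/

section Form

variable {V : Type*} [Fintype V] [DecidableEq V] (Γ : SimpleGraph V) [DecidableRel Γ.Adj]

/-! The dimension of `L(0)` is bounded above using the relations, and a surjection onto `u` attains
the bound.

Each diagram carries a positive vector `δ` in the kernel of its Cartan matrix with `δ x₀ = 1`.
Writing the form as a sum of squares (`IsAffine.two_mul_form`) shows that it is positive
semidefinite with radical `ℤδ`. Hence the form of `Γ⁰` is positive definite, and its roots are the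
vectors of norm 2. The vectors of norm at most 2 between `0` and `δ`, other than `0`, are the
positive roots of `Γ⁰`, the vectors `δ + β` with `β` a negative root, and `δ` itself. These are the
weights of `u`.

Upper bound: in characteristic other than 2, prefixing the letter `x` to a monomial of weight `ν`
gives zero unless `⟨α_x, ν⟩ ≤ -1` (`lieMonomial_pairing`). So only the weights above support nonzero
monomials. If `⟨α_x, μ⟩ = 1`, the component of real weight `μ` is the image of the component of
weight `μ - α_x` under `ad x` (`weightSpace_le_map`), so by descent it is at most a line. The
component of weight `δ` is spanned by brackets `[x, L_{δ - α_x}]` with `x ≠ x₀`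
(`weightSpace_delta_le`). The total is at most `|Π⁰| + |Φ⁰| = dim g = dim u`.

Lower bound: the proposed generators of `u` satisfy the sandwich relations
(`sandwichRelations_targetGen`). The double bracket with `E_x` sends `E_{-α_x}` to a multiple of
`E_x`, which dies in `g/n_+`. The element attached to `x₀` lies in an abelian ideal. The resulting
morphism reaches every basis vector because the structure constants between roots are `±1`, so it is
surjective and then bijective by dimension. The same computation matches the gradings.

The complex algebra enters through its Chevalley bases. A model on `ℂ^I ⊕ ℂ^Root` with signs given
by a bimultiplicative cocycle is a Lie algebra satisfying the Serre relations, so the Kac-Moody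
algebra maps to it. An `sl₂` argument shows that the nonzero weights of the Kac-Moody algebra are
vectors of norm 2 with one-dimensional weight spaces (`SerreRelations.weightSpace_ne_zero`). Hence
the map is injective, `rootSystem = Root` (`rootSystem_eq`), and a sign change in the model's basis
yields a Chevalley basis. -/

/-- The symmetric bilinear form of the Cartan matrix of a graph. -/
def form : LinearMap.BilinForm ℤ (V → ℤ) := Matrix.toBilin' (cartanMatrix Γ)

/-- The simple root at a vertex. -/
abbrev simple (x : V) : V → ℤ := Pi.single x 1

theorem form_eq_sum (u v : V → ℤ) :
    form Γ u v = ∑ x, u x * (cartanMatrix Γ).mulVec v x := by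
  simp [form, Matrix.toBilin'_apply', dotProduct]

theorem form_simple_left (x : V) (v : V → ℤ) :
    form Γ (simple x) v = (cartanMatrix Γ).mulVec v x := by
  simp [form_eq_sum, Pi.single_apply]

theorem form_eq_sum_simple (u v : V → ℤ) : form Γ u v = ∑ x, u x * form Γ (simple x) v := by
  simp only [form_simple_left]
  exact form_eq_sum Γ u v

theorem mulVec_cartanMatrix (v : V → ℤ) (x : V) :
    (cartanMatrix Γ).mulVec v x = 2 * v x - ∑ y, if Γ.Adj x y then v y else 0 := by
  have h : ∀ y, cartanMatrix Γ x y * v y =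
      (if x = y then 2 * v y else 0) - (if Γ.Adj x y then v y else 0) := by
    intro y
    by_cases hxy : x = y
    · subst hxy; simp [cartanMatrix]
    · by_cases ha : Γ.Adj x y <;> simp [cartanMatrix, hxy, ha]
  simp [Matrix.mulVec, dotProduct, h, Finset.sum_sub_distrib]

theorem form_simple_eq (x : V) (v : V → ℤ) :
    form Γ (simple x) v = 2 * v x - ∑ y, if Γ.Adj x y then v y else 0 := by
  rw [form_simple_left, mulVec_cartanMatrix]

theorem form_simple_simple (x y : V) : form Γ (simple x) (simple y) = cartanMatrix Γ x y := by
  simp [form_simple_left]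

theorem form_simple_self (x : V) : form Γ (simple x) (simple x) = 2 := by
  simp [form_simple_left, cartanMatrix]

theorem form_simple_adj {x y : V} (h : Γ.Adj x y) : form Γ (simple x) (simple y) = -1 := by
  simp [form_simple_simple, cartanMatrix, h, h.ne]

theorem form_simple_not_adj {x y : V} (hne : x ≠ y) (h : ¬ Γ.Adj x y) :
    form Γ (simple x) (simple y) = 0 := by
  simp [form_simple_simple, cartanMatrix, h, hne]

theorem form_comm (u v : V → ℤ) : form Γ u v = form Γ v u := by
  have h : (cartanMatrix Γ).transpose = cartanMatrix Γ := by
    ext x y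
    simp [cartanMatrix, Γ.adj_comm, eq_comm]
  simp only [form, Matrix.toBilin'_apply']
  rw [Matrix.dotProduct_mulVec, ← Matrix.mulVec_transpose, h, dotProduct_comm]

theorem form_add_self (u v : V → ℤ) :
    form Γ (u + v) (u + v) = form Γ u u + 2 * form Γ u v + form Γ v v := by
  simp only [map_add, LinearMap.add_apply, form_comm Γ v u]; ring

theorem form_sub_self (u v : V → ℤ) :
    form Γ (u - v) (u - v) = form Γ u u - 2 * form Γ u v + form Γ v v := by
  simp only [map_sub, LinearMap.sub_apply, form_comm Γ v u]; ring

/-- The form is the symmetrization of an integral bilinear form. -/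
theorem exists_half_form : ∃ B : LinearMap.BilinForm ℤ (V → ℤ),
    ∀ u v, B u v + B v u = form Γ u v := by
  classical
  -- Ordering the vertices counts each edge in one triangular half only. The diagonal entry `1`
  -- makes norms even and later gives the cocycle the value `-1` on a pair of equal roots.
  let e := Fintype.equivFin V
  let M : Matrix V V ℤ := Matrix.of fun x y =>
    if x = y then 1 else if Γ.Adj x y ∧ e x < e y then -1 else 0
  refine ⟨Matrix.toBilin' M, fun u v => ?_⟩
  have h : M + M.transpose = cartanMatrix Γ := by
    ext x y
    by_cases hxy : x = y
    · subst hxy; simp [M, cartanMatrix]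
    · have hne : e x ≠ e y := fun h => hxy (e.injective h)
      by_cases ha : Γ.Adj x y
      · rcases lt_or_gt_of_ne hne with h | h <;>
          simp [M, cartanMatrix, hxy, Ne.symm hxy, ha, ha.symm, h, h.not_gt]
      · have ha' : ¬ Γ.Adj y x := fun h => ha h.symm
        simp [M, cartanMatrix, hxy, Ne.symm hxy, ha, ha']
  simp only [form, Matrix.toBilin'_apply', ← h, Matrix.add_mulVec, dotProduct_add]
  rw [Matrix.mulVec_transpose, ← Matrix.dotProduct_mulVec v M u |>.trans (dotProduct_comm _ _)]

theorem even_form_self (v : V → ℤ) : Even (form Γ v v) := by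
  obtain ⟨B, hB⟩ := exists_half_form Γ
  exact ⟨B v v, (hB v v).symm⟩

theorem form_simple_nonpos {v : V → ℤ} (hv : 0 ≤ v) {x : V} (hx : v x = 0) :
    form Γ (simple x) v ≤ 0 := by
  rw [form_simple_eq, hx]
  have : 0 ≤ ∑ y, if Γ.Adj x y then v y else 0 :=
    Finset.sum_nonneg fun y _ => by split_ifs; exacts [hv y, le_rfl]
  omega

theorem form_nonpos_of_disjoint {u v : V → ℤ} (hu : 0 ≤ u) (hv : 0 ≤ v)
    (h : ∀ x, u x = 0 ∨ v x = 0) : form Γ u v ≤ 0 := by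
  rw [form_eq_sum_simple]
  refine Finset.sum_nonpos fun x _ => ?_
  rcases h x with h | h
  · simp [h]
  · exact mul_nonpos_of_nonneg_of_nonpos (hu x) (form_simple_nonpos Γ hv h)

/-- The norm is the sum of the pairings with simple roots, weighted by the nonnegative coordinates
of `v`, so some term is positive. This supplies the simple root removed in each descent below. -/
theorem exists_form_simple_pos {v : V → ℤ} (hv : 0 ≤ v) (h : 0 < form Γ v v) :
    ∃ x, 0 < v x ∧ 0 < form Γ (simple x) v := by
  by_contra! hc
  rw [form_eq_sum_simple] at h
  refine absurd h (not_lt.mpr (Finset.sum_nonpos fun x _ => ?_))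
  rcases (hv x).lt_or_eq with h' | h'
  · exact mul_nonpos_of_nonneg_of_nonpos (hv x) (hc x h')
  · simp [← h']

/-- In the positive semidefinite case, one of the parts of a root is isotropic. -/
theorem form_posPart_or_negPart (hpsd : ∀ v, 0 ≤ form Γ v v) {v : V → ℤ}
    (hv : form Γ v v ≤ 2) : form Γ v⁺ v⁺ = 0 ∨ form Γ v⁻ v⁻ = 0 := by
  have h1 := form_sub_self Γ v⁺ v⁻
  rw [posPart_sub_negPart] at h1
  -- Disjoint supports make the cross term nonpositive, so the norms of the two parts add up to at
  -- most 2. Both are even and nonnegative, so one is zero.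
  have h2 : form Γ v⁺ v⁻ ≤ 0 := by
    refine form_nonpos_of_disjoint Γ (posPart_nonneg v) (negPart_nonneg v) fun x => ?_
    simp only [Pi.posPart_apply, Pi.negPart_apply, posPart_eq_zero, negPart_eq_zero]
    exact le_total _ _
  have h3 := hpsd v⁺
  have h4 := hpsd v⁻
  obtain ⟨a, ha⟩ := even_form_self Γ v⁺
  obtain ⟨b, hb⟩ := even_form_self Γ v⁻
  omega

end Form

/-! ### Roots of a positive definite graph -/

section PosDef

variable {V : Type*} [Fintype V] [DecidableEq V] (Γ : SimpleGraph V) [DecidableRel Γ.Adj]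

/-- The form of the graph is positive definite. -/
def IsPosDef : Prop := ∀ v : V → ℤ, v ≠ 0 → 0 < form Γ v v

/-- The vectors of norm `2`. -/
def Root : Set (V → ℤ) := {v | form Γ v v = 2}

variable {Γ}

theorem simple_mem_root (x : V) : simple x ∈ Root Γ := form_simple_self Γ x

theorem neg_mem_root {v : V → ℤ} (h : v ∈ Root Γ) : -v ∈ Root Γ := by
  simpa [Root] using h

theorem ne_zero_of_mem_root {v : V → ℤ} (h : v ∈ Root Γ) : v ≠ 0 := by
  rintro rfl; simp [Root] at h

/-- The norm of `u + v` is `4 + 2⟨u, v⟩`. Questions about which sums are roots thus become questions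
about values of the form. -/
theorem add_mem_root_iff {u v : V → ℤ} (hu : u ∈ Root Γ) (hv : v ∈ Root Γ) :
    u + v ∈ Root Γ ↔ form Γ u v = -1 := by
  simp only [Root, Set.mem_ofPred_eq] at *
  rw [form_add_self, hu, hv]; omega

theorem sub_mem_root_iff {u v : V → ℤ} (hu : u ∈ Root Γ) (hv : v ∈ Root Γ) :
    u - v ∈ Root Γ ↔ form Γ u v = 1 := by
  simp only [Root, Set.mem_ofPred_eq] at *
  rw [form_sub_self, hu, hv]; omega

namespace IsPosDef

variable (h : IsPosDef Γ)
include h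

theorem eq_zero {v : V → ℤ} (hv : form Γ v v ≤ 0) : v = 0 := by
  by_contra hc
  exact absurd (h v hc) (not_lt.mpr hv)

theorem nonneg (v : V → ℤ) : 0 ≤ form Γ v v := by
  by_cases hv : v = 0
  · simp [hv]
  · exact (h v hv).le

theorem root_nonneg_or_nonpos {v : V → ℤ} (hv : v ∈ Root Γ) : 0 ≤ v ∨ v ≤ 0 := by
  rcases form_posPart_or_negPart Γ h.nonneg (le_of_eq hv) with h1 | h1
  · exact Or.inr (posPart_eq_zero.mp (h.eq_zero h1.le))
  · exact Or.inl (negPart_eq_zero.mp (h.eq_zero h1.le))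

theorem add_eq_zero_iff {u v : V → ℤ} (hu : u ∈ Root Γ) (hv : v ∈ Root Γ) :
    u + v = 0 ↔ form Γ u v = -2 := by
  simp only [Root, Set.mem_ofPred_eq] at *
  have h1 := form_add_self Γ u v
  refine ⟨fun h0 => ?_, fun h0 => h.eq_zero (by omega)⟩
  rw [h0] at h1
  simp at h1; omega

theorem sub_eq_zero_iff {u v : V → ℤ} (hu : u ∈ Root Γ) (hv : v ∈ Root Γ) :
    u = v ↔ form Γ u v = 2 := by
  have := h.add_eq_zero_iff hu (neg_mem_root hv)
  rw [← sub_eq_add_neg, sub_eq_zero] at this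
  rw [this]; simp

theorem form_le_two {u v : V → ℤ} (hu : u ∈ Root Γ) (hv : v ∈ Root Γ) : form Γ u v ≤ 2 := by
  have h1 := form_sub_self Γ u v
  have h2 := h.nonneg (u - v)
  simp only [Root, Set.mem_ofPred_eq] at *
  omega

theorem neg_two_le_form {u v : V → ℤ} (hu : u ∈ Root Γ) (hv : v ∈ Root Γ) :
    -2 ≤ form Γ u v := by
  have := h.form_le_two hu (neg_mem_root hv)
  simp at this; omega

/-- A positive root that is not simple is the sum of a simple root and a positive root. -/
theorem exists_sub_simple {v : V → ℤ} (hv : v ∈ Root Γ) (h0 : 0 ≤ v)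
    (hs : ∀ x, v ≠ simple x) : ∃ x, v - simple x ∈ Root Γ ∧ 0 ≤ v - simple x := by
  obtain ⟨x, hx, hf⟩ := exists_form_simple_pos Γ h0 (by rw [hv]; norm_num)
  have h1 : form Γ (simple x) v ≤ 2 := h.form_le_two (simple_mem_root x) hv
  -- Two roots that pair to 2 are equal, which `hs` excludes. The pairing is therefore 1 and the
  -- difference is a root.
  have h2 : form Γ (simple x) v ≠ 2 := fun hc =>
    hs x ((h.sub_eq_zero_iff (simple_mem_root x) hv).mpr hc).symm
  refine ⟨x, (sub_mem_root_iff hv (simple_mem_root x)).mpr (by rw [form_comm]; omega),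
    fun y => ?_⟩
  by_cases hy : y = x
  · subst hy; simp; omega
  · simpa [hy] using h0 y

end IsPosDef

end PosDef

/-! ### Affine graphs -/

/-- A connected graph with a positive vector in the kernel of its Cartan matrix, whose coefficient
at `x₀` is `1`. -/
structure IsAffine {V : Type*} [Fintype V] [DecidableEq V] (Γ : SimpleGraph V)
    [DecidableRel Γ.Adj] (x₀ : V) (δ : V → ℤ) : Prop where
  pos (x : V) : 0 < δ x
  form_simple (x : V) : form Γ (simple x) δ = 0
  base : δ x₀ = 1
  preconnected : Γ.Preconnected

/-! ### Semidefiniteness and radical of an affine graph. -/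

namespace IsAffine

variable {V : Type*} [Fintype V] [DecidableEq V] {Γ : SimpleGraph V} [DecidableRel Γ.Adj]
  {x₀ : V} {δ : V → ℤ} (h : IsAffine Γ x₀ δ)
include h

theorem form_left (v : V → ℤ) : form Γ v δ = 0 := by
  rw [form_eq_sum_simple]; simp [h.form_simple]

theorem form_right (v : V → ℤ) : form Γ δ v = 0 := by
  rw [form_comm, h.form_left]

/-- Expanding the squares, the kernel equation `∑_{y ~ x} δ y = 2 δ x` turns the diagonal terms into
multiples of `v x ^ 2`. The factor 2 on the left appears because every edge is counted in both
directions. -/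
theorem two_mul_form (v : V → ℤ) : (2 * form Γ v v : ℚ) =
    ∑ x, ∑ y, if Γ.Adj x y then
      (δ x * δ y : ℚ) * ((v x : ℚ) / δ x - (v y : ℚ) / δ y) ^ 2 else 0 := by
  have hne : ∀ x, (δ x : ℚ) ≠ 0 := fun x => by exact_mod_cast (h.pos x).ne'
  have hδ : ∀ x, ∑ y, (if Γ.Adj x y then (δ y : ℚ) else 0) = 2 * δ x := fun x => by
    have := h.form_simple x
    rw [form_simple_eq] at this
    have h2 : (∑ y, if Γ.Adj x y then δ y else 0) = 2 * δ x := by omega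
    have h3 := congrArg (Int.cast : ℤ → ℚ) h2
    push_cast at h3
    exact h3
  have hsq : ∑ x, ∑ y, (if Γ.Adj x y then (v x : ℚ) ^ 2 / δ x * δ y else 0) =
      2 * ∑ x, (v x : ℚ) ^ 2 := by
    rw [Finset.mul_sum]
    refine Finset.sum_congr rfl fun x _ => ?_
    have : ∀ y, (if Γ.Adj x y then (v x : ℚ) ^ 2 / δ x * δ y else 0) =
        (v x : ℚ) ^ 2 / δ x * (if Γ.Adj x y then (δ y : ℚ) else 0) := fun y => by
      split_ifs <;> simp
    simp only [this, ← Finset.mul_sum, hδ]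
    field_simp [hne x]
  have hsq' : ∑ x, ∑ y, (if Γ.Adj x y then (v y : ℚ) ^ 2 / δ y * δ x else 0) =
      2 * ∑ x, (v x : ℚ) ^ 2 := by
    rw [Finset.sum_comm, ← hsq]
    simp only [Γ.adj_comm]
  have hterm : ∀ x y, (if Γ.Adj x y then
      (δ x * δ y : ℚ) * ((v x : ℚ) / δ x - (v y : ℚ) / δ y) ^ 2 else 0) =
      (if Γ.Adj x y then (v x : ℚ) ^ 2 / δ x * δ y else 0) +
      (if Γ.Adj x y then (v y : ℚ) ^ 2 / δ y * δ x else 0) -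
      2 * (v x * (if Γ.Adj x y then (v y : ℚ) else 0)) := fun x y => by
    have h1 := hne x
    have h2 := hne y
    split_ifs
    · field_simp; ring
    · simp
  simp only [hterm, Finset.sum_sub_distrib, Finset.sum_add_distrib, hsq, hsq', ← Finset.mul_sum]
  rw [form_eq_sum_simple]
  simp only [form_simple_eq]
  push_cast
  simp only [mul_sub, Finset.sum_sub_distrib]
  have : ∑ x, (v x : ℚ) * (2 * v x) = 2 * ∑ x, (v x : ℚ) ^ 2 := by
    rw [Finset.mul_sum]; exact Finset.sum_congr rfl fun x _ => by ring
  rw [this]; ring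

theorem term_nonneg (v : V → ℤ) (x y : V) : 0 ≤ (if Γ.Adj x y then
      (δ x * δ y : ℚ) * ((v x : ℚ) / δ x - (v y : ℚ) / δ y) ^ 2 else 0) := by
  have h1 : (0 : ℚ) < δ x := by exact_mod_cast h.pos x
  have h2 : (0 : ℚ) < δ y := by exact_mod_cast h.pos y
  split_ifs <;> positivity

theorem nonneg (v : V → ℤ) : 0 ≤ form Γ v v := by
  have h1 := h.two_mul_form v
  have h2 : (0 : ℚ) ≤ 2 * form Γ v v := by
    rw [h1]
    exact Finset.sum_nonneg fun x _ => Finset.sum_nonneg fun y _ => h.term_nonneg v x y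
  have h3 : (0 : ℤ) ≤ 2 * form Γ v v := by exact_mod_cast h2
  omega

/-- All squares in `two_mul_form` vanish, so `v / δ` is constant along edges and hence on the
connected graph. Since `δ x₀ = 1`, the constant is the integer `v x₀`. -/
theorem eq_smul {v : V → ℤ} (hv : form Γ v v ≤ 0) : v = v x₀ • δ := by
  have h0 : form Γ v v = 0 := le_antisymm hv (h.nonneg v)
  have h1 := h.two_mul_form v
  rw [h0, Int.cast_zero, mul_zero] at h1
  have h2 : ∀ x y, Γ.Adj x y → (v x : ℚ) / δ x = (v y : ℚ) / δ y := by
    intro x y hxy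
    have h3 := (Finset.sum_eq_zero_iff_of_nonneg fun x _ =>
      Finset.sum_nonneg fun y _ => h.term_nonneg v x y).mp h1.symm x (Finset.mem_univ x)
    have h4 := (Finset.sum_eq_zero_iff_of_nonneg fun y _ =>
      h.term_nonneg v x y).mp h3 y (Finset.mem_univ y)
    rw [if_pos hxy] at h4
    have h5 : (δ x : ℚ) ≠ 0 := by exact_mod_cast (h.pos x).ne'
    have h6 : (δ y : ℚ) ≠ 0 := by exact_mod_cast (h.pos y).ne'
    have h7 := (mul_eq_zero.mp h4).resolve_left (mul_ne_zero h5 h6)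
    exact sub_eq_zero.mp (pow_eq_zero_iff two_ne_zero |>.mp h7)
  have h3 : ∀ x y, Γ.Reachable x y → (v x : ℚ) / δ x = (v y : ℚ) / δ y := by
    rintro x y ⟨p⟩
    induction p with
    | nil => rfl
    | cons ha _ ih => exact (h2 _ _ ha).trans ih
  funext x
  have h4 := h3 x x₀ (h.preconnected x x₀)
  have h5 : (δ x : ℚ) ≠ 0 := by exact_mod_cast (h.pos x).ne'
  rw [h.base, Int.cast_one, div_one, div_eq_iff h5] at h4
  simpa using (by exact_mod_cast h4 : v x = v x₀ * δ x)

theorem isNullRoot : IsNullRoot Γ δ where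
  nonneg x := (h.pos x).le
  mulVec_eq_zero := by
    funext x
    rw [← form_simple_left, h.form_simple]; rfl
  span v hv := ⟨v x₀, h.eq_smul (by rw [form_eq_sum, hv]; simp)⟩
  primitive d hd := isUnit_of_dvd_one (h.base ▸ hd x₀)

/-- In contrast to the definite case, the isotropic part may be a nonzero multiple of `δ`. It then
has full support, which forces the other part to vanish. -/
theorem root_nonneg_or_nonpos {v : V → ℤ} (hv : v ∈ Root Γ) : 0 ≤ v ∨ v ≤ 0 := by
  have key : ∀ u w : V → ℤ, (∀ x, u x = 0 ∨ w x = 0) → 0 ≤ u → form Γ u u = 0 →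
      u = 0 ∨ w = 0 := by
    intro u w hd hu h0
    have h1 := h.eq_smul h0.le
    by_cases hc : u x₀ = 0
    · left; rw [h1, hc, zero_smul]
    · right
      funext x
      refine (hd x).resolve_left ?_
      rw [h1]
      exact mul_ne_zero hc (h.pos x).ne'
  have hd : ∀ x, v⁺ x = 0 ∨ v⁻ x = 0 := fun x => by
    simp only [Pi.posPart_apply, Pi.negPart_apply, posPart_eq_zero, negPart_eq_zero]
    exact le_total _ _
  have : v⁺ = 0 ∨ v⁻ = 0 := by
    rcases form_posPart_or_negPart Γ h.nonneg (le_of_eq hv) with h1 | h1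
    · exact key _ _ hd (posPart_nonneg v) h1
    · exact (key _ _ (fun x => (hd x).symm) (negPart_nonneg v) h1).symm
  rw [posPart_eq_zero, negPart_eq_zero] at this
  exact this.symm

theorem sub_mem_root {u : V → ℤ} : δ - u ∈ Root Γ ↔ u ∈ Root Γ := by
  simp [Root, h.form_left, h.form_right]

end IsAffine

/-- The vectors of norm at most `2` between `0` and `δ`, without `0`: the weights of the sandwich
algebra. -/
structure IsSandwichWeight {V : Type*} [Fintype V] [DecidableEq V] (Γ : SimpleGraph V)
    [DecidableRel Γ.Adj] (δ β : V → ℤ) : Prop where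
  nonneg : 0 ≤ β
  le : β ≤ δ
  ne_zero : β ≠ 0
  form_le : form Γ β β ≤ 2

/-! ### Adding and removing simple roots among the sandwich weights. -/

namespace IsAffine

variable {V : Type*} [Fintype V] [DecidableEq V] {Γ : SimpleGraph V} [DecidableRel Γ.Adj]
  {x₀ : V} {δ : V → ℤ} (h : IsAffine Γ x₀ δ)
include h

theorem simple_le (x : V) : simple x ≤ δ := by
  intro y
  by_cases hy : y = x
  · subst hy; simpa using Int.add_one_le_iff.mpr (h.pos y)
  · simpa [hy] using (h.pos y).le

theorem isSandwichWeight_simple (x : V) : IsSandwichWeight Γ δ (simple x) where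
  nonneg := Pi.single_nonneg.mpr zero_le_one
  le := h.simple_le x
  ne_zero := ne_zero_of_mem_root (simple_mem_root (Γ := Γ) x)
  form_le := (form_simple_self Γ x).le

/-- The norm changes by `2 + 2⟨α_x, β⟩ ≤ 0`. The upper bound could fail only if `β x = δ x`; then `δ
- β ≥ 0` vanishes at `x`, so `⟨α_x, δ - β⟩ ≤ 0`, which contradicts the negative pairing because `δ`
is in the radical. -/
theorem isSandwichWeight_add {β : V → ℤ} (hβ : IsSandwichWeight Γ δ β) {x : V}
    (hx : form Γ (simple x) β ≤ -1) : IsSandwichWeight Γ δ (β + simple x) where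
  nonneg := add_nonneg hβ.nonneg (Pi.single_nonneg.mpr zero_le_one)
  le y := by
    by_cases hy : y = x
    · subst hy
      rcases (hβ.le y).lt_or_eq with h1 | h1
      · simpa using h1
      · exfalso
        have h2 := form_simple_nonpos Γ (v := δ - β) (sub_nonneg.mpr hβ.le) (x := y)
          (by simp [h1])
        rw [map_sub, h.form_simple] at h2
        omega
    · simpa [hy] using hβ.le y
  ne_zero hc := by
    have := congrFun hc x
    have h1 := hβ.nonneg x
    simp at this h1
    omega
  form_le := by
    have h1 := hβ.form_le
    rw [form_add_self, form_simple_self, form_comm Γ β (simple x)]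
    omega

/-- The norm is even, so it is 2 or 0. An isotropic `β` is `β x₀` times `δ`, where `β x₀` is 0 or 1.
-/
theorem sandwichWeight_cases {β : V → ℤ} (hβ : IsSandwichWeight Γ δ β) :
    β ∈ Root Γ ∨ β = δ := by
  have h1 := h.nonneg β
  have h2 := hβ.form_le
  obtain ⟨a, ha⟩ := even_form_self Γ β
  rcases (by omega : form Γ β β = 2 ∨ form Γ β β ≤ 0) with h3 | h3
  · exact Or.inl h3
  · right
    have h4 := h.eq_smul h3
    have h5 := hβ.nonneg x₀
    have h6 : β x₀ ≤ 1 := (hβ.le x₀).trans h.base.le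
    change 0 ≤ β x₀ at h5
    rcases (by omega : β x₀ = 0 ∨ β x₀ = 1) with h7 | h7
    · rw [h7, zero_smul] at h4; exact absurd h4 hβ.ne_zero
    · rw [h7, one_smul] at h4; exact h4

/-- There are at least three vertices. -/
theorem exists_third (x y : V) : ∃ z, z ≠ x ∧ z ≠ y := by
  by_contra! hc
  -- If `b` were the only possible vertex besides `a`, the kernel equation at `a` would give `2 δ a
  -- ≤ δ b`. Applying this both ways contradicts positivity.
  have key : ∀ a b : V, (∀ z, z ≠ a → z = b) → 2 * δ a ≤ δ b := by
    intro a b hab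
    have h1 := h.form_simple a
    rw [form_simple_eq] at h1
    have h2 : (∑ y, if Γ.Adj a y then δ y else 0) ≤ ∑ y, if y = b then δ y else 0 := by
      refine Finset.sum_le_sum fun z _ => ?_
      by_cases hz : Γ.Adj a z
      · rw [if_pos hz, if_pos (hab z hz.ne')]
      · rw [if_neg hz]; split_ifs; exacts [(h.pos z).le, le_rfl]
    simp at h2
    omega
  have h1 := key x y hc
  have h2 := key y x fun z hz => by
    by_contra h3; exact hz (hc z h3)
  have h3 := h.pos x
  have h4 := h.pos y
  omega

/-- The sum of two adjacent simple roots is the only weight of the sandwich algebra that pairs to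
`1` with both. -/
theorem eq_add_of_adj {β : V → ℤ} (hβ : IsSandwichWeight Γ δ β) (hr : β ∈ Root Γ) {x y : V}
    (hxy : Γ.Adj x y) (hx : form Γ (simple x) β = 1) (hy : form Γ (simple y) β = 1) :
    β = simple x + simple y := by
  -- The difference is isotropic, hence `c • δ`. At a third vertex, `0 ≤ β` gives `c ≥ 0`. At `x`,
  -- the bound `β ≤ δ` reads `1 + c δ x ≤ δ x` and gives `c ≤ 0`.
  have h1 : form Γ (β - (simple x + simple y)) (β - (simple x + simple y)) = 0 := by
    rw [form_sub_self, form_add_self, form_simple_self, form_simple_self, form_simple_adj Γ hxy,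
      map_add, form_comm Γ β (simple x), form_comm Γ β (simple y), hx, hy, hr]
    norm_num
  have h2 := h.eq_smul h1.le
  set c := (β - (simple x + simple y)) x₀
  have h3 : ∀ z, β z = simple x z + simple y z + c * δ z := fun z => by
    have := congrFun h2 z
    simp only [Pi.sub_apply, Pi.add_apply, Pi.smul_apply, smul_eq_mul] at this
    omega
  obtain ⟨z, hzx, hzy⟩ := h.exists_third x y
  have h4 := h3 z
  have h5 := h3 x
  have h6 := hβ.nonneg z
  have h7 := hβ.le x
  have h8 := h.pos x
  have h9 := h.pos z
  simp only [Pi.single_apply, hzx, hzy, if_false, if_true, hxy.ne, Pi.zero_apply] at h4 h5 h6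
  have h10 : 0 ≤ c := by by_contra hc; push Not at hc; nlinarith
  have h11 : c ≤ 0 := by by_contra hc; push Not at hc; nlinarith
  have h12 : c = 0 := le_antisymm h11 h10
  funext z
  simp [h3 z, h12]

/-- A weight that is not simple and not `δ` is the sum of a weight and a simple root. -/
theorem exists_sub_simple {β : V → ℤ} (hβ : IsSandwichWeight Γ δ β) (hr : β ∈ Root Γ)
    (hs : ∀ x, β ≠ simple x) : ∃ x, form Γ (simple x) β = 1 ∧
      IsSandwichWeight Γ δ (β - simple x) ∧ β - simple x ∈ Root Γ := by
  obtain ⟨x, hx, hf⟩ := exists_form_simple_pos Γ hβ.nonneg (by rw [hr]; norm_num)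
  have h1 : form Γ (β - simple x) (β - simple x) = 4 - 2 * form Γ (simple x) β := by
    rw [form_sub_self, hr, form_simple_self, form_comm]; ring
  have h2 := h.nonneg (β - simple x)
  have hlo : 0 ≤ β - simple x := fun y => by
    by_cases hy : y = x
    · subst hy; simp; omega
    · simpa [hy] using hβ.nonneg y
  -- Semidefiniteness bounds the pairing by 2. With pairing 2 the difference `β - α_x` would be a
  -- multiple of `δ`, and `β ≤ δ` allows only the multiple 0, making `β` simple.
  have hx1 : form Γ (simple x) β = 1 := by
    rcases (by omega : form Γ (simple x) β = 1 ∨ form Γ (simple x) β = 2) with h3 | h3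
    · exact h3
    · exfalso
      have h4 := h.eq_smul (v := β - simple x) (by omega)
      have h5 := congrFun h4 x
      have h6 := hβ.le x
      have h7 := h.pos x
      have h8 : 0 ≤ (β - simple x) x₀ := hlo x₀
      simp only [Pi.sub_apply, Pi.smul_apply, smul_eq_mul, Pi.single_eq_same] at h5 h8
      have h9 : (β - simple x) x₀ = 0 := by
        simp only [Pi.sub_apply]
        by_contra hc
        have : 1 ≤ β x₀ - simple x x₀ := by omega
        nlinarith
      rw [h9, zero_smul, sub_eq_zero] at h4
      exact hs x h4
  refine ⟨x, hx1, ⟨hlo, (sub_le_self _ (Pi.single_nonneg.mpr zero_le_one)).trans hβ.le,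
    fun hc => hs x (sub_eq_zero.mp hc), by omega⟩, ?_⟩
  change form Γ (β - simple x) (β - simple x) = 2
  omega

end IsAffine

/-! ### The finite diagram of an affine diagram -/

section ExtendWeight

variable {V : Type*} [DecidableEq V] {x₀ : V}

@[simp] theorem extendWeight_coe (β : Removed x₀ → ℤ) (x : Removed x₀) :
    extendWeight β x.1 = β x := by
  simp [extendWeight, x.2]

@[simp] theorem extendWeight_base (β : Removed x₀ → ℤ) : extendWeight β x₀ = 0 := by
  simp [extendWeight]

theorem eq_extendWeight {v : V → ℤ} (hv : v x₀ = 0) :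
    v = extendWeight (fun x : Removed x₀ => v x.1) := by
  funext x
  by_cases hx : x = x₀
  · subst hx; simp [hv]
  · exact (extendWeight_coe (fun x : Removed x₀ => v x.1) ⟨x, hx⟩).symm

theorem extendWeight_injective :
    Function.Injective (extendWeight : (Removed x₀ → ℤ) → V → ℤ) := fun u v huv => by
  funext x
  rw [← extendWeight_coe u, huv, extendWeight_coe]

theorem extendWeight_add (u v : Removed x₀ → ℤ) :
    extendWeight (u + v) = extendWeight u + extendWeight v := by
  funext x
  by_cases hx : x = x₀ <;> simp [extendWeight, hx]

theorem extendWeight_neg (u : Removed x₀ → ℤ) : extendWeight (-u) = -extendWeight u := by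
  funext x
  by_cases hx : x = x₀ <;> simp [extendWeight, hx]

@[simp] theorem extendWeight_zero : extendWeight (0 : Removed x₀ → ℤ) = 0 := by
  funext x
  by_cases hx : x = x₀ <;> simp [extendWeight, hx]

theorem extendWeight_simple (x : Removed x₀) : extendWeight (simple x) = simple x.1 := by
  funext y
  by_cases hy : y = x₀
  · subst hy; simp [Ne.symm x.2]
  · simp [extendWeight, hy, Pi.single_apply, Subtype.ext_iff]

theorem extendWeight_nonneg {u : Removed x₀ → ℤ} : 0 ≤ extendWeight u ↔ 0 ≤ u := by
  refine ⟨fun h x => by simpa using h x.1, fun h x => ?_⟩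
  by_cases hx : x = x₀
  · subst hx; simp
  · exact (h ⟨x, hx⟩).trans_eq (extendWeight_coe u ⟨x, hx⟩).symm

theorem extendWeight_nonpos {u : Removed x₀ → ℤ} : extendWeight u ≤ 0 ↔ u ≤ 0 := by
  rw [← neg_nonneg, ← extendWeight_neg, extendWeight_nonneg, neg_nonneg]

variable [Fintype V] {Γ : SimpleGraph V} [DecidableRel Γ.Adj]

theorem form_extendWeight (u v : Removed x₀ → ℤ) :
    form Γ (extendWeight u) (extendWeight v) = form (removeVertex Γ x₀) u v := by
  have hsum : ∀ f : V → ℤ, f x₀ = 0 → ∑ x, f x = ∑ x : Removed x₀, f x.1 := fun f hf => by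
    rw [← Finset.sum_subtype {x | x ≠ x₀} (by simp) f]
    refine (Finset.sum_subset (Finset.subset_univ _) fun x _ hx => ?_).symm
    simp at hx
    rw [hx, hf]
  rw [form_eq_sum_simple, form_eq_sum_simple, hsum _ (by simp)]
  refine Finset.sum_congr rfl fun x _ => ?_
  rw [form_simple_eq, form_simple_eq, hsum _ (by simp)]
  simp [SimpleGraph.comap_adj]

theorem extendWeight_mem_root {u : Removed x₀ → ℤ} :
    extendWeight u ∈ Root Γ ↔ u ∈ Root (removeVertex Γ x₀) := by
  simp [Root, form_extendWeight]

end ExtendWeight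

/-! ### Finite roots inside the affine lattice. -/

namespace IsAffine

variable {V : Type*} [Fintype V] [DecidableEq V] {Γ : SimpleGraph V} [DecidableRel Γ.Adj]
  {x₀ : V} {δ : V → ℤ} (h : IsAffine Γ x₀ δ)
include h

/-- A vector of nonpositive norm is its coordinate at `x₀` times `δ`, and an extended vector has
coordinate 0 there. -/
theorem isPosDef : IsPosDef (removeVertex Γ x₀) := by
  intro v hv
  rw [← form_extendWeight]
  by_contra hc
  have h1 := h.eq_smul (not_lt.mp hc)
  rw [extendWeight_base, zero_smul] at h1
  exact hv (extendWeight_injective (h1.trans extendWeight_zero.symm))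

/-- `δ + u` is a root with coordinate 1 at `x₀`, so it is not nonpositive. Applied to `u` and `-u`,
this bounds all finite roots by `δ`. -/
theorem delta_add_nonneg {u : Removed x₀ → ℤ} (hu : u ∈ Root (removeVertex Γ x₀)) :
    0 ≤ δ + extendWeight u := by
  have h1 : δ + extendWeight u ∈ Root Γ := by
    rw [← sub_neg_eq_add, h.sub_mem_root]
    exact neg_mem_root (extendWeight_mem_root.mpr hu)
  refine (h.root_nonneg_or_nonpos h1).resolve_right fun hc => ?_
  have := hc x₀
  simp [h.base] at this

theorem extendWeight_le {u : Removed x₀ → ℤ} (hu : u ∈ Root (removeVertex Γ x₀)) :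
    extendWeight u ≤ δ := by
  have := h.delta_add_nonneg (neg_mem_root hu)
  rwa [extendWeight_neg, ← sub_eq_add_neg, sub_nonneg] at this

theorem finite_root : (Root (removeVertex Γ x₀)).Finite := by
  refine (Set.finite_Icc (fun x : Removed x₀ => -δ x.1) (fun x => δ x.1)).subset
    fun u hu => ⟨fun x => ?_, fun x => ?_⟩
  · have := h.delta_add_nonneg hu x.1
    simp at this
    change -δ x.1 ≤ u x
    omega
  · simpa using h.extendWeight_le hu x.1

/-- The lowest root. -/
theorem exists_lowest : ∃ θ : Removed x₀ → ℤ, extendWeight θ = simple x₀ - δ ∧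
    IsLeast (Root (removeVertex Γ x₀)) θ := by
  have h0 : (simple x₀ - δ) x₀ = 0 := by simp [h.base]
  have h1 := (eq_extendWeight h0).symm
  refine ⟨_, h1, ?_, fun u hu x => ?_⟩
  · rw [← extendWeight_mem_root, h1, ← neg_sub]
    exact neg_mem_root (h.sub_mem_root.mpr (simple_mem_root x₀))
  -- Away from `x₀` the candidate equals `-δ`, so minimality is the inequality `0 ≤ δ + u`.
  · have := h.delta_add_nonneg hu x.1
    simp only [Pi.zero_apply, Pi.add_apply, extendWeight_coe] at this
    have h2 : simple x₀ x.1 = 0 := by simp [x.2]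
    simp only [Pi.sub_apply, h2]; omega

theorem sandwichWeight_base {β : V → ℤ} (hβ : IsSandwichWeight Γ δ β) :
    β x₀ = 0 ∨ β x₀ = 1 := by
  have h1 : 0 ≤ β x₀ := hβ.nonneg x₀
  have h2 : β x₀ ≤ 1 := (hβ.le x₀).trans h.base.le
  omega

theorem isSandwichWeight_extendWeight {u : Removed x₀ → ℤ}
    (hu : u ∈ Root (removeVertex Γ x₀)) (h0 : 0 ≤ u) :
    IsSandwichWeight Γ δ (extendWeight u) where
  nonneg := extendWeight_nonneg.mpr h0
  le := h.extendWeight_le hu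
  ne_zero := ne_zero_of_mem_root (extendWeight_mem_root (Γ := Γ) |>.mpr hu)
  form_le := le_of_eq (extendWeight_mem_root (Γ := Γ) |>.mpr hu)

theorem delta_add_mem_root {u : Removed x₀ → ℤ} (hu : u ∈ Root (removeVertex Γ x₀)) :
    δ + extendWeight u ∈ Root Γ := by
  rw [← sub_neg_eq_add, h.sub_mem_root]
  exact neg_mem_root (extendWeight_mem_root.mpr hu)

theorem isSandwichWeight_delta_add {u : Removed x₀ → ℤ}
    (hu : u ∈ Root (removeVertex Γ x₀)) (h0 : u ≤ 0) :
    IsSandwichWeight Γ δ (δ + extendWeight u) where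
  nonneg := h.delta_add_nonneg hu
  le := add_le_of_nonpos_right (extendWeight_nonpos.mpr h0)
  ne_zero := ne_zero_of_mem_root (h.delta_add_mem_root hu)
  form_le := le_of_eq (h.delta_add_mem_root hu)

/-- The real weights of the sandwich algebra are the positive roots of the finite diagram and the
translates by `δ` of its negative roots. -/
theorem sandwichWeight_real {β : V → ℤ} (hβ : IsSandwichWeight Γ δ β) (hr : β ∈ Root Γ) :
    (∃ u ∈ Root (removeVertex Γ x₀), 0 ≤ u ∧ β = extendWeight u) ∨
      ∃ u ∈ Root (removeVertex Γ x₀), u ≤ 0 ∧ β = δ + extendWeight u := by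
  rcases h.sandwichWeight_base hβ with h0 | h0
  · left
    have h1 := eq_extendWeight h0
    exact ⟨_, extendWeight_mem_root.mp (h1 ▸ hr), extendWeight_nonneg.mp (h1 ▸ hβ.nonneg), h1⟩
  · right
    have h1 : (β - δ) x₀ = 0 := by simp [h0, h.base]
    have h2 := eq_extendWeight h1
    refine ⟨_, ?_, ?_, eq_add_of_sub_eq' h2⟩
    · rw [← extendWeight_mem_root, ← h2, ← neg_sub]
      exact neg_mem_root (h.sub_mem_root.mpr hr)
    · rw [← extendWeight_nonpos, ← h2]
      exact sub_nonpos.mpr hβ.le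

end IsAffine

/-! ### Monomials and generators -/

section Monomials

variable {R : Type*} [CommRing R] {ι L : Type*} [LieRing L] [LieAlgebra R L] (g : ι → L)

theorem lieMonomial_cons (i : ι) {w : List ι} (hw : w ≠ []) :
    lieMonomial g (i :: w) = ⁅g i, lieMonomial g w⁆ := by
  cases w with
  | nil => exact absurd rfl hw
  | cons j w => rfl

theorem map_lieMonomial {L' : Type*} [LieRing L'] [LieAlgebra R L'] (φ : L →ₗ⁅R⁆ L')
    (w : List ι) : φ (lieMonomial g w) = lieMonomial (fun i => φ (g i)) w := by
  induction w with
  | nil => exact map_zero φ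
  | cons i w ih =>
    rcases eq_or_ne w [] with rfl | hw
    · rfl
    · rw [lieMonomial_cons g i hw, lieMonomial_cons _ i hw, LieHom.map_lie, ih]

variable {M : Type*} [AddCommMonoid M] (wt : ι → M)

theorem lieMonomial_mem_weightSpace (w : List ι) :
    lieMonomial g w ∈ weightSpace R g wt (w.map wt).sum :=
  Submodule.subset_span ⟨w, rfl, rfl⟩

theorem gen_mem_weightSpace (i : ι) : g i ∈ weightSpace R g wt (wt i) := by
  simpa [lieMonomial] using lieMonomial_mem_weightSpace (R := R) g wt [i]

theorem lie_mem_weightSpace (i : ι) {μ : M} {z : L} (hz : z ∈ weightSpace R g wt μ) :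
    ⁅g i, z⁆ ∈ weightSpace R g wt (wt i + μ) := by
  induction hz using Submodule.span_induction with
  | zero => simp
  | add u v _ _ hu hv => rw [lie_add]; exact Submodule.add_mem _ hu hv
  | smul t u _ hu => rw [lie_smul]; exact Submodule.smul_mem _ _ hu
  | mem u hu =>
    obtain ⟨w, rfl, rfl⟩ := hu
    rcases eq_or_ne w [] with rfl | hw
    · simp [lieMonomial]
    · rw [← lieMonomial_cons g i hw]
      simpa using lieMonomial_mem_weightSpace (R := R) g wt (i :: w)

theorem lieMonomial_mem_of_closed (S : M → Submodule R L) (h1 : ∀ i, g i ∈ S (wt i))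
    (h2 : ∀ i μ, ∀ z ∈ S μ, ⁅g i, z⁆ ∈ S (wt i + μ)) (w : List ι) :
    lieMonomial g w ∈ S (w.map wt).sum := by
  induction w with
  | nil => exact Submodule.zero_mem _
  | cons i w ih =>
    rcases eq_or_ne w [] with rfl | hw
    · simpa [lieMonomial] using h1 i
    · rw [lieMonomial_cons g i hw, List.map_cons, List.sum_cons]
      exact h2 i _ _ ih

/-- This is the induction principle used in place of a grading: a property of weighted elements is
checked on the generators and under bracketing with them. -/
theorem weightSpace_le_of_closed (S : M → Submodule R L) (h1 : ∀ i, g i ∈ S (wt i))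
    (h2 : ∀ i μ, ∀ z ∈ S μ, ⁅g i, z⁆ ∈ S (wt i + μ)) (μ : M) :
    weightSpace R g wt μ ≤ S μ := by
  refine Submodule.span_le.mpr ?_
  rintro _ ⟨w, rfl, rfl⟩
  exact lieMonomial_mem_of_closed g wt S h1 h2 w

variable (R) in
/-- The elements `g i` generate the Lie algebra. -/
def Generates : Prop := LieSubalgebra.lieSpan R L (Set.range g) = ⊤

variable {g}

theorem Generates.eq_top_of_mem (hg : Generates R g) {S : LieSubalgebra R L}
    (hS : ∀ i, g i ∈ S) (z : L) : z ∈ S := by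
  have h : LieSubalgebra.lieSpan R L (Set.range g) ≤ S :=
    LieSubalgebra.lieSpan_le.mpr (Set.range_subset_iff.mpr hS)
  exact h (hg ▸ LieSubalgebra.mem_top z)

/-- The elements whose adjoint action preserves `S` form a subalgebra containing the generators,
hence everything. So `S` is itself a subalgebra containing the generators. -/
theorem Generates.mem_of_stable (hg : Generates R g) {S : Submodule R L}
    (h1 : ∀ i, g i ∈ S) (h2 : ∀ i, ∀ z ∈ S, ⁅g i, z⁆ ∈ S) (z : L) : z ∈ S := by
  let N : LieSubalgebra R L :=
    { carrier := {y | ∀ z ∈ S, ⁅y, z⁆ ∈ S}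
      zero_mem' := fun z _ => by simp
      add_mem' := fun {a b} ha hb z hz => by
        rw [add_lie]; exact S.add_mem (ha z hz) (hb z hz)
      smul_mem' := fun t a ha z hz => by
        rw [smul_lie]; exact S.smul_mem t (ha z hz)
      lie_mem' := fun {a b} ha hb z hz => by
        rw [lie_lie]; exact S.sub_mem (ha _ (hb z hz)) (hb _ (ha z hz)) }
  have hN : ∀ y, y ∈ N := hg.eq_top_of_mem h2
  let T : LieSubalgebra R L := { S with lie_mem' := fun {a b} _ hb => hN a b hb }
  exact hg.eq_top_of_mem (S := T) h1 z

theorem Generates.iSup_weightSpace (hg : Generates R g) (wt : ι → M) :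
    ⨆ μ, weightSpace R g wt μ = ⊤ := by
  rw [eq_top_iff]
  rintro z -
  refine hg.mem_of_stable (fun i => Submodule.mem_iSup_of_mem (wt i)
    (gen_mem_weightSpace g wt i)) (fun i z hz => ?_) z
  induction hz using Submodule.iSup_induction' with
  | mem μ z hz => exact Submodule.mem_iSup_of_mem _ (lie_mem_weightSpace g wt i hz)
  | zero => simp
  | add u v _ _ hu hv => rw [lie_add]; exact Submodule.add_mem _ hu hv

theorem Generates.map {L' : Type*} [LieRing L'] [LieAlgebra R L'] (hg : Generates R g)
    (φ : L →ₗ⁅R⁆ L') (hφ : Function.Surjective φ) : Generates R (fun i => φ (g i)) := by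
  rw [Generates, eq_top_iff]
  rintro z -
  obtain ⟨y, rfl⟩ := hφ z
  exact hg.eq_top_of_mem (S := (LieSubalgebra.lieSpan R L' (Set.range fun i => φ (g i))).comap φ)
    (fun i => LieSubalgebra.subset_lieSpan ⟨i, rfl⟩) y

/-- The universal property gives a map to the generated subalgebra. Its composite with the inclusion
fixes the generators, so it is the identity. -/
theorem generates_freeLieAlgebra (X : Type*) : Generates R (FreeLieAlgebra.of R (X := X)) := by
  rw [Generates, eq_top_iff]
  rintro z -
  set S := LieSubalgebra.lieSpan R (FreeLieAlgebra R X) (Set.range (FreeLieAlgebra.of R))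
  let f : FreeLieAlgebra R X →ₗ⁅R⁆ S := FreeLieAlgebra.lift R fun x =>
    ⟨FreeLieAlgebra.of R x, LieSubalgebra.subset_lieSpan ⟨x, rfl⟩⟩
  have h : S.incl.comp f = LieHom.id := FreeLieAlgebra.hom_ext fun x => by
    simp [f]
  have := LieHom.congr_fun h z
  change (f z : FreeLieAlgebra R X) = z at this
  rw [← this]
  exact (f z).2

end Monomials

/-! ### Quotients of Lie algebras -/

section Quotient

variable {R : Type*} [CommRing R] {L : Type*} [LieRing L] [LieAlgebra R L]

/-- The quotient map as a morphism of Lie algebras. -/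
def quotientMk (I : LieIdeal R L) : L →ₗ⁅R⁆ L ⧸ I where
  toFun := LieSubmodule.Quotient.mk
  map_add' _ _ := rfl
  map_smul' _ _ := rfl
  map_lie' := rfl

theorem quotientMk_surjective (I : LieIdeal R L) : Function.Surjective (quotientMk I) :=
  Quot.mk_surjective

variable {L' : Type*} [LieRing L'] [LieAlgebra R L']

/-- A morphism of Lie algebras vanishing on the generators of an ideal descends to the quotient. -/
def quotientLift (s : Set L) (φ : L →ₗ⁅R⁆ L') (h : ∀ z ∈ s, φ z = 0) :
    (L ⧸ LieSubmodule.lieSpan R L s) →ₗ⁅R⁆ L' where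
  toLinearMap := Submodule.liftQ (LieSubmodule.lieSpan R L s).toSubmodule (φ : L →ₗ[R] L') (by
    have hle : LieSubmodule.lieSpan R L s ≤ φ.ker :=
      LieSubmodule.lieSpan_le.mpr fun z hz => LieHom.mem_ker.mpr (h z hz)
    exact fun z hz => LieHom.mem_ker.mp (hle hz))
  map_lie' {x y} := by
    obtain ⟨x, rfl⟩ := quotientMk_surjective _ x
    obtain ⟨y, rfl⟩ := quotientMk_surjective _ y
    rw [← LieHom.map_lie]
    exact φ.map_lie x y

theorem quotientLift_mk (s : Set L) (φ : L →ₗ⁅R⁆ L') (h : ∀ z ∈ s, φ z = 0) (z : L) :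
    quotientLift s φ h (LieSubmodule.Quotient.mk z) = φ z := rfl

end Quotient

/-! ### A lemma on `sl₂` -/

section Sl2

variable {k : Type*} [Field k] [CharZero k] {L : Type*} [LieRing L] [LieAlgebra k L]
  {e f h : L}

local notation "ad" => LieAlgebra.ad k L

omit [CharZero k] in
theorem ad_pow_succ (m : ℕ) (v : L) : (ad f ^ (m + 1)) v = ⁅f, (ad f ^ m) v⁆ := by
  rw [pow_succ', Module.End.mul_apply, LieAlgebra.ad_apply]

omit [CharZero k] in
theorem lie_h_ad_pow (hhf : ⁅h, f⁆ = -(2 : k) • f) {c : k} {v : L} (hv : ⁅h, v⁆ = c • v) (m : ℕ) :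
    ⁅h, (ad f ^ m) v⁆ = (c - 2 * m) • (ad f ^ m) v := by
  induction m with
  | zero => simp [hv]
  | succ m ih =>
    rw [pow_succ', Module.End.mul_apply, LieAlgebra.ad_apply, leibniz_lie, hhf, ih, smul_lie,
      lie_smul, ← add_smul]
    push_cast; ring_nf

-- The usual `sl₂` commutation formula, with the term containing `⁅e, v⁆` kept because `v` is not
-- yet known to be a highest weight vector.
omit [CharZero k] in
theorem lie_e_ad_pow (hef : ⁅e, f⁆ = h) (hhf : ⁅h, f⁆ = -(2 : k) • f) {c : k} {v : L}
    (hv : ⁅h, v⁆ = c • v) (m : ℕ) :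
    ⁅e, (ad f ^ (m + 1)) v⁆ = (ad f ^ (m + 1)) ⁅e, v⁆ + ((m + 1) * (c - m)) • (ad f ^ m) v := by
  induction m with
  | zero => simp [leibniz_lie e f v, hef, hv, add_comm]
  | succ m ih =>
    rw [ad_pow_succ (m + 1), leibniz_lie, hef, lie_h_ad_pow hhf hv, ih, lie_add, lie_smul,
      ← ad_pow_succ, ← ad_pow_succ, add_left_comm, ← add_smul]
    push_cast; ring_nf

/-- On a vector of positive weight `n`, the operator `fⁿ` is injective if `e` acts nilpotently. -/
theorem eq_zero_of_ad_pow_eq_zero (hef : ⁅e, f⁆ = h) (hhe : ⁅h, e⁆ = (2 : k) • e)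
    (hhf : ⁅h, f⁆ = -(2 : k) • f) (d : ℕ) : ∀ (n : ℕ) (v : L), 0 < n → ⁅h, v⁆ = (n : k) • v →
      (ad e ^ d) v = 0 → (ad f ^ n) v = 0 → v = 0 := by
  induction d with
  | zero => intro n v _ _ h0 _; simpa using h0
  | succ d ih =>
    intro n v hn hv he hf
    have hf1 : (ad f ^ (n + 1)) v = 0 := by
      rw [pow_succ', Module.End.mul_apply, hf, map_zero]
    have hf2 : (ad f ^ (n + 2)) v = 0 := by
      rw [pow_succ', Module.End.mul_apply, hf1, map_zero]
    -- The vector `⁅e, v⁆` has weight `n + 2` and is killed by `e ^ d`. The commutation formula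
    -- shows that `f ^ (n + 2)` kills it too, so induction on the nilpotency exponent applies.
    have hev : ⁅e, v⁆ = 0 := by
      refine ih (n + 2) ⁅e, v⁆ (by omega) ?_ ?_ ?_
      · rw [leibniz_lie, hhe, hv, smul_lie, lie_smul, ← add_smul]
        push_cast; ring_nf
      · rw [pow_succ, Module.End.mul_apply, LieAlgebra.ad_apply] at he
        exact he
      · have := lie_e_ad_pow hef hhf hv (n + 1)
        rw [hf1, smul_zero, add_zero] at this
        rw [← this, show n + 1 + 1 = n + 2 from rfl, hf2, lie_zero]
    -- Now `v` is a highest weight vector. Applying `e` lowers the vanishing power of `f` by one,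
    -- since the coefficient `(n - m)(m + 1)` is nonzero in characteristic 0.
    have key : ∀ m, m ≤ n → (ad f ^ (n - m)) v = 0 := by
      intro m
      induction m with
      | zero => intro _; simpa using hf
      | succ m ihm =>
        intro hm
        have h1 := lie_e_ad_pow hef hhf hv (n - (m + 1))
        rw [show n - (m + 1) + 1 = n - m by omega, ihm (by omega), hev, map_zero, lie_zero,
          zero_add] at h1
        refine (smul_eq_zero.mp h1.symm).resolve_left (mul_ne_zero ?_ ?_)
        · exact_mod_cast Nat.succ_ne_zero (n - (m + 1))
        · rw [Nat.cast_sub hm, sub_sub_cancel]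
          exact_mod_cast Nat.succ_ne_zero m
    simpa using key n le_rfl

end Sl2

/-! ### The Lie algebra of a positive definite graph, by a cocycle on the root lattice -/

section Model

variable {I : Type*} [Fintype I] [DecidableEq I] (Γ : SimpleGraph I) [DecidableRel Γ.Adj]

/-- A bilinear form whose symmetrization is the form of the graph. -/
def halfForm : LinearMap.BilinForm ℤ (I → ℤ) := (exists_half_form Γ).choose

theorem halfForm_add_halfForm (u v : I → ℤ) : halfForm Γ u v + halfForm Γ v u = form Γ u v :=
  (exists_half_form Γ).choose_spec u v

/-- The sign cocycle. -/
def eps (u v : I → ℤ) : ℤ := (halfForm Γ u v).negOnePow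

theorem eps_add_right (u v w : I → ℤ) : eps Γ u (v + w) = eps Γ u v * eps Γ u w := by
  simp [eps, Int.negOnePow_add]

theorem eps_neg_left (u v : I → ℤ) : eps Γ (-u) v = eps Γ u v := by
  simp [eps, Int.negOnePow_neg]

theorem eps_neg_right (u v : I → ℤ) : eps Γ u (-v) = eps Γ u v := by
  simp [eps, Int.negOnePow_neg]

theorem eps_sub_right (u v w : I → ℤ) : eps Γ u (v - w) = eps Γ u v * eps Γ u w := by
  rw [sub_eq_add_neg, eps_add_right, eps_neg_right]

theorem eps_mul_self (u v : I → ℤ) : eps Γ u v * eps Γ u v = 1 := by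
  rw [eps, ← Units.val_mul, Int.units_mul_self, Units.val_one]

theorem eps_eq_or (u v : I → ℤ) : eps Γ u v = 1 ∨ eps Γ u v = -1 :=
  mul_self_eq_one_iff.mp (eps_mul_self Γ u v)

theorem eps_mul_swap (u v : I → ℤ) : eps Γ u v * eps Γ v u = (form Γ u v).negOnePow := by
  rw [← halfForm_add_halfForm, Int.negOnePow_add, Units.val_mul]; rfl

variable {Γ} in
theorem eps_swap_of_odd {u v : I → ℤ} (h : Odd (form Γ u v)) : eps Γ u v = -eps Γ v u := by
  have h1 := eps_mul_swap Γ u v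
  rw [Int.negOnePow_odd _ h] at h1
  rcases eps_eq_or Γ u v with h2 | h2 <;> rw [h2] at h1 ⊢ <;> simp at h1 ⊢ <;> omega

variable {Γ} in
theorem eps_swap_of_even {u v : I → ℤ} (h : Even (form Γ u v)) : eps Γ u v = eps Γ v u := by
  have h1 := eps_mul_swap Γ u v
  rw [Int.negOnePow_even _ h] at h1
  rcases eps_eq_or Γ u v with h2 | h2 <;> rw [h2] at h1 ⊢ <;> simp at h1 ⊢ <;> omega

variable {Γ} in
theorem eps_self {u : I → ℤ} (h : u ∈ Root Γ) : eps Γ u u = -1 := by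
  have h1 := halfForm_add_halfForm Γ u u
  have h2 : form Γ u u = 2 := h
  have h3 : halfForm Γ u u = 1 := by omega
  simp [eps, h3]

/-- The underlying space of the Lie algebra of a positive definite graph. -/
def Model : Type _ := (I ⊕ Root Γ) →₀ ℂ

instance : AddCommGroup (Model Γ) := inferInstanceAs (AddCommGroup ((I ⊕ Root Γ) →₀ ℂ))

instance : Module ℂ (Model Γ) := inferInstanceAs (Module ℂ ((I ⊕ Root Γ) →₀ ℂ))

namespace Model

/-- The standard basis. -/
def stdBasis : Module.Basis (I ⊕ Root Γ) ℂ (Model Γ) := Finsupp.basisSingleOne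

/-- The coroot of a vector of the root lattice. -/
def coroot (u : I → ℤ) : Model Γ := ∑ x, u x • stdBasis Γ (Sum.inl x)

open Classical in
/-- The root vector of a root; it is zero if `u` is not a root. -/
def rootVec (u : I → ℤ) : Model Γ :=
  if h : u ∈ Root Γ then stdBasis Γ (Sum.inr ⟨u, h⟩) else 0

variable {Γ}

theorem rootVec_coe (u : Root Γ) : rootVec Γ u.1 = stdBasis Γ (Sum.inr u) := by
  simp [rootVec, u.2]

theorem rootVec_of_notMem {u : I → ℤ} (h : u ∉ Root Γ) : rootVec Γ u = 0 := by
  simp [rootVec, h]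

theorem coroot_simple (x : I) : coroot Γ (simple x) = stdBasis Γ (Sum.inl x) := by
  simp [coroot, Pi.single_apply, ite_smul]

theorem coroot_add (u v : I → ℤ) : coroot Γ (u + v) = coroot Γ u + coroot Γ v := by
  simp [coroot, add_smul, Finset.sum_add_distrib]

theorem coroot_neg (u : I → ℤ) : coroot Γ (-u) = -coroot Γ u := by
  simp [coroot]

variable (Γ)

/-- The structure constants. -/
def structureConst : I ⊕ Root Γ → I ⊕ Root Γ → Model Γ
  | .inl _, .inl _ => 0
  | .inl x, .inr v => form Γ (simple x) v.1 • rootVec Γ v.1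
  | .inr u, .inl y => -(form Γ (simple y) u.1 • rootVec Γ u.1)
  -- The sign of the coroot is `ε(u, -u) = -1`, in agreement with the cocycle in the other case.
  | .inr u, .inr v =>
    if u.1 + v.1 = 0 then -coroot Γ u.1 else eps Γ u.1 v.1 • rootVec Γ (u.1 + v.1)

/-- The bracket as a bilinear map. -/
def br : Model Γ →ₗ[ℂ] Model Γ →ₗ[ℂ] Model Γ :=
  (stdBasis Γ).constr ℂ fun i => (stdBasis Γ).constr ℂ (structureConst Γ i)

theorem br_stdBasis (i j : I ⊕ Root Γ) :
    br Γ (stdBasis Γ i) (stdBasis Γ j) = structureConst Γ i j := by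
  simp [br]

variable {Γ}

theorem br_coroot_coroot (u v : I → ℤ) : br Γ (coroot Γ u) (coroot Γ v) = 0 := by
  simp [coroot, br_stdBasis, structureConst]

theorem br_coroot_rootVec (u v : I → ℤ) :
    br Γ (coroot Γ u) (rootVec Γ v) = form Γ u v • rootVec Γ v := by
  by_cases hv : v ∈ Root Γ
  · rw [form_eq_sum_simple, Finset.sum_smul, coroot, map_sum, LinearMap.sum_apply]
    refine Finset.sum_congr rfl fun x _ => ?_
    rw [map_zsmul, LinearMap.smul_apply, rootVec_coe ⟨v, hv⟩, br_stdBasis, structureConst,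
      mul_smul, rootVec_coe ⟨v, hv⟩]
  · simp [rootVec_of_notMem hv]

theorem br_rootVec_coroot (u v : I → ℤ) :
    br Γ (rootVec Γ u) (coroot Γ v) = -(form Γ v u • rootVec Γ u) := by
  by_cases hu : u ∈ Root Γ
  · rw [form_eq_sum_simple, Finset.sum_smul, coroot, map_sum, ← Finset.sum_neg_distrib]
    refine Finset.sum_congr rfl fun x _ => ?_
    rw [map_zsmul, rootVec_coe ⟨u, hu⟩, br_stdBasis, structureConst, smul_neg,
      mul_smul, rootVec_coe ⟨u, hu⟩]
  · simp [rootVec_of_notMem hu]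

theorem br_rootVec_of_add_eq_zero {u v : I → ℤ} (hu : u ∈ Root Γ) (hv : v ∈ Root Γ)
    (h : u + v = 0) : br Γ (rootVec Γ u) (rootVec Γ v) = -coroot Γ u := by
  rw [rootVec_coe ⟨u, hu⟩, rootVec_coe ⟨v, hv⟩, br_stdBasis]
  simp [structureConst, h]

theorem br_rootVec {u v : I → ℤ} (hu : u ∈ Root Γ) (hv : v ∈ Root Γ) (h : u + v ≠ 0) :
    br Γ (rootVec Γ u) (rootVec Γ v) = eps Γ u v • rootVec Γ (u + v) := by
  rw [rootVec_coe ⟨u, hu⟩, rootVec_coe ⟨v, hv⟩, br_stdBasis]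
  simp [structureConst, h]

theorem induction {p : Model Γ → Prop} (h0 : p 0) (ha : ∀ x y, p x → p y → p (x + y))
    (hs : ∀ (c : ℂ) x, p x → p (c • x)) (h1 : ∀ x, p (coroot Γ (simple x)))
    (h2 : ∀ u ∈ Root Γ, p (rootVec Γ u)) (z : Model Γ) : p z := by
  have hz : z ∈ Submodule.span ℂ (Set.range (stdBasis Γ)) := (stdBasis Γ).mem_span z
  induction hz using Submodule.span_induction with
  | zero => exact h0
  | add u v _ _ hu hv => exact ha u v hu hv
  | smul t u _ hu => exact hs t u hu
  | mem u hu =>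
    obtain ⟨x | v, rfl⟩ := hu
    · rw [← coroot_simple]; exact h1 x
    · rw [← rootVec_coe]; exact h2 _ v.2

theorem br_rootVec_swap {u v : I → ℤ} (hu : u ∈ Root Γ) (hv : v ∈ Root Γ) :
    br Γ (rootVec Γ u) (rootVec Γ v) = -br Γ (rootVec Γ v) (rootVec Γ u) := by
  by_cases h : u + v = 0
  · rw [br_rootVec_of_add_eq_zero hu hv h,
      br_rootVec_of_add_eq_zero hv hu (by rw [add_comm, h]), neg_neg,
      eq_neg_of_add_eq_zero_left h, coroot_neg, neg_neg]
  · rw [br_rootVec hu hv h, br_rootVec hv hu (by rwa [add_comm]), add_comm v u, ← neg_smul]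
    by_cases hr : u + v ∈ Root Γ
    · rw [eps_swap_of_odd (by rw [(add_mem_root_iff hu hv).mp hr]; decide)]
    · simp [rootVec_of_notMem hr]

theorem br_swap (x y : Model Γ) : br Γ x y = -br Γ y x := by
  refine induction (p := fun x => br Γ x y = -br Γ y x) (by simp) (fun a b ha hb => ?_)
    (fun c a ha => ?_) (fun a => ?_) (fun u hu => ?_) x
  · simp [ha, hb]; abel
  · simp [ha]
  · refine induction (p := fun y => br Γ _ y = -br Γ y _) (by simp) (fun b c hb hc => ?_)
      (fun c b hb => ?_) (fun b => ?_) (fun v hv => ?_) y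
    · simp [hb, hc]; abel
    · simp [hb]
    · simp [br_coroot_coroot]
    · simp [br_coroot_rootVec, br_rootVec_coroot]
  · refine induction (p := fun y => br Γ _ y = -br Γ y _) (by simp) (fun b c hb hc => ?_)
      (fun c b hb => ?_) (fun b => ?_) (fun v hv => ?_) y
    · simp [hb, hc]; abel
    · simp [hb]
    · simp [br_coroot_rootVec, br_rootVec_coroot]
    · exact br_rootVec_swap hu hv

theorem br_br_rootVec {u v w : I → ℤ} (hu : u ∈ Root Γ) (hv : v ∈ Root Γ) (hw : w ∈ Root Γ)
    (h1 : form Γ v w = -1) (h2 : u + (v + w) ≠ 0) :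
    br Γ (rootVec Γ u) (br Γ (rootVec Γ v) (rootVec Γ w)) =
      (eps Γ v w * (eps Γ u v * eps Γ u w)) • rootVec Γ (u + (v + w)) := by
  have hr := (add_mem_root_iff hv hw).mpr h1
  rw [br_rootVec hv hw (ne_zero_of_mem_root hr), map_zsmul, br_rootVec hu hr h2, ← mul_smul,
    eps_add_right]

/-! ### The Jacobi identity for root vectors. -/

section Jacobi

variable (hΓ : IsPosDef Γ)
include hΓ

theorem br_rootVec_eq_zero {u v : I → ℤ} (hu : u ∈ Root Γ) (hv : v ∈ Root Γ)
    (h1 : form Γ u v ≠ -1) (h2 : form Γ u v ≠ -2) : br Γ (rootVec Γ u) (rootVec Γ v) = 0 := by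
  rw [br_rootVec hu hv (fun h => h2 ((hΓ.add_eq_zero_iff hu hv).mp h)),
    rootVec_of_notMem (fun h => h1 ((add_mem_root_iff hu hv).mp h)), smul_zero]

/-- The last term is `⟨u, w⟩` times the root vector of `w`. For each of the five possible pairings,
at most one of the other terms survives and it cancels this one: by the action of a coroot when the
pairing is `±2`, and by `ε ^ 2 = 1` and `ε(u, u) = -1` when it is `±1`. -/
theorem jacobi_of_opposite {u w : I → ℤ} (hu : u ∈ Root Γ) (hw : w ∈ Root Γ) :
    br Γ (rootVec Γ u) (br Γ (rootVec Γ (-u)) (rootVec Γ w)) +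
      br Γ (rootVec Γ (-u)) (br Γ (rootVec Γ w) (rootVec Γ u)) +
      br Γ (rootVec Γ w) (br Γ (rootVec Γ u) (rootVec Γ (-u))) = 0 := by
  have hn := neg_mem_root hu
  have huu : form Γ u u = 2 := hu
  have hww : form Γ w w = 2 := hw
  have h3 : br Γ (rootVec Γ w) (br Γ (rootVec Γ u) (rootVec Γ (-u))) =
      form Γ u w • rootVec Γ w := by
    rw [br_rootVec_of_add_eq_zero hu hn (add_neg_cancel u), map_neg, br_rootVec_coroot, neg_neg]
  have hfn : form Γ (-u) w = -form Γ u w := by simp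
  have hle := hΓ.form_le_two hu hw
  have hge := hΓ.neg_two_le_form hu hw
  rw [h3]
  rcases (by omega : form Γ u w = -2 ∨ form Γ u w = -1 ∨ form Γ u w = 0 ∨ form Γ u w = 1 ∨
    form Γ u w = 2) with h | h | h | h | h
  · have hwu : w = -u := (neg_eq_of_add_eq_zero_right ((hΓ.add_eq_zero_iff hu hw).mpr h)).symm
    subst hwu
    rw [br_rootVec_eq_zero hΓ hn hn (by omega) (by omega),
      br_rootVec_of_add_eq_zero hn hu (neg_add_cancel u), map_neg, br_rootVec_coroot, h, map_zero]
    simp [huu]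
  · rw [br_rootVec_eq_zero hΓ hn hw (by omega) (by omega), map_zero,
      br_br_rootVec hn hw hu (by rw [form_comm, h]) (by simpa using ne_zero_of_mem_root hw),
      eps_neg_left, eps_neg_left, eps_self hu, eps_swap_of_odd (u := u) (v := w) (by rw [h]; decide)]
    have : eps Γ w u * (-eps Γ w u * -1) = 1 := by linear_combination eps_mul_self Γ w u
    rw [this, h]; simp
  · rw [br_rootVec_eq_zero hΓ hn hw (by omega) (by omega),
      br_rootVec_eq_zero hΓ hw hu (by rw [form_comm]; omega) (by rw [form_comm]; omega), h]
    simp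
  · rw [br_rootVec_eq_zero hΓ hw hu (by rw [form_comm]; omega) (by rw [form_comm]; omega),
      br_br_rootVec hu hn hw (by omega) (by simpa using ne_zero_of_mem_root hw),
      eps_neg_left, eps_neg_right, eps_self hu, h]
    have : eps Γ u w * (-1 * eps Γ u w) = -1 := by linear_combination -eps_mul_self Γ u w
    rw [this]; simp
  · have hwu : u = w := (hΓ.sub_eq_zero_iff hu hw).mpr h
    subst hwu
    rw [br_rootVec_eq_zero hΓ hu hu (by omega) (by omega),
      br_rootVec_of_add_eq_zero hn hu (neg_add_cancel u), map_neg, br_rootVec_coroot, hfn, h,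
      map_zero]
    simp

omit hΓ in
theorem br_br_rootVec_of_sum {u v w : I → ℤ} (hu : u ∈ Root Γ) (hv : v ∈ Root Γ)
    (hw : w ∈ Root Γ) (h : u + v + w = 0) :
    br Γ (rootVec Γ u) (br Γ (rootVec Γ v) (rootVec Γ w)) = -(eps Γ v w • coroot Γ u) := by
  have h1 : v + w = -u := by rw [eq_neg_iff_add_eq_zero, ← h]; abel
  rw [br_rootVec hv hw (h1 ▸ ne_zero_of_mem_root (neg_mem_root hu)), map_zsmul, h1,
    br_rootVec_of_add_eq_zero hu (neg_mem_root hu) (add_neg_cancel u), smul_neg]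

theorem jacobi_rootVec {u v w : I → ℤ} (hu : u ∈ Root Γ) (hv : v ∈ Root Γ) (hw : w ∈ Root Γ) :
    br Γ (rootVec Γ u) (br Γ (rootVec Γ v) (rootVec Γ w)) +
      br Γ (rootVec Γ v) (br Γ (rootVec Γ w) (rootVec Γ u)) +
      br Γ (rootVec Γ w) (br Γ (rootVec Γ u) (rootVec Γ v)) = 0 := by
  by_cases h1 : u + v = 0
  · obtain rfl := (neg_eq_of_add_eq_zero_right h1).symm
    exact jacobi_of_opposite hΓ hu hw
  by_cases h2 : v + w = 0
  · obtain rfl := (neg_eq_of_add_eq_zero_right h2).symm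
    rw [← jacobi_of_opposite hΓ hv hu]; abel
  by_cases h3 : w + u = 0
  · obtain rfl := (neg_eq_of_add_eq_zero_right h3).symm
    rw [← jacobi_of_opposite hΓ hw hv]; abel
  have huu : form Γ u u = 2 := hu
  have hvv : form Γ v v = 2 := hv
  have hww : form Γ w w = 2 := hw
  have f1 := (hΓ.add_eq_zero_iff hu hv).not.mp h1
  have f2 := (hΓ.add_eq_zero_iff hv hw).not.mp h2
  have f3 := (hΓ.add_eq_zero_iff hw hu).not.mp h3
  have g1 := hΓ.neg_two_le_form hu hv
  have g2 := hΓ.neg_two_le_form hv hw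
  have g3 := hΓ.neg_two_le_form hw hu
  by_cases hS : u + v + w = 0
  -- When the three roots sum to zero, they pair to `-1` in a way that makes the three cocycle
  -- values equal. The identity is then the vanishing of the sum of the coroots.
  · have e1 : v + w = -u := by rw [eq_neg_iff_add_eq_zero, ← hS]; abel
    have hwe : w = -u - v := by rw [← e1]; abel
    rw [br_br_rootVec_of_sum hu hv hw hS,
      br_br_rootVec_of_sum hv hw hu (by rw [← hS]; abel),
      br_br_rootVec_of_sum hw hu hv (by rw [← hS]; abel)]
    have q : form Γ u v = -1 := by
      have := hww
      rw [hwe, form_sub_self] at this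
      simp at this
      omega
    have o1 : eps Γ v w = eps Γ u v := by
      rw [hwe, eps_sub_right, eps_neg_right, eps_self hv, eps_swap_of_odd (u := u) (v := v)
        (by rw [q]; decide)]
      ring
    have q2 : form Γ w u = -1 := by
      rw [hwe]; simp [form_comm Γ v u]; omega
    have o2 : eps Γ w u = eps Γ u v := by
      rw [eps_swap_of_odd (by rw [q2]; decide), hwe, eps_sub_right, eps_neg_right, eps_self hu]
      ring
    rw [o1, o2, ← neg_add, ← neg_add, ← smul_add, ← smul_add, ← coroot_add, ← coroot_add, hS]
    simp [coroot]
  by_cases hr : u + v + w ∈ Root Γ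
  -- The pairings sum to `-2` and none is below `-1`, so two of them are `-1` and one is 0. The
  -- corresponding two double brackets cancel, since swapping the arguments of the cocycle changes
  -- its sign exactly when the pairing is odd.
  · have hsum : form Γ u v + form Γ v w + form Γ w u = -2 := by
      have : form Γ (u + v + w) (u + v + w) = 2 := hr
      rw [form_add_self, form_add_self] at this
      simp only [map_add, LinearMap.add_apply, form_comm Γ u w] at this
      omega
    have hS2 : v + (w + u) ≠ 0 := fun h => hS (by rw [← h]; abel)
    have hS3 : w + (u + v) ≠ 0 := fun h => hS (by rw [← h]; abel)
    have s2 : v + (w + u) = u + (v + w) := by abel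
    have s3 : w + (u + v) = u + (v + w) := by abel
    rw [add_assoc] at hS
    rcases (by omega : (form Γ u v = 0 ∧ form Γ v w = -1 ∧ form Γ w u = -1) ∨
      (form Γ u v = -1 ∧ form Γ v w = 0 ∧ form Γ w u = -1) ∨
      (form Γ u v = -1 ∧ form Γ v w = -1 ∧ form Γ w u = 0)) with ⟨a, b, c⟩ | ⟨a, b, c⟩ | ⟨a, b, c⟩
    · rw [br_br_rootVec hu hv hw b hS, br_br_rootVec hv hw hu c hS2,
        br_rootVec_eq_zero hΓ hu hv (by omega) (by omega), map_zero, s2, add_zero, ← add_smul,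
        eps_swap_of_odd (u := w) (v := u) (by rw [c]; decide),
        eps_swap_of_even (u := u) (v := v) (by rw [a]; decide)]
      convert zero_smul ℤ _ using 2
      ring
    · rw [br_br_rootVec hv hw hu c hS2, br_br_rootVec hw hu hv a hS3,
        br_rootVec_eq_zero hΓ hv hw (by omega) (by omega), map_zero, s2, s3, zero_add, ← add_smul,
        eps_swap_of_odd (u := u) (v := v) (by rw [a]; decide),
        eps_swap_of_even (u := v) (v := w) (by rw [b]; decide)]
      convert zero_smul ℤ _ using 2
      ring
    · rw [br_br_rootVec hu hv hw b hS, br_br_rootVec hw hu hv a hS3,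
        br_rootVec_eq_zero hΓ hw hu (by omega) (by omega), map_zero, s3, add_zero, ← add_smul,
        eps_swap_of_odd (u := v) (v := w) (by rw [b]; decide),
        eps_swap_of_even (u := w) (v := u) (by rw [c]; decide)]
      convert zero_smul ℤ _ using 2
      ring
  -- If the total is neither zero nor a root, every double bracket vanishes separately.
  · have key : ∀ a b c : I → ℤ, a ∈ Root Γ → b ∈ Root Γ → c ∈ Root Γ → b + c ≠ 0 →
        a + (b + c) = u + v + w →
        br Γ (rootVec Γ a) (br Γ (rootVec Γ b) (rootVec Γ c)) = 0 := by
      intro a b c ha hb hc hbc habc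
      rw [br_rootVec hb hc hbc, map_zsmul]
      by_cases hbr : b + c ∈ Root Γ
      · rw [br_rootVec ha hbr (habc ▸ hS), habc, rootVec_of_notMem hr]; simp
      · simp [rootVec_of_notMem hbr]
    rw [key u v w hu hv hw h2 (by abel), key v w u hv hw hu h3 (by abel),
      key w u v hw hu hv h1 (by abel)]
    simp

theorem leibniz_rootVec {u v w : I → ℤ} (hu : u ∈ Root Γ) (hv : v ∈ Root Γ) (hw : w ∈ Root Γ) :
    br Γ (rootVec Γ u) (br Γ (rootVec Γ v) (rootVec Γ w)) =
      br Γ (br Γ (rootVec Γ u) (rootVec Γ v)) (rootVec Γ w) +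
      br Γ (rootVec Γ v) (br Γ (rootVec Γ u) (rootVec Γ w)) := by
  have h := jacobi_rootVec hΓ hu hv hw
  rw [br_swap (rootVec Γ w) (rootVec Γ u), br_swap (rootVec Γ w) (br Γ _ _), map_neg] at h
  rw [← sub_eq_zero, ← h]; abel

end Jacobi

/-- The bracket with a coroot acts on a root space by a scalar. -/
theorem br_coroot_br (u : I → ℤ) {v w : I → ℤ} (hv : v ∈ Root Γ) (hw : w ∈ Root Γ) :
    br Γ (coroot Γ u) (br Γ (rootVec Γ v) (rootVec Γ w)) =
      form Γ u (v + w) • br Γ (rootVec Γ v) (rootVec Γ w) := by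
  by_cases h : v + w = 0
  · rw [br_rootVec_of_add_eq_zero hv hw h, h, map_neg, br_coroot_coroot]; simp
  · rw [br_rootVec hv hw h, map_zsmul, br_coroot_rootVec, smul_comm]

theorem leibniz (hΓ : IsPosDef Γ) (x y z : Model Γ) :
    br Γ x (br Γ y z) = br Γ (br Γ x y) z + br Γ y (br Γ x z) := by
  -- Coroots act by scalars additive in the weight, hence as derivations. A coroot in either other
  -- argument reduces to this case by antisymmetry.
  have hhe : ∀ a y z, br Γ (coroot Γ a) (br Γ y z) =
      br Γ (br Γ (coroot Γ a) y) z + br Γ y (br Γ (coroot Γ a) z) := by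
    intro a y z
    refine induction (p := fun y => br Γ _ (br Γ y z) = br Γ (br Γ _ y) z + br Γ y _) (by simp)
      (fun b c hb hc => ?_) (fun c b hb => ?_) (fun b => ?_) (fun v hv => ?_) y
    · simp only [map_add, LinearMap.add_apply, hb, hc]; abel
    · simp only [map_smul, LinearMap.smul_apply, hb, smul_add]
    · refine induction (p := fun z => br Γ _ (br Γ _ z) = br Γ _ z + br Γ _ (br Γ _ z)) (by simp)
        (fun b c hb hc => ?_) (fun c b hb => ?_) (fun b => ?_) (fun v hv => ?_) z
      · simp only [map_add, hb, hc]; abel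
      · simp only [map_smul, hb, smul_add]
      · simp [br_coroot_coroot]
      · simp only [br_coroot_coroot, br_coroot_rootVec, map_zsmul, map_zero, LinearMap.zero_apply,
          zero_add]
        rw [smul_comm]
    · refine induction (p := fun z => br Γ _ (br Γ _ z) = br Γ _ z + br Γ _ (br Γ _ z)) (by simp)
        (fun b c hb hc => ?_) (fun c b hb => ?_) (fun b => ?_) (fun w hw => ?_) z
      · simp only [map_add, hb, hc]; abel
      · simp only [map_smul, hb, smul_add]
      · simp [br_coroot_coroot, br_coroot_rootVec, br_rootVec_coroot]
        rw [smul_comm]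
      · rw [br_coroot_br _ hv hw, br_coroot_rootVec, br_coroot_rootVec, map_zsmul, map_zsmul,
          LinearMap.smul_apply, ← add_smul, map_add]
  refine induction (p := fun x => br Γ x (br Γ y z) = br Γ (br Γ x y) z + br Γ y (br Γ x z))
    (by simp) (fun b c hb hc => ?_) (fun c b hb => ?_) (fun a => hhe _ y z) (fun u hu => ?_) x
  · simp only [map_add, LinearMap.add_apply, hb, hc]; abel
  · simp only [map_smul, LinearMap.smul_apply, hb, smul_add]
  refine induction (p := fun y => br Γ _ (br Γ y z) = br Γ (br Γ _ y) z + br Γ y _) (by simp)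
      (fun b c hb hc => ?_) (fun c b hb => ?_) (fun b => ?_) (fun v hv => ?_) y
  · simp only [map_add, LinearMap.add_apply, hb, hc]; abel
  · simp only [map_smul, LinearMap.smul_apply, hb, smul_add]
  · rw [hhe, br_swap (rootVec Γ u) (coroot Γ _), map_neg, LinearMap.neg_apply]; abel
  refine induction (p := fun z => br Γ _ (br Γ _ z) = br Γ _ z + br Γ _ (br Γ _ z)) (by simp)
      (fun b c hb hc => ?_) (fun c b hb => ?_) (fun b => ?_) (fun w hw => ?_) z
  · simp only [map_add, hb, hc]; abel
  · simp only [map_smul, hb, smul_add]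
  · rw [br_swap (rootVec Γ v) (coroot Γ _), br_swap (br Γ _ _) (coroot Γ _), hhe,
      br_swap (rootVec Γ u) (coroot Γ _), map_neg, map_neg,
      br_swap (rootVec Γ v) (br Γ (coroot Γ _) (rootVec Γ u)), neg_neg]
    abel
  · exact leibniz_rootVec hΓ hu hv hw

end Model

end Model

/-! ### Families satisfying the Serre relations -/

open CartanMatrix (Generators)

section Serre

variable {I : Type*} [DecidableEq I] (Γ : SimpleGraph I) [DecidableRel Γ.Adj]

/-- The Serre relations of a simply laced graph. -/
structure SerreRelations {L : Type*} [LieRing L] (g : Generators I → L) : Prop where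
  HH (x y : I) : ⁅g (.H x), g (.H y)⁆ = 0
  EF (x : I) : ⁅g (.E x), g (.F x)⁆ = g (.H x)
  EF_of_ne {x y : I} (h : x ≠ y) : ⁅g (.E x), g (.F y)⁆ = 0
  HE (x y : I) : ⁅g (.H x), g (.E y)⁆ = cartanMatrix Γ x y • g (.E y)
  HF (x y : I) : ⁅g (.H x), g (.F y)⁆ = -(cartanMatrix Γ x y • g (.F y))
  EE {x y : I} (h : ¬ Γ.Adj x y) : ⁅g (.E x), g (.E y)⁆ = 0
  EEE {x y : I} (h : Γ.Adj x y) : ⁅g (.E x), ⁅g (.E x), g (.E y)⁆⁆ = 0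
  FF {x y : I} (h : ¬ Γ.Adj x y) : ⁅g (.F x), g (.F y)⁆ = 0
  FFF {x y : I} (h : Γ.Adj x y) : ⁅g (.F x), ⁅g (.F x), g (.F y)⁆⁆ = 0

theorem KacMoody.gen_eq_zero_of_mem {z : FreeLieAlgebra ℂ (Generators I)}
    (hz : z ∈ CartanMatrix.Relations.toSet ℂ (cartanMatrix Γ)) :
    quotientMk (CartanMatrix.Relations.toIdeal ℂ (cartanMatrix Γ)) z = 0 :=
  (Submodule.Quotient.mk_eq_zero _).mpr (LieSubmodule.subset_lieSpan hz)

/-- The quotient map onto the Kac-Moody algebra. -/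
def KacMoody.mk : FreeLieAlgebra ℂ (Generators I) →ₗ⁅ℂ⁆ KacMoody Γ :=
  quotientMk (CartanMatrix.Relations.toIdeal ℂ (cartanMatrix Γ))

theorem KacMoody.mk_of (a : Generators I) :
    KacMoody.mk Γ (FreeLieAlgebra.of ℂ a) = KacMoody.gen Γ a := rfl

theorem KacMoody.mk_eq_zero {z : FreeLieAlgebra ℂ (Generators I)}
    (hz : z ∈ CartanMatrix.Relations.toSet ℂ (cartanMatrix Γ)) : KacMoody.mk Γ z = 0 :=
  KacMoody.gen_eq_zero_of_mem Γ hz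

theorem KacMoody.generates : Generates ℂ (KacMoody.gen Γ) :=
  (generates_freeLieAlgebra (Generators I)).map (KacMoody.mk Γ)
    (quotientMk_surjective (CartanMatrix.Relations.toIdeal ℂ (cartanMatrix Γ)))

theorem KacMoody.serreRelations : SerreRelations Γ (KacMoody.gen Γ) := by
  have key : ∀ z ∈ CartanMatrix.Relations.toSet ℂ (cartanMatrix Γ), KacMoody.mk Γ z = 0 :=
    fun z hz => KacMoody.mk_eq_zero Γ hz
  have hEE : ∀ x y, _ := fun x y => key _ (Or.inl (Or.inr ⟨(x, y), rfl⟩))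
  have hFF : ∀ x y, _ := fun x y => key _ (Or.inr ⟨(x, y), rfl⟩)
  have hEF : ∀ x y, _ := fun x y => key _ (Or.inl (Or.inl (Or.inl (Or.inl (Or.inr ⟨(x, y), rfl⟩)))))
  have hHH : ∀ x y, _ := fun x y => key _ (Or.inl (Or.inl (Or.inl (Or.inl (Or.inl ⟨(x, y), rfl⟩)))))
  have hHE : ∀ x y, _ := fun x y => key _ (Or.inl (Or.inl (Or.inl (Or.inr ⟨(x, y), rfl⟩))))
  have hHF : ∀ x y, _ := fun x y => key _ (Or.inl (Or.inl (Or.inr ⟨(x, y), rfl⟩)))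
  simp only [CartanMatrix.Relations.HH, CartanMatrix.Relations.EF, CartanMatrix.Relations.HE,
    CartanMatrix.Relations.HF, CartanMatrix.Relations.adE, CartanMatrix.Relations.adF,
    Function.uncurry, Function.comp_apply] at hEE hFF hEF hHH hHE hHF
  refine ⟨fun x y => ?_, fun x => ?_, fun {x y} h => ?_, fun x y => ?_, fun x y => ?_,
    fun {x y} h => ?_, fun {x y} h => ?_, fun {x y} h => ?_, fun {x y} h => ?_⟩
  · simpa [KacMoody.mk_of] using hHH x y
  · simpa [KacMoody.mk_of, sub_eq_zero] using hEF x x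
  · simpa [KacMoody.mk_of, h] using hEF x y
  · simpa [KacMoody.mk_of, sub_eq_zero] using hHE x y
  · simpa [KacMoody.mk_of, add_eq_zero_iff_eq_neg] using hHF x y
  · rcases eq_or_ne x y with rfl | hne
    · exact lie_self _
    · simpa [KacMoody.mk_of, cartanMatrix, h, hne] using hEE x y
  · simpa [KacMoody.mk_of, cartanMatrix, h, h.ne] using hEE x y
  · rcases eq_or_ne x y with rfl | hne
    · exact lie_self _
    · simpa [KacMoody.mk_of, cartanMatrix, h, hne] using hFF x y
  · simpa [KacMoody.mk_of, cartanMatrix, h, h.ne] using hFF x y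

variable {Γ}

section Lift

variable {L : Type*} [LieRing L] [LieAlgebra ℂ L] {g : Generators I → L} (hg : SerreRelations Γ g)

/-- The universal property of the Kac-Moody algebra. -/
def KacMoody.lift : KacMoody Γ →ₗ⁅ℂ⁆ L :=
  quotientLift (CartanMatrix.Relations.toSet ℂ (cartanMatrix Γ)) (FreeLieAlgebra.lift ℂ g) (by
    -- The exponent is 1 for adjacent vertices and 0 otherwise, including on the diagonal, where the
    -- truncation turns `-2` into 0 and the relation becomes `⁅E_x, E_x⁆ = 0`.
    have hEE : ∀ x y, ((LieAlgebra.ad ℂ L (g (.E x))) ^ (-cartanMatrix Γ x y).toNat)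
        ⁅g (.E x), g (.E y)⁆ = 0 := by
      intro x y
      rcases eq_or_ne x y with rfl | hne
      · simp
      · by_cases h : Γ.Adj x y
        · simpa [cartanMatrix, hne, h] using hg.EEE h
        · simpa [cartanMatrix, hne, h] using hg.EE h
    have hFF : ∀ x y, ((LieAlgebra.ad ℂ L (g (.F x))) ^ (-cartanMatrix Γ x y).toNat)
        ⁅g (.F x), g (.F y)⁆ = 0 := by
      intro x y
      rcases eq_or_ne x y with rfl | hne
      · simp
      · by_cases h : Γ.Adj x y
        · simpa [cartanMatrix, hne, h] using hg.FFF h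
        · simpa [cartanMatrix, hne, h] using hg.FF h
    have hpow : ∀ (a z : FreeLieAlgebra ℂ (Generators I)) (n : ℕ),
        FreeLieAlgebra.lift ℂ g ((LieAlgebra.ad ℂ _ a ^ n) z) =
          (LieAlgebra.ad ℂ L (FreeLieAlgebra.lift ℂ g a) ^ n) (FreeLieAlgebra.lift ℂ g z) := by
      intro a z n
      induction n with
      | zero => simp
      | succ n ih => rw [ad_pow_succ, ad_pow_succ, LieHom.map_lie, ih]
    rintro z (((((⟨⟨x, y⟩, rfl⟩ | ⟨⟨x, y⟩, rfl⟩) | ⟨⟨x, y⟩, rfl⟩) | ⟨⟨x, y⟩, rfl⟩) |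
      ⟨⟨x, y⟩, rfl⟩) | ⟨⟨x, y⟩, rfl⟩)
    · simp [CartanMatrix.Relations.HH, hg.HH]
    · rcases eq_or_ne x y with rfl | hne
      · simp [CartanMatrix.Relations.EF, hg.EF]
      · simp [CartanMatrix.Relations.EF, hne, hg.EF_of_ne hne]
    · simp [CartanMatrix.Relations.HE, hg.HE]
    · simp [CartanMatrix.Relations.HF, hg.HF]
    · simp only [CartanMatrix.Relations.adE, Function.uncurry, Function.comp_apply, hpow,
        LieHom.map_lie, FreeLieAlgebra.lift_of_apply, hEE]
    · simp only [CartanMatrix.Relations.adF, Function.uncurry, Function.comp_apply, hpow,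
        LieHom.map_lie, FreeLieAlgebra.lift_of_apply, hFF])

theorem KacMoody.lift_gen (a : Generators I) : KacMoody.lift hg (KacMoody.gen Γ a) = g a :=
  (quotientLift_mk _ _ _ _).trans (FreeLieAlgebra.lift_of_apply _ _)

end Lift

/-- The Chevalley involution on families of generators. -/
def swapGen {L : Type*} [LieRing L] (g : Generators I → L) : Generators I → L
  | .H x => -g (.H x)
  | .E x => g (.F x)
  | .F x => g (.E x)

theorem SerreRelations.swap {L : Type*} [LieRing L] {g : Generators I → L}
    (hg : SerreRelations Γ g) : SerreRelations Γ (swapGen g) where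
  HH x y := by simp [swapGen, hg.HH]
  EF x := by simp [swapGen, ← lie_skew (g (.F x)), hg.EF]
  EF_of_ne {x y} h := by simp [swapGen, ← lie_skew (g (.F x)), hg.EF_of_ne h.symm]
  HE x y := by simp [swapGen, hg.HF]
  HF x y := by simp [swapGen, hg.HE]
  EE h := hg.FF h
  EEE h := hg.FFF h
  FF h := hg.EE h
  FFF h := hg.EEE h

end Serre

/-! ### Monomials in elements of simple weights -/

section SimpleWeights

variable {I : Type*} [DecidableEq I] {K : Type*} [Field K] {L : Type*} [LieRing L]
  [LieAlgebra K L] (e : I → L)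

theorem sum_simple_nonneg (w : List I) : 0 ≤ (w.map simple).sum :=
  List.sum_nonneg (by simp [Pi.single_nonneg])

theorem sum_simple_apply (w : List I) (x : I) : (w.map simple).sum x = w.count x := by
  induction w with
  | nil => simp
  | cons y w ih =>
    rcases eq_or_ne x y with rfl | h
    · simp [ih, add_comm]
    · simp [ih, h, h.symm]

theorem sum_simple_ne_zero {w : List I} (hw : w ≠ []) : (w.map simple).sum ≠ 0 := by
  intro h
  obtain ⟨x, hx⟩ := List.exists_mem_of_ne_nil w hw
  have := congrFun h x
  rw [sum_simple_apply] at this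
  simp only [Pi.zero_apply, Nat.cast_eq_zero, List.count_eq_zero] at this
  exact this hx

theorem weightSpace_simple_eq_bot {μ : I → ℤ} (h : ¬ (0 ≤ μ ∧ μ ≠ 0)) :
    weightSpace K e simple μ = ⊥ := by
  rw [eq_bot_iff]
  refine Submodule.span_le.mpr ?_
  rintro _ ⟨w, rfl, rfl⟩
  rcases eq_or_ne w [] with rfl | hw
  · exact Submodule.zero_mem _
  · exact absurd ⟨sum_simple_nonneg w, sum_simple_ne_zero hw⟩ h

/-- The monomials whose weight is a multiple of a simple root. -/
theorem weightSpace_nsmul_simple (x : I) (n : ℕ) :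
    weightSpace K e simple ((n : ℤ) • simple x) ≤ if n = 1 then K ∙ e x else ⊥ := by
  refine Submodule.span_le.mpr ?_
  rintro _ ⟨w, hw, rfl⟩
  have hall : ∀ y ∈ w, y = x := by
    intro y hy
    by_contra hne
    have := congrFun hw y
    rw [sum_simple_apply] at this
    simp [hne, List.count_eq_zero] at this
    exact this hy
  have hlen := congrFun hw x
  rw [sum_simple_apply, List.eq_replicate_of_mem hall] at hlen
  simp at hlen
  have hmon : ∀ k, lieMonomial e (List.replicate (k + 2) x) = 0 := by
    intro k
    induction k with
    | zero => exact lie_self _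
    | succ k ih =>
      rw [List.replicate_succ, lieMonomial_cons e x (by simp), ih, lie_zero]
  rw [List.eq_replicate_of_mem hall, hlen]
  rcases n with _ | _ | n
  · simp [lieMonomial]
  · simp [lieMonomial]
  · simp [hmon n]

end SimpleWeights

/-- A subspace that embeds into a line is contained in a line. -/
theorem exists_le_span_singleton {K L : Type*} [Field K] [AddCommGroup L] [Module K L]
    {W : Submodule K L} (f : L →ₗ[K] L) (hf : ∀ z ∈ W, f z = 0 → z = 0) (v : L)
    (hv : ∀ z ∈ W, f z ∈ K ∙ v) : ∃ u, W ≤ K ∙ u := by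
  by_cases hW : W = ⊥
  · exact ⟨0, by simp [hW]⟩
  obtain ⟨u, hu, hu0⟩ := W.ne_bot_iff.mp hW
  obtain ⟨c, hc⟩ := Submodule.mem_span_singleton.mp (hv u hu)
  have hc0 : c ≠ 0 := by
    rintro rfl
    exact hu0 (hf u hu (by rw [← hc, zero_smul]))
  refine ⟨u, fun z hz => ?_⟩
  obtain ⟨d, hd⟩ := Submodule.mem_span_singleton.mp (hv z hz)
  have h1 : z - (d / c) • u = 0 := by
    refine hf _ (W.sub_mem hz (W.smul_mem _ hu)) ?_
    rw [map_sub, map_smul, ← hc, ← hd, smul_smul, div_mul_cancel₀ _ hc0, sub_self]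
  rw [sub_eq_zero.mp h1]
  exact Submodule.smul_mem _ _ (Submodule.mem_span_singleton_self u)

/-! ### Weights of Lie algebras with Serre relations -/

namespace SerreRelations

variable {I : Type*} [Fintype I] [DecidableEq I] {Γ : SimpleGraph I} [DecidableRel Γ.Adj]
  {L : Type*} [LieRing L] [LieAlgebra ℂ L] {g : Generators I → L}

/-- The span of the `H`-generators, in weight `0`. -/
def cartanPart (g : Generators I → L) (μ : I → ℤ) : Submodule ℂ L :=
  if μ = 0 then Submodule.span ℂ (Set.range fun x => g (.H x)) else ⊥

theorem cartanPart_zero (g : Generators I → L) :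
    cartanPart g 0 = Submodule.span ℂ (Set.range fun x => g (.H x)) := by simp [cartanPart]

theorem cartanPart_of_ne (g : Generators I → L) {μ : I → ℤ} (h : μ ≠ 0) :
    cartanPart g μ = ⊥ := by simp [cartanPart, h]

theorem cartanPart_swap (g : Generators I → L) (μ : I → ℤ) :
    cartanPart (swapGen g) μ = cartanPart g μ := by
  rcases eq_or_ne μ 0 with rfl | h
  · rw [cartanPart_zero, cartanPart_zero]
    refine le_antisymm (Submodule.span_le.mpr ?_) (Submodule.span_le.mpr ?_)
    · rintro _ ⟨x, rfl⟩
      exact Submodule.neg_mem _ (Submodule.subset_span ⟨x, rfl⟩)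
    · rintro _ ⟨x, rfl⟩
      exact neg_mem_iff.mp (Submodule.subset_span ⟨x, rfl⟩)
  · rw [cartanPart_of_ne _ h, cartanPart_of_ne _ h]

/-- The monomials in the `E`-generators. -/
abbrev posPart (g : Generators I → L) (μ : I → ℤ) : Submodule ℂ L :=
  Extremal.weightSpace ℂ (fun x => g (.E x)) simple μ

/-- The monomials in the `F`-generators. -/
abbrev negPart (g : Generators I → L) (μ : I → ℤ) : Submodule ℂ L :=
  Extremal.weightSpace ℂ (fun x => g (.F x)) simple (-μ)

theorem posPart_swap (g : Generators I → L) (μ : I → ℤ) :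
    posPart (swapGen g) μ = negPart g (-μ) := by
  simp [posPart, negPart, swapGen]

theorem negPart_swap (g : Generators I → L) (μ : I → ℤ) :
    negPart (swapGen g) μ = posPart g (-μ) := rfl

variable (hg : SerreRelations Γ g)
include hg

theorem lie_H_of_mem (x : I) {μ : I → ℤ} {z : L}
    (hz : z ∈ Extremal.weightSpace ℂ g genWeight μ) :
    ⁅g (.H x), z⁆ = form Γ (simple x) μ • z := by
  let S : (I → ℤ) → Submodule ℂ L := fun μ =>
    LinearMap.ker (LieAlgebra.ad ℂ L (g (.H x)) - ((form Γ (simple x) μ : ℤ) : ℂ) • LinearMap.id)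
  have hS : ∀ μ z, z ∈ S μ ↔ ⁅g (.H x), z⁆ = form Γ (simple x) μ • z := fun μ z => by
    simp [S, sub_eq_zero, Int.cast_smul_eq_zsmul]
  rw [← hS]
  refine weightSpace_le_of_closed g genWeight S (fun a => ?_) (fun a μ z hz => ?_) μ hz
  · rw [hS]
    cases a with
    | H y => simp [genWeight, hg.HH]
    | E y => rw [hg.HE, genWeight, form_simple_simple]
    | F y => rw [hg.HF, genWeight, map_neg, form_simple_simple, neg_smul]
  · rw [hS] at hz ⊢
    rw [leibniz_lie, hz, lie_zsmul, map_add, add_smul]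
    congr 1
    cases a with
    | H y => simp [genWeight, hg.HH]
    | E y => rw [hg.HE, zsmul_lie, genWeight, form_simple_simple]
    | F y => rw [hg.HF, neg_lie, zsmul_lie, genWeight, map_neg, form_simple_simple, neg_smul]

omit hg in
theorem posPart_le (μ : I → ℤ) : posPart g μ ≤ Extremal.weightSpace ℂ g genWeight μ :=
  weightSpace_le_of_closed _ _ _ (fun x => gen_mem_weightSpace g genWeight (.E x))
    (fun x _ _ hz => lie_mem_weightSpace g genWeight (.E x) hz) μ

theorem lie_H_posPart (x : I) {μ : I → ℤ} {z : L} (hz : z ∈ posPart g μ) :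
    ⁅g (.H x), z⁆ = form Γ (simple x) μ • z :=
  hg.lie_H_of_mem x (posPart_le μ hz)

theorem lie_E_cartanPart (x : I) {μ : I → ℤ} {z : L} (hz : z ∈ cartanPart g μ) :
    ⁅g (.E x), z⁆ ∈ posPart g (simple x + μ) := by
  rcases eq_or_ne μ 0 with rfl | h0
  · rw [cartanPart_zero] at hz
    rw [add_zero]
    have hle : Submodule.span ℂ (Set.range fun x => g (.H x)) ≤
        (posPart g (simple x)).comap (LieAlgebra.ad ℂ L (g (.E x))) := by
      refine Submodule.span_le.mpr ?_
      rintro _ ⟨y, rfl⟩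
      change ⁅g (.E x), g (.H y)⁆ ∈ posPart g (simple x)
      rw [← lie_skew, hg.HE]
      exact Submodule.neg_mem _ (zsmul_mem (gen_mem_weightSpace (fun x => g (.E x)) simple x) _)
    exact hle hz
  · rw [cartanPart_of_ne _ h0, Submodule.mem_bot] at hz
    rw [hz, lie_zero]; exact Submodule.zero_mem _

/-- Moving `F_x` past a leading `E_y` leaves an `H`-term, or nothing, plus `E_y` applied to a
shorter instance. The Cartan part arises from a single letter. -/
theorem lie_F_posPart (x : I) {μ : I → ℤ} {z : L} (hz : z ∈ posPart g μ) :
    ⁅g (.F x), z⁆ ∈ posPart g (μ - simple x) ⊔ cartanPart g (μ - simple x) := by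
  -- The second condition is carried along so that `H_x` acts on the remaining monomial by a scalar.
  let S : (I → ℤ) → Submodule ℂ L := fun μ =>
    (posPart g (μ - simple x) ⊔ cartanPart g (μ - simple x)).comap (LieAlgebra.ad ℂ L (g (.F x)))
      ⊓ posPart g μ
  refine (weightSpace_le_of_closed (fun x => g (.E x)) simple S (fun y => ⟨?_, ?_⟩)
    (fun y μ z hz => ⟨?_, ?_⟩) μ hz).1
  · change ⁅g (.F x), g (.E y)⁆ ∈
      posPart g (simple y - simple x) ⊔ cartanPart g (simple y - simple x)
    rw [← lie_skew]
    refine Submodule.neg_mem _ (Submodule.mem_sup_right ?_)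
    rcases eq_or_ne y x with rfl | h
    · rw [sub_self, cartanPart_zero, hg.EF]
      exact Submodule.subset_span ⟨y, rfl⟩
    · rw [hg.EF_of_ne h]; exact Submodule.zero_mem _
  · exact gen_mem_weightSpace (fun x => g (.E x)) simple y
  · obtain ⟨hz1, hz2⟩ := hz
    have hz1 : ⁅g (.F x), z⁆ ∈ posPart g (μ - simple x) ⊔ cartanPart g (μ - simple x) := hz1
    change ⁅g (.F x), ⁅g (.E y), z⁆⁆ ∈
      posPart g (simple y + μ - simple x) ⊔ cartanPart g (simple y + μ - simple x)
    rw [leibniz_lie]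
    refine Submodule.add_mem _ ?_ ?_
    · rw [← lie_skew (g (.F x))]
      rcases eq_or_ne y x with rfl | h
      · refine Submodule.mem_sup_left ?_
        rw [hg.EF, neg_lie, hg.lie_H_posPart y hz2, add_sub_cancel_left]
        exact Submodule.neg_mem _ (zsmul_mem hz2 _)
      · rw [hg.EF_of_ne h, neg_zero, zero_lie]; exact Submodule.zero_mem _
    · obtain ⟨a, ha, b, hb, hab⟩ := Submodule.mem_sup.mp hz1
      rw [← hab, lie_add, add_sub_assoc]
      refine Submodule.mem_sup_left (Submodule.add_mem _
        (lie_mem_weightSpace (fun x => g (.E x)) simple y ha) ?_)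
      exact hg.lie_E_cartanPart y hb
  · exact lie_mem_weightSpace (fun x => g (.E x)) simple y hz.2

omit hg in
/-- The sum of the parts of weight `μ` in the triangular decomposition. -/
def triangular (g : Generators I → L) (μ : I → ℤ) : Submodule ℂ L :=
  posPart g μ ⊔ negPart g μ ⊔ cartanPart g μ

omit hg in
theorem triangular_swap (g : Generators I → L) (μ : I → ℤ) : triangular (swapGen g) μ = triangular g (-μ) := by
  have : cartanPart g μ = cartanPart g (-μ) := by
    rcases eq_or_ne μ 0 with rfl | h
    · simp
    · rw [cartanPart_of_ne _ h, cartanPart_of_ne _ (neg_ne_zero.mpr h)]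
  rw [triangular, triangular, posPart_swap, negPart_swap, cartanPart_swap, sup_comm (negPart _ _),
    this]

theorem lie_F_triangular (x : I) {μ : I → ℤ} {z : L} (hz : z ∈ triangular g μ) :
    ⁅g (.F x), z⁆ ∈ triangular g (μ - simple x) := by
  obtain ⟨d, hd, c, hc, rfl⟩ := Submodule.mem_sup.mp hz
  obtain ⟨a, ha, b, hb, rfl⟩ := Submodule.mem_sup.mp hd
  rw [lie_add, lie_add]
  have e : simple x + -μ = -(μ - simple x) := by abel
  refine Submodule.add_mem _ (Submodule.add_mem _ ?_ ?_) ?_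
  · exact (sup_le_sup_right le_sup_left _ :
      posPart g (μ - simple x) ⊔ cartanPart g (μ - simple x) ≤ triangular g (μ - simple x))
      (hg.lie_F_posPart x ha)
  · refine Submodule.mem_sup_left (Submodule.mem_sup_right ?_)
    have := lie_mem_weightSpace (R := ℂ) (fun x => g (.F x)) simple x hb
    rwa [e] at this
  · refine Submodule.mem_sup_left (Submodule.mem_sup_right ?_)
    rw [← cartanPart_swap] at hc
    have := hg.swap.lie_E_cartanPart x hc
    rw [posPart_swap] at this
    rcases eq_or_ne μ 0 with rfl | h0
    · rwa [add_zero, ← zero_sub] at this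
    · rw [cartanPart_of_ne _ h0, Submodule.mem_bot] at hc
      rw [hc, lie_zero]; exact Submodule.zero_mem _

/-- The triangular sums contain the generators and are stable under them. Stability under `F_x` is
`lie_F_triangular`; the case of `E_x` follows from it through `swapGen`. -/
theorem weightSpace_le_triangular (μ : I → ℤ) :
    Extremal.weightSpace ℂ g genWeight μ ≤ triangular g μ := by
  refine (weightSpace_le_of_closed g genWeight
    (fun μ => triangular g μ ⊓ Extremal.weightSpace ℂ g genWeight μ) (fun a => ⟨?_, ?_⟩)
    (fun a μ z hz => ⟨?_, ?_⟩) μ).trans inf_le_left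
  · cases a with
    | H x =>
      refine Submodule.mem_sup_right ?_
      rw [genWeight, cartanPart_zero]
      exact Submodule.subset_span ⟨x, rfl⟩
    | E x => exact Submodule.mem_sup_left (Submodule.mem_sup_left
        (gen_mem_weightSpace (fun x => g (.E x)) simple x))
    | F x =>
      refine Submodule.mem_sup_left (Submodule.mem_sup_right ?_)
      rw [negPart, genWeight, neg_neg]
      exact gen_mem_weightSpace (fun x => g (.F x)) simple x
  · exact gen_mem_weightSpace g genWeight a
  · cases a with
    | H x =>
      rw [hg.lie_H_of_mem x hz.2, genWeight, zero_add]
      exact zsmul_mem hz.1 _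
    | E x =>
      have h1 := hz.1
      rw [← neg_neg μ, ← triangular_swap] at h1
      have h2 := hg.swap.lie_F_triangular x h1
      rw [triangular_swap] at h2
      have e : -(-μ - simple x) = genWeight (.E x) + μ := by rw [genWeight]; abel
      rwa [e] at h2
    | F x =>
      have h2 := hg.lie_F_triangular x hz.1
      have e : μ - simple x = genWeight (.F x) + μ := by rw [genWeight]; abel
      rwa [e] at h2
  · exact lie_mem_weightSpace g genWeight a hz.2

end SerreRelations

/-! ### Roots and multiplicities by `sl₂` theory. -/

namespace SerreRelations

variable {I : Type*} [Fintype I] [DecidableEq I] {Γ : SimpleGraph I} [DecidableRel Γ.Adj]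
  {L : Type*} [LieRing L] [LieAlgebra ℂ L] {g : Generators I → L}

theorem weightSpace_swap (g : Generators I → L) (μ : I → ℤ) :
    Extremal.weightSpace ℂ g genWeight μ ≤
      Extremal.weightSpace ℂ (swapGen g) genWeight (-μ) := by
  refine weightSpace_le_of_closed g genWeight
    (fun μ => Extremal.weightSpace ℂ (swapGen g) genWeight (-μ)) (fun a => ?_)
    (fun a μ z hz => ?_) μ
  · cases a with
    | H x =>
      have := gen_mem_weightSpace (R := ℂ) (swapGen g) genWeight (.H x)
      simpa [genWeight, swapGen] using this
    | E x => exact gen_mem_weightSpace (R := ℂ) (swapGen g) genWeight (.F x)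
    | F x =>
      simpa [genWeight, swapGen] using gen_mem_weightSpace (R := ℂ) (swapGen g) genWeight (.E x)
  · cases a with
    | H x =>
      have := lie_mem_weightSpace (R := ℂ) (swapGen g) genWeight (.H x) hz
      rw [swapGen, neg_lie, neg_mem_iff] at this
      simpa [genWeight] using this
    | E x =>
      have := lie_mem_weightSpace (R := ℂ) (swapGen g) genWeight (.F x) hz
      rwa [neg_add]
    | F x =>
      have := lie_mem_weightSpace (R := ℂ) (swapGen g) genWeight (.E x) hz
      rwa [genWeight, neg_add, neg_neg]

variable (hg : SerreRelations Γ g)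
include hg

/-- The elements killed by some power of `ad E_x` form the Engel subalgebra, so it suffices to check
the generators. -/
theorem exists_ad_pow_eq_zero (hgen : Generates ℂ g) (x : I) (z : L) :
    ∃ d, (LieAlgebra.ad ℂ L (g (.E x)) ^ d) z = 0 := by
  rw [← LieSubalgebra.mem_engel_iff]
  refine hgen.eq_top_of_mem (fun a => ?_) z
  rw [LieSubalgebra.mem_engel_iff]
  have hEH : ∀ y, ⁅g (.E x), g (.H y)⁆ = -(cartanMatrix Γ y x • g (.E x)) := fun y => by
    rw [← lie_skew, hg.HE]
  cases a with
  | H y => exact ⟨2, by simp [pow_succ, hEH]⟩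
  | E y =>
    by_cases h : Γ.Adj x y
    · exact ⟨2, by simp [pow_succ, hg.EEE h]⟩
    · exact ⟨1, by simp [hg.EE h]⟩
  | F y =>
    rcases eq_or_ne x y with rfl | h
    · exact ⟨3, by simp [pow_succ, hg.EF, hEH]⟩
    · exact ⟨1, by simp [hg.EF_of_ne h]⟩

/-- Powers of an `F`-generator act injectively on suitable weight spaces. -/
theorem ad_F_pow_injOn (hgen : Generates ℂ g) (x : I) {μ : I → ℤ} {n : ℕ} (hn : 0 < n)
    (hμ : form Γ (simple x) μ = n) {z : L} (hz : z ∈ Extremal.weightSpace ℂ g genWeight μ)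
    (h0 : (LieAlgebra.ad ℂ L (g (.F x)) ^ n) z = 0) : z = 0 := by
  obtain ⟨d, hd⟩ := hg.exists_ad_pow_eq_zero hgen x z
  have hxx : cartanMatrix Γ x x = 2 := by simp [cartanMatrix]
  refine eq_zero_of_ad_pow_eq_zero (k := ℂ) (hg.EF x) ?_ ?_ d n z hn ?_ hd h0
  · rw [hg.HE, hxx, ← Int.cast_smul_eq_zsmul ℂ]; norm_num
  · rw [hg.HF, hxx, ← Int.cast_smul_eq_zsmul ℂ]; norm_num
  · rw [hg.lie_H_of_mem x hz, hμ, ← Int.cast_smul_eq_zsmul ℂ]; norm_num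

omit hg in
theorem ad_F_pow_mem (x : I) {μ : I → ℤ} (n : ℕ) {z : L}
    (hz : z ∈ Extremal.weightSpace ℂ g genWeight μ) :
    (LieAlgebra.ad ℂ L (g (.F x)) ^ n) z ∈
      Extremal.weightSpace ℂ g genWeight (μ - (n : ℤ) • simple x) := by
  induction n with
  | zero => simpa using hz
  | succ n ih =>
    rw [ad_pow_succ]
    have := lie_mem_weightSpace g genWeight (.F x) ih
    convert this using 1
    rw [genWeight, Nat.cast_succ, add_smul, one_smul, sub_add_eq_sub_sub, sub_eq_neg_add]

theorem weightSpace_le_posPart {μ : I → ℤ} (h0 : 0 ≤ μ) (h1 : μ ≠ 0) :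
    Extremal.weightSpace ℂ g genWeight μ ≤ posPart g μ := by
  refine (hg.weightSpace_le_triangular μ).trans ?_
  rw [triangular, cartanPart_of_ne _ h1, negPart, weightSpace_simple_eq_bot]
  · simp
  · rintro ⟨h2, -⟩
    exact h1 (le_antisymm (neg_nonneg.mp h2) h0)

theorem nonneg_or_nonpos {μ : I → ℤ} (h : Extremal.weightSpace ℂ g genWeight μ ≠ ⊥) :
    0 ≤ μ ∨ μ ≤ 0 := by
  by_contra! hc
  refine h (eq_bot_iff.mpr ((hg.weightSpace_le_triangular μ).trans ?_))
  rw [triangular, posPart, negPart, weightSpace_simple_eq_bot, weightSpace_simple_eq_bot,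
    cartanPart_of_ne]
  · simp
  · rintro rfl; exact hc.1 le_rfl
  · exact fun h2 => hc.2 (neg_nonneg.mp h2.1)
  · exact fun h2 => hc.1 h2.1

theorem weightSpace_zero_le :
    Extremal.weightSpace ℂ g genWeight 0 ≤ Submodule.span ℂ (Set.range fun x => g (.H x)) := by
  refine (hg.weightSpace_le_triangular 0).trans ?_
  rw [triangular, posPart, negPart, weightSpace_simple_eq_bot, weightSpace_simple_eq_bot,
    cartanPart_zero] <;> simp

variable (hΓ : IsPosDef Γ) (hgen : Generates ℂ g)
include hΓ hgen

/-- Positive weights are roots and their weight spaces are lines. -/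
theorem weightSpace_pos (n : ℕ) : ∀ μ : I → ℤ, ∑ x, μ x = n → 0 ≤ μ → μ ≠ 0 →
    Extremal.weightSpace ℂ g genWeight μ ≠ ⊥ →
    μ ∈ Root Γ ∧ ∃ v, Extremal.weightSpace ℂ g genWeight μ ≤ ℂ ∙ v := by
  induction n using Nat.strong_induction_on with
  | _ n ih =>
  intro μ hn h0 h1 hne
  obtain ⟨x, hx, hf⟩ := exists_form_simple_pos Γ h0 (hΓ μ h1)
  obtain ⟨m, hm⟩ := Int.eq_ofNat_of_zero_le hf.le
  have hm0 : 0 < m := by omega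
  -- `μ'` is the reflection of `μ` in `α_x`. It has the same norm and smaller height, and `ad F_x ^
  -- m` embeds the weight space of `μ` into that of `μ'`.
  set μ' := μ - (m : ℤ) • simple x with hμ'
  have hform : form Γ μ' μ' = form Γ μ μ := by
    rw [hμ', form_sub_self, map_smul, map_smul, LinearMap.map_smul₂, form_simple_self,
      form_comm Γ μ (simple x), hm, smul_eq_mul, smul_eq_mul, smul_eq_mul]
    ring
  have hinj : ∀ z ∈ Extremal.weightSpace ℂ g genWeight μ,
      (LieAlgebra.ad ℂ L (g (.F x)) ^ m) z = 0 → z = 0 :=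
    fun z hz h => hg.ad_F_pow_injOn hgen x hm0 hm hz h
  have hne' : Extremal.weightSpace ℂ g genWeight μ' ≠ ⊥ := by
    obtain ⟨z, hz, hz0⟩ := (Submodule.ne_bot_iff _).mp hne
    exact (Submodule.ne_bot_iff _).mpr ⟨_, ad_F_pow_mem x m hz, fun h => hz0 (hinj z hz h)⟩
  rcases hg.nonneg_or_nonpos hne' with h2 | h2
  · have h3 : μ' ≠ 0 := by
      intro h
      have := hΓ μ h1
      rw [← hform, h] at this
      simp at this
    have hsum : ∑ y, μ' y = ∑ y, μ y - m := by
      simp [hμ', Finset.sum_sub_distrib, ← Finset.mul_sum]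
    have hsum0 : 0 ≤ ∑ y, μ' y := Finset.sum_nonneg fun y _ => h2 y
    obtain ⟨hr, v, hv⟩ := ih (n - m) (by omega) μ' (by omega) h2 h3 hne'
    refine ⟨?_, exists_le_span_singleton _ hinj v fun z hz => hv (ad_F_pow_mem x m hz)⟩
    change form Γ μ μ = 2
    rw [← hform]; exact hr
  -- If the reflection is nonpositive, `μ` is supported at `x`. Among multiples of `α_x`, only `α_x`
  -- itself carries a nonzero monomial in the `E`-generators.
  · have hμx : μ = ((μ x).toNat : ℤ) • simple x := by
      funext y
      by_cases hy : y = x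
      · subst hy; simp [hx.le]
      · have h3 := h2 y
        have h4 := h0 y
        simp [hμ', hy] at h3 h4 ⊢
        exact le_antisymm h3 h4
    have hle := hg.weightSpace_le_posPart h0 h1
    rw [hμx] at hle
    have hle2 := hle.trans (weightSpace_nsmul_simple (fun x => g (.E x)) x _)
    rw [← hμx] at hle2
    split_ifs at hle2 with h3
    · rw [h3] at hμx
      refine ⟨?_, _, hle2⟩
      rw [hμx, Nat.cast_one, one_smul]
      exact simple_mem_root x
    · exact absurd (eq_bot_iff.mpr hle2) hne

/-- Nonzero weights are roots and their weight spaces are lines. -/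
theorem weightSpace_ne_zero {μ : I → ℤ} (h1 : μ ≠ 0)
    (hne : Extremal.weightSpace ℂ g genWeight μ ≠ ⊥) :
    μ ∈ Root Γ ∧ ∃ v, Extremal.weightSpace ℂ g genWeight μ ≤ ℂ ∙ v := by
  have hnat : ∀ ν : I → ℤ, 0 ≤ ν → ∑ x, ν x = ((∑ x, ν x).toNat : ℤ) := fun ν hν =>
    (Int.toNat_of_nonneg (Finset.sum_nonneg fun x _ => hν x)).symm
  rcases hg.nonneg_or_nonpos hne with h0 | h0
  · exact hg.weightSpace_pos hΓ hgen _ μ (hnat μ h0) h0 h1 hne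
  · have h0' := neg_nonneg.mpr h0
    have hle := weightSpace_swap g μ
    have hgen' : Generates ℂ (swapGen g) := by
      rw [Generates, eq_top_iff]
      rintro z -
      refine hgen.eq_top_of_mem (fun a => ?_) z
      cases a with
      | H x => exact neg_mem_iff.mp (LieSubalgebra.subset_lieSpan ⟨.H x, rfl⟩)
      | E x => exact LieSubalgebra.subset_lieSpan ⟨.F x, rfl⟩
      | F x => exact LieSubalgebra.subset_lieSpan ⟨.E x, rfl⟩
    obtain ⟨hr, v, hv⟩ := hg.swap.weightSpace_pos hΓ hgen' _ (-μ) (hnat _ h0') h0'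
      (neg_ne_zero.mpr h1) fun h => hne (eq_bot_iff.mpr (h ▸ hle))
    exact ⟨by simpa using neg_mem_root hr, v, hle.trans hv⟩

end SerreRelations

/-! ### The Kac-Moody algebra and the model -/

section Model

variable {I : Type*} [Fintype I] [DecidableEq I] {Γ : SimpleGraph I} [DecidableRel Γ.Adj]

namespace Model

instance [hΓ : Fact (IsPosDef Γ)] : LieRing (Model Γ) where
  bracket x y := br Γ x y
  add_lie x y z := by simp
  lie_add x y z := by simp
  lie_self x := by
    have h := br_swap x x
    have h2 : (2 : ℂ) • br Γ x x = 0 := by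
      rw [two_smul]; nth_rewrite 1 [h]; exact neg_add_cancel _
    exact (smul_eq_zero.mp h2).resolve_left two_ne_zero
  leibniz_lie x y z := leibniz hΓ.out x y z

instance [Fact (IsPosDef Γ)] : LieAlgebra ℂ (Model Γ) where
  lie_smul t x y := (br Γ x).map_smul t y

theorem lie_def [Fact (IsPosDef Γ)] (x y : Model Γ) : ⁅x, y⁆ = br Γ x y := rfl

variable (Γ) in
/-- The Chevalley generators of the model. -/
def gen : Generators I → Model Γ
  | .H x => coroot Γ (simple x)
  | .E x => rootVec Γ (simple x)
  -- Opposite root vectors bracket to minus the coroot; this sign restores `⁅E_x, F_x⁆ = H_x`.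
  | .F x => -rootVec Γ (-simple x)

theorem serreRelations [hΓ : Fact (IsPosDef Γ)] : SerreRelations Γ (gen Γ) := by
  have hr : ∀ x, simple x ∈ Root Γ := simple_mem_root
  have hn : ∀ x, -simple x ∈ Root Γ := fun x => neg_mem_root (simple_mem_root x)
  have hEE : ∀ {x y : I}, Γ.Adj x y → simple x + simple y ∈ Root Γ := fun h =>
    (add_mem_root_iff (hr _) (hr _)).mpr (form_simple_adj Γ h)
  have hFF : ∀ {x y : I}, Γ.Adj x y → -simple x + -simple y ∈ Root Γ := fun h => by
    rw [← neg_add]; exact neg_mem_root (hEE h)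
  refine ⟨fun x y => ?_, fun x => ?_, fun {x y} h => ?_, fun x y => ?_, fun x y => ?_,
    fun {x y} h => ?_, fun {x y} h => ?_, fun {x y} h => ?_, fun {x y} h => ?_⟩
  · simp [lie_def, gen, br_coroot_coroot]
  · simp [lie_def, gen, br_rootVec_of_add_eq_zero (hr x) (hn x) (add_neg_cancel _)]
  · have h1 : 0 ≥ form Γ (simple x) (simple y) :=
      form_simple_nonpos Γ (Pi.single_nonneg.mpr zero_le_one) (by simp [h])
    simp only [lie_def, gen, map_neg]
    rw [br_rootVec_eq_zero hΓ.out (hr x) (hn y) (by simp; omega) (by simp; omega), neg_zero]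
  · simp [lie_def, gen, br_coroot_rootVec, form_simple_simple]
  · simp [lie_def, gen, br_coroot_rootVec, form_simple_simple]
  · rcases eq_or_ne x y with rfl | hne
    · exact lie_self _
    · have := form_simple_not_adj Γ hne h
      exact br_rootVec_eq_zero hΓ.out (hr x) (hr y) (by omega) (by omega)
  · simp only [lie_def, gen]
    rw [br_rootVec (hr x) (hr y) (ne_zero_of_mem_root (hEE h)), map_zsmul,
      br_rootVec_eq_zero hΓ.out (hr x) (hEE h) (by simp [form_simple_self, form_simple_adj Γ h])
        (by simp [form_simple_self, form_simple_adj Γ h]), smul_zero]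
  · rcases eq_or_ne x y with rfl | hne
    · exact lie_self _
    · have := form_simple_not_adj Γ hne h
      simp only [lie_def, gen, map_neg, LinearMap.neg_apply, neg_neg]
      exact br_rootVec_eq_zero hΓ.out (hn x) (hn y) (by simp; omega) (by simp; omega)
  · simp only [lie_def, gen, map_neg, LinearMap.neg_apply, neg_neg]
    rw [br_rootVec (hn x) (hn y) (ne_zero_of_mem_root (hFF h)), map_zsmul,
      br_rootVec_eq_zero hΓ.out (hn x) (hFF h) (by simp [form_simple_self, form_simple_adj Γ h])
        (by simp [form_simple_self, form_simple_adj Γ h]), smul_zero, neg_zero]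

end Model

variable [hΓ : Fact (IsPosDef Γ)]

variable (Γ) in
/-- The map from the Kac-Moody algebra to the model. -/
def KacMoody.toModel : KacMoody Γ →ₗ⁅ℂ⁆ Model Γ := KacMoody.lift Model.serreRelations

theorem KacMoody.toModel_gen (a : Generators I) :
    KacMoody.toModel Γ (KacMoody.gen Γ a) = Model.gen Γ a := KacMoody.lift_gen _ a

-- Induction on the height: removing a simple root reduces to a smaller root, and bracketing with
-- `E_x` or `F_x` returns the desired root vector up to a sign.
open Model in
theorem KacMoody.exists_toModel_eq_of_nonneg (n : ℕ) : ∀ u ∈ Root Γ, 0 ≤ u → ∑ x, u x = n →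
    (∃ z ∈ KacMoody.weightSpace Γ u, KacMoody.toModel Γ z = rootVec Γ u) ∧
      ∃ z ∈ KacMoody.weightSpace Γ (-u), KacMoody.toModel Γ z = rootVec Γ (-u) := by
  induction n with
  | zero =>
    intro u hu h0 hs
    refine absurd (funext fun x => ?_) (ne_zero_of_mem_root hu)
    exact (Finset.sum_eq_zero_iff_of_nonneg fun x _ => h0 x).mp hs x (Finset.mem_univ x)
  | succ n ih =>
    intro u hu h0 hs
    by_cases hsimp : ∃ x, u = simple x
    · obtain ⟨x, rfl⟩ := hsimp
      refine ⟨⟨_, gen_mem_weightSpace _ genWeight (.E x), toModel_gen _⟩, -KacMoody.gen Γ (.F x),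
        Submodule.neg_mem _ (gen_mem_weightSpace _ genWeight (.F x)), ?_⟩
      rw [map_neg, toModel_gen, Model.gen, neg_neg]
    · push Not at hsimp
      obtain ⟨x, hr, hx⟩ := hΓ.out.exists_sub_simple hu h0 hsimp
      have hxr : simple x ∈ Root Γ := simple_mem_root x
      obtain ⟨⟨a, ha, ha'⟩, b, hb, hb'⟩ := ih (u - simple x) hr hx (by
        simp [Finset.sum_sub_distrib, hs])
      have e1 : simple x + (u - simple x) = u := add_sub_cancel _ _
      have e2 : -simple x + -(u - simple x) = -u := by abel
      have n1 : simple x + (u - simple x) ≠ 0 := by rw [e1]; exact ne_zero_of_mem_root hu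
      have n2 : -simple x + -(u - simple x) ≠ 0 := by
        rw [e2]; exact ne_zero_of_mem_root (neg_mem_root hu)
      constructor
      · refine ⟨eps Γ (simple x) (u - simple x) • ⁅KacMoody.gen Γ (.E x), a⁆, zsmul_mem ?_ _, ?_⟩
        · have := lie_mem_weightSpace (KacMoody.gen Γ) genWeight (.E x) ha
          rwa [genWeight, e1] at this
        · rw [map_zsmul, LieHom.map_lie, ha', toModel_gen, Model.gen, lie_def,
            br_rootVec hxr hr n1, e1, ← mul_smul, eps_mul_self, one_smul]
      · refine ⟨-(eps Γ (-simple x) (-(u - simple x)) • ⁅KacMoody.gen Γ (.F x), b⁆),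
          neg_mem (zsmul_mem ?_ _), ?_⟩
        · have := lie_mem_weightSpace (KacMoody.gen Γ) genWeight (.F x) hb
          rwa [genWeight, e2] at this
        · rw [map_neg, map_zsmul, LieHom.map_lie, hb', toModel_gen, Model.gen, neg_lie,
            lie_def, br_rootVec (neg_mem_root hxr) (neg_mem_root hr) n2, e2, smul_neg, neg_neg, ← mul_smul,
            eps_mul_self, one_smul]

open Model in
theorem KacMoody.exists_toModel_eq (u : I → ℤ) (hu : u ∈ Root Γ) :
    ∃ z ∈ KacMoody.weightSpace Γ u, KacMoody.toModel Γ z = rootVec Γ u := by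
  have hnat : ∀ ν : I → ℤ, 0 ≤ ν → ∑ x, ν x = ((∑ x, ν x).toNat : ℤ) := fun ν hν =>
    (Int.toNat_of_nonneg (Finset.sum_nonneg fun x _ => hν x)).symm
  rcases hΓ.out.root_nonneg_or_nonpos hu with h | h
  · exact (exists_toModel_eq_of_nonneg _ u hu h (hnat u h)).1
  · have h' := neg_nonneg.mpr h
    simpa using (exists_toModel_eq_of_nonneg _ (-u) (neg_mem_root hu) h' (hnat _ h')).2

variable (Γ) in
/-- The root vectors of the Kac-Moody algebra that map to those of the model, and the `H_x`. -/
def KacMoody.rootBasisFun : I ⊕ Root Γ → KacMoody Γ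
  | .inl x => KacMoody.gen Γ (.H x)
  | .inr u => (KacMoody.exists_toModel_eq u.1 u.2).choose

theorem KacMoody.rootBasisFun_mem (u : Root Γ) :
    KacMoody.rootBasisFun Γ (.inr u) ∈ KacMoody.weightSpace Γ u.1 :=
  (KacMoody.exists_toModel_eq u.1 u.2).choose_spec.1

theorem KacMoody.toModel_rootBasisFun (i : I ⊕ Root Γ) :
    KacMoody.toModel Γ (KacMoody.rootBasisFun Γ i) = Model.stdBasis Γ i := by
  rcases i with x | u
  · rw [KacMoody.rootBasisFun, KacMoody.toModel_gen, Model.gen, Model.coroot_simple]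
  · rw [← Model.rootVec_coe]
    exact (KacMoody.exists_toModel_eq u.1 u.2).choose_spec.2

theorem KacMoody.rootBasisFun_ne_zero (i : I ⊕ Root Γ) : KacMoody.rootBasisFun Γ i ≠ 0 := by
  intro h
  have h1 := KacMoody.toModel_rootBasisFun i
  rw [h, map_zero] at h1
  exact (Model.stdBasis Γ).ne_zero i h1.symm

/-- The `sl₂` argument shows that weights have norm 2. Conversely, the preimages of the model's root
vectors are nonzero elements of the corresponding weight spaces. -/
theorem rootSystem_eq : rootSystem Γ = Root Γ := by
  ext u
  refine ⟨fun h => ((KacMoody.serreRelations Γ).weightSpace_ne_zero hΓ.out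
    (KacMoody.generates Γ) h.1 h.2).1, fun h => ⟨ne_zero_of_mem_root h, ?_⟩⟩
  exact (Submodule.ne_bot_iff _).mpr ⟨_, KacMoody.rootBasisFun_mem ⟨u, h⟩,
    KacMoody.rootBasisFun_ne_zero _⟩

theorem KacMoody.span_rootBasisFun :
    ⊤ ≤ Submodule.span ℂ (Set.range (KacMoody.rootBasisFun Γ)) := by
  rw [← (KacMoody.generates Γ).iSup_weightSpace genWeight]
  refine iSup_le fun μ => ?_
  by_cases hbot : KacMoody.weightSpace Γ μ = ⊥
  · exact (le_of_eq hbot).trans bot_le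
  rcases eq_or_ne μ 0 with rfl | h0
  · refine (KacMoody.serreRelations Γ).weightSpace_zero_le.trans (Submodule.span_mono ?_)
    rintro _ ⟨x, rfl⟩
    exact ⟨.inl x, rfl⟩
  · obtain ⟨hr, v, hv⟩ := (KacMoody.serreRelations Γ).weightSpace_ne_zero hΓ.out
      (KacMoody.generates Γ) h0 hbot
    obtain ⟨c, hc⟩ := Submodule.mem_span_singleton.mp (hv (KacMoody.rootBasisFun_mem ⟨μ, hr⟩))
    have hc0 : c ≠ 0 := by
      rintro rfl
      exact KacMoody.rootBasisFun_ne_zero (.inr ⟨μ, hr⟩) (by rw [← hc, zero_smul])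
    refine hv.trans ((Submodule.span_singleton_le_iff_mem _ _).mpr ?_)
    rw [← inv_smul_smul₀ hc0 v, hc]
    exact Submodule.smul_mem _ _ (Submodule.subset_span ⟨_, rfl⟩)

variable (Γ) in
/-- The basis of the Kac-Moody algebra corresponding to the standard basis of the model. -/
def KacMoody.rootBasis : Module.Basis (I ⊕ Root Γ) ℂ (KacMoody Γ) :=
  Module.Basis.mk (v := KacMoody.rootBasisFun Γ) (by
    refine LinearIndependent.of_comp (KacMoody.toModel Γ : KacMoody Γ →ₗ[ℂ] Model Γ) ?_
    have h : ⇑(KacMoody.toModel Γ : KacMoody Γ →ₗ[ℂ] Model Γ) ∘ KacMoody.rootBasisFun Γ =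
        Model.stdBasis Γ := funext KacMoody.toModel_rootBasisFun
    rw [h]
    exact (Model.stdBasis Γ).linearIndependent) KacMoody.span_rootBasisFun

theorem KacMoody.rootBasis_apply (i : I ⊕ Root Γ) :
    KacMoody.rootBasis Γ i = KacMoody.rootBasisFun Γ i := by
  simp [KacMoody.rootBasis]

/-- The map carries a basis to a basis. Identities in the Kac-Moody algebra can therefore be
verified in the model, where brackets are explicit. -/
theorem KacMoody.toModel_injective : Function.Injective (KacMoody.toModel Γ) := by
  let e := (KacMoody.rootBasis Γ).equiv (Model.stdBasis Γ) (Equiv.refl _)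
  have : (KacMoody.toModel Γ : KacMoody Γ →ₗ[ℂ] Model Γ) = e.toLinearMap :=
    (KacMoody.rootBasis Γ).ext fun i => by
      refine Eq.trans ?_ ((KacMoody.rootBasis Γ).equiv_apply i (Model.stdBasis Γ) _).symm
      rw [KacMoody.rootBasis_apply]
      exact KacMoody.toModel_rootBasisFun i
  intro a b hab
  refine e.injective ?_
  have h1 := LinearMap.congr_fun this a
  have h2 := LinearMap.congr_fun this b
  exact h1.symm.trans (hab.trans h2)

end Model

/-! ### Existence of a Chevalley basis -/

section Existence

variable {I : Type*} [Fintype I] [DecidableEq I] {Γ : SimpleGraph I} [DecidableRel Γ.Adj]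

open Classical in
/-- The sign that turns the root vectors of the model into a Chevalley basis. -/
def rootSign (u : I → ℤ) : ℤ := if 0 ≤ u then 1 else -1

theorem rootSign_eq_or (u : I → ℤ) : rootSign u = 1 ∨ rootSign u = -1 := by
  unfold rootSign; split_ifs <;> simp

theorem rootSign_mul_self (u : I → ℤ) : rootSign u * rootSign u = 1 := by
  rcases rootSign_eq_or u with h | h <;> simp [h]

theorem IsPosDef.rootSign_neg (h : IsPosDef Γ) {u : I → ℤ} (hu : u ∈ Root Γ) :
    rootSign (-u) = -rootSign u := by
  have h0 := ne_zero_of_mem_root hu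
  rcases h.root_nonneg_or_nonpos hu with h1 | h1
  · have h2 : ¬ u ≤ 0 := fun h2 => h0 (le_antisymm h2 h1)
    simp [rootSign, h1, h2]
  · have h2 : ¬ 0 ≤ u := fun h2 => h0 (le_antisymm h1 h2)
    simp [rootSign, h1, h2]

variable [hΓ : Fact (IsPosDef Γ)]

/-- The roots, as the weights of the Kac-Moody algebra and as vectors of norm `2`. -/
def rootEquiv : Root Γ ≃ rootSystem Γ := Equiv.setCongr rootSystem_eq.symm

open Classical in
variable (Γ) in
/-- The signs, as units. -/
def signUnit : I ⊕ rootSystem Γ → ℂˣ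
  | .inl _ => 1
  | .inr u => if 0 ≤ u.1 then 1 else -1

variable (Γ) in
/-- The basis of the Kac-Moody algebra underlying a Chevalley basis. -/
def chevalleyFamily : Module.Basis (I ⊕ rootSystem Γ) ℂ (KacMoody Γ) :=
  ((KacMoody.rootBasis Γ).reindex (Equiv.sumCongr (Equiv.refl I) rootEquiv)).unitsSMul
    (signUnit Γ)

theorem chevalleyFamily_inl (x : I) :
    chevalleyFamily Γ (.inl x) = KacMoody.gen Γ (.H x) := by
  simp [chevalleyFamily, Module.Basis.unitsSMul_apply, signUnit, KacMoody.rootBasis_apply,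
    KacMoody.rootBasisFun]

theorem chevalleyFamily_inr (u : rootSystem Γ) :
    chevalleyFamily Γ (.inr u) =
      rootSign u.1 • KacMoody.rootBasisFun Γ (.inr (rootEquiv.symm u)) := by
  simp only [chevalleyFamily, Module.Basis.unitsSMul_apply, signUnit, rootSign]
  split_ifs <;> simp [KacMoody.rootBasis_apply]

theorem toModel_chevalleyFamily_inl (x : I) :
    KacMoody.toModel Γ (chevalleyFamily Γ (.inl x)) = Model.coroot Γ (simple x) := by
  rw [chevalleyFamily_inl, KacMoody.toModel_gen, Model.gen]

theorem toModel_chevalleyFamily_inr (u : rootSystem Γ) :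
    KacMoody.toModel Γ (chevalleyFamily Γ (.inr u)) = rootSign u.1 • Model.rootVec Γ u.1 := by
  rw [chevalleyFamily_inr, map_zsmul, KacMoody.toModel_rootBasisFun, ← Model.rootVec_coe]
  rfl

theorem mem_root (u : rootSystem Γ) : u.1 ∈ Root Γ := by
  rw [← rootSystem_eq]; exact u.2

open Model in
theorem toModel_lie_chevalleyFamily (u v : rootSystem Γ) :
    KacMoody.toModel Γ ⁅chevalleyFamily Γ (.inr u), chevalleyFamily Γ (.inr v)⁆ =
      (rootSign u.1 * rootSign v.1) • br Γ (rootVec Γ u.1) (rootVec Γ v.1) := by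
  rw [LieHom.map_lie, toModel_chevalleyFamily_inr, toModel_chevalleyFamily_inr, zsmul_lie,
    lie_zsmul, ← mul_smul, lie_def]

open Model in
variable (Γ) in
/-- The Chevalley basis given by the cocycle. -/
def chevalleyBasis : ChevalleyBasis Γ where
  basis := chevalleyFamily Γ
  basis_inl := chevalleyFamily_inl
  mem_weightSpace u := by
    rw [chevalleyFamily_inr]
    exact zsmul_mem (KacMoody.rootBasisFun_mem (rootEquiv.symm u)) _
  basis_simple x u hu := by
    apply KacMoody.toModel_injective
    have : (0 : I → ℤ) ≤ Pi.single x 1 := Pi.single_nonneg.mpr zero_le_one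
    rw [toModel_chevalleyFamily_inr, KacMoody.toModel_gen, gen, hu, rootSign, if_pos this, one_smul]
  basis_neg_simple x u hu := by
    apply KacMoody.toModel_injective
    have h1 := hΓ.out.rootSign_neg (simple_mem_root (Γ := Γ) x)
    have : (0 : I → ℤ) ≤ simple x := Pi.single_nonneg.mpr zero_le_one
    rw [show rootSign (simple x) = 1 from if_pos this] at h1
    rw [toModel_chevalleyFamily_inr, KacMoody.toModel_gen, gen, hu, h1, neg_smul, one_smul]
  lie_H_H x y := by rw [chevalleyFamily_inl, chevalleyFamily_inl, (KacMoody.serreRelations Γ).HH]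
  lie_H_E x u := by
    apply KacMoody.toModel_injective
    rw [LieHom.map_lie, map_zsmul, toModel_chevalleyFamily_inl, toModel_chevalleyFamily_inr,
      lie_zsmul, lie_def, br_coroot_rootVec, form_simple_left, smul_comm]
  -- The signs of `u` and `-u` are opposite, which turns the model's minus coroot into the coroot.
  lie_opposite u v h := by
    apply KacMoody.toModel_injective
    rw [toModel_lie_chevalleyFamily, br_rootVec_of_add_eq_zero (mem_root u) (mem_root v) h,
      (neg_eq_of_add_eq_zero_right h).symm, hΓ.out.rootSign_neg (mem_root u), mul_neg,
      rootSign_mul_self, neg_smul, one_smul, neg_neg, map_sum, coroot]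
    refine Finset.sum_congr rfl fun x _ => ?_
    rw [map_zsmul, toModel_chevalleyFamily_inl, coroot_simple]
  lie_root u v w h := by
    have h0 : u.1 + v.1 ≠ 0 := h ▸ w.2.1
    have key : ⁅chevalleyFamily Γ (.inr u), chevalleyFamily Γ (.inr v)⁆ =
        (rootSign u.1 * rootSign v.1 * rootSign w.1 * eps Γ u.1 v.1) •
          chevalleyFamily Γ (.inr w) := by
      apply KacMoody.toModel_injective
      rw [toModel_lie_chevalleyFamily, br_rootVec (mem_root u) (mem_root v) h0, map_zsmul,
        toModel_chevalleyFamily_inr, h, ← mul_smul, ← mul_smul]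
      congr 1
      linear_combination
        -(rootSign u.1 * rootSign v.1 * eps Γ u.1 v.1) * rootSign_mul_self w.1
    rw [key]
    rcases rootSign_eq_or u.1 with h1 | h1 <;> rcases rootSign_eq_or v.1 with h2 | h2 <;>
      rcases rootSign_eq_or w.1 with h3 | h3 <;> rcases eps_eq_or Γ u.1 v.1 with h4 | h4 <;>
      simp [h1, h2, h3, h4]
  lie_nonroot u v h0 h := by
    apply KacMoody.toModel_injective
    have h : u.1 + v.1 ∉ Root Γ := fun hr => h (rootSystem_eq (Γ := Γ).ge hr)
    rw [toModel_lie_chevalleyFamily, br_rootVec (mem_root u) (mem_root v) h0, rootVec_of_notMem h,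
      smul_zero, smul_zero, map_zero]

end Existence

/-! ### Lie algebras generated by sandwich elements -/

/-- A family of sandwich elements, commuting for non-adjacent vertices. -/
structure SandwichRelations {V L : Type*} (Γ : SimpleGraph V) [LieRing L] (s : V → L) : Prop where
  comm {x y : V} (h : ¬ Γ.Adj x y) : ⁅s x, s y⁆ = 0
  sandwich (x : V) (z : L) : ⁅s x, ⁅s x, z⁆⁆ = 0

namespace SandwichRelations

variable {V : Type*} {Γ : SimpleGraph V} {K : Type*} [Field K] {L : Type*} [LieRing L]
  [LieAlgebra K L] {s : V → L} (hs : SandwichRelations Γ s)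
include hs

-- Expanding `⁅s x, ⁅s x, ⁅y, z⁆⁆⁆ = 0` by the Leibniz rule leaves `2 ⁅⁅s x, y⁆, ⁅s x, z⁆⁆ = 0`.
-- Dividing by 2 gives the second sandwich identity.
variable (K) in
theorem lie_lie_lie (hK : (2 : K) ≠ 0) (x : V) (y z : L) : ⁅s x, ⁅y, ⁅s x, z⁆⁆⁆ = 0 := by
  have h1 := hs.sandwich x ⁅y, z⁆
  have h2 : (2 : K) • ⁅⁅s x, y⁆, ⁅s x, z⁆⁆ = 0 := by
    rw [leibniz_lie (s x) y z, lie_add, leibniz_lie (s x) ⁅s x, y⁆ z, hs.sandwich x y, zero_lie,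
      zero_add, leibniz_lie (s x) y ⁅s x, z⁆, hs.sandwich x z, lie_zero, add_zero] at h1
    rw [two_smul]; exact h1
  have h3 := (smul_eq_zero.mp h2).resolve_left hK
  rw [leibniz_lie, h3, hs.sandwich, lie_zero, add_zero]

theorem lie_comm {x y : V} (h : ¬ Γ.Adj x y) (z : L) : ⁅s x, ⁅s y, z⁆⁆ = ⁅s y, ⁅s x, z⁆⁆ := by
  rw [leibniz_lie, hs.comm h, zero_lie, zero_add]

variable [Fintype V] [DecidableEq V] [DecidableRel Γ.Adj]

variable (K) in
/-- Restrictions on the weights of nonzero monomials. -/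
theorem lieMonomial_pairing (hK : (2 : K) ≠ 0) (x : V) (w : List V) :
    (⁅s x, lieMonomial s w⁆ ≠ 0 → form Γ (simple x) (w.map simple).sum ≤ -1) ∧
    (∀ y : L, ⁅s x, ⁅y, lieMonomial s w⁆⁆ ≠ 0 → form Γ (simple x) (w.map simple).sum ≤ 0) ∧
    (lieMonomial s w ≠ 0 → w = [x] ∨ form Γ (simple x) (w.map simple).sum ≤ 1) := by
  -- The three bounds are proved together because they feed one another. For an adjacent new letter,
  -- the first uses the second and the second uses the third; when the new letter is `x` itself, the
  -- third uses the first. A nonadjacent letter commutes with `s x` and leaves the pairing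
  -- unchanged.
  induction w with
  | nil => simp [lieMonomial]
  | cons z w ih =>
    obtain ⟨ihA, ihB, ihC⟩ := ih
    rw [List.map_cons, List.sum_cons, map_add]
    rcases eq_or_ne w [] with rfl | hw
    · simp only [lieMonomial, List.map_nil, List.sum_nil, map_zero, add_zero]
      rcases eq_or_ne x z with rfl | hne
      · refine ⟨fun h => absurd (lie_self _) h, fun y h => absurd ?_ h, fun _ => Or.inl rfl⟩
        rw [← lie_skew y, lie_neg, hs.sandwich, neg_zero]
      · by_cases h : Γ.Adj x z
        · rw [form_simple_adj Γ h]; simp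
        · rw [form_simple_not_adj Γ hne h, hs.comm h]; simp
    · rw [lieMonomial_cons s z hw]
      rcases eq_or_ne x z with rfl | hne
      · rw [form_simple_self]
        refine ⟨fun h => absurd (hs.sandwich _ _) h,
          fun y h => absurd (hs.lie_lie_lie K hK _ _ _) h, fun h => Or.inr ?_⟩
        have := ihA h
        omega
      · by_cases h : Γ.Adj x z
        · rw [form_simple_adj Γ h]
          refine ⟨fun h1 => ?_, fun y h1 => ?_, fun h1 => Or.inr ?_⟩
          · have := ihB _ h1; omega
          · have h0 : lieMonomial s w ≠ 0 := fun h0 => h1 (by simp [h0])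
            rcases ihC h0 with rfl | h2
            · refine absurd ?_ h1
              rw [lieMonomial, ← lie_skew (s z), lie_neg, lie_neg, hs.lie_lie_lie K hK, neg_zero]
            · omega
          · have h0 : lieMonomial s w ≠ 0 := fun h0 => h1 (by simp [h0])
            rcases ihC h0 with rfl | h2
            · simp [form_simple_self]
            · omega
        · rw [form_simple_not_adj Γ hne h, zero_add]
          refine ⟨fun h1 => ihA fun h0 => h1 ?_, fun y h1 => ?_, fun h1 => ?_⟩
          · rw [hs.lie_comm h, h0, lie_zero]
          · rw [leibniz_lie y, lie_add, hs.lie_comm h] at h1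
            by_cases h2 : ⁅s x, ⁅y, lieMonomial s w⁆⁆ = 0
            · rw [h2, lie_zero, add_zero] at h1
              exact ihB _ h1
            · exact ihB _ h2
          · have h0 : lieMonomial s w ≠ 0 := fun h0 => h1 (by simp [h0])
            rcases ihC h0 with rfl | h2
            · exact absurd (hs.comm fun h' => h h'.symm) h1
            · exact Or.inr h2

/-! ### Upper bounds for the weight components. -/

section Affine

variable (hK : (2 : K) ≠ 0) {x₀ : V} {δ : V → ℤ} (hδ : IsAffine Γ x₀ δ)
include hK hδ

-- Building a nonzero monomial from its innermost letter, each new letter pairs to at most `-1` with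
-- the weight so far, so `isSandwichWeight_add` applies at each step.
variable (K) in
theorem isSandwichWeight_of_lieMonomial_ne_zero {w : List V} (hw : lieMonomial s w ≠ 0) :
    IsSandwichWeight Γ δ (w.map simple).sum := by
  induction w with
  | nil => exact absurd rfl hw
  | cons x w ih =>
    rcases eq_or_ne w [] with rfl | h
    · simpa using hδ.isSandwichWeight_simple x
    · rw [lieMonomial_cons s x h] at hw
      have h0 : lieMonomial s w ≠ 0 := fun h0 => hw (by simp [h0])
      rw [List.map_cons, List.sum_cons, add_comm]
      exact hδ.isSandwichWeight_add (ih h0) ((hs.lieMonomial_pairing K hK x w).1 hw)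

theorem weightSpace_eq_bot {μ : V → ℤ} (hμ : ¬ IsSandwichWeight Γ δ μ) :
    weightSpace K s simple μ = ⊥ := by
  rw [eq_bot_iff]
  refine Submodule.span_le.mpr ?_
  rintro _ ⟨w, rfl, rfl⟩
  by_contra h
  exact hμ (hs.isSandwichWeight_of_lieMonomial_ne_zero K hK hδ h)

/-- The weight space of a real weight is obtained from that of any predecessor. -/
theorem weightSpace_le_map (n : ℕ) : ∀ μ : V → ℤ, ∑ x, μ x = n → IsSandwichWeight Γ δ μ →
    μ ∈ Root Γ → ∀ x, form Γ (simple x) μ = 1 → weightSpace K s simple μ ≤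
      (weightSpace K s simple (μ - simple x)).map (LieAlgebra.ad K L (s x)) := by
  induction n using Nat.strong_induction_on with
  | _ n ih =>
  intro μ hn hμ hr x hx
  refine Submodule.span_le.mpr ?_
  rintro _ ⟨w, hw, rfl⟩
  by_cases h0 : lieMonomial s w = 0
  · rw [h0]; exact Submodule.zero_mem _
  rcases w with _ | ⟨z, w⟩
  · exact absurd rfl h0
  rw [List.map_cons, List.sum_cons] at hw
  rcases eq_or_ne w [] with rfl | hne
  · exfalso
    simp only [List.map_nil, List.sum_nil, add_zero] at hw
    rw [← hw, form_simple_simple] at hx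
    simp only [cartanMatrix, Matrix.of_apply] at hx
    split_ifs at hx <;> omega
  rw [lieMonomial_cons s z hne] at h0 ⊢
  have h1 : lieMonomial s w ≠ 0 := fun h1 => h0 (by simp [h1])
  set ν := (w.map simple).sum with hνw
  have hν : IsSandwichWeight Γ δ ν := hs.isSandwichWeight_of_lieMonomial_ne_zero K hK hδ h1
  have hmem : lieMonomial s w ∈ weightSpace K s simple ν := lieMonomial_mem_weightSpace s simple w
  have hp : form Γ (simple z) ν ≤ -1 := (hs.lieMonomial_pairing K hK z w).1 h0
  have hq : form Γ μ μ = 2 := hr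
  have hνle := hν.form_le
  rw [← hw, form_add_self, form_simple_self] at hq
  -- From `‖ν‖² + 2⟨α_z, ν⟩ + 2 = 2` and `‖ν‖² ≤ 2`, the pairing is at least `-1`; so `ν` is again
  -- real and the induction can continue.
  have hzν : form Γ (simple z) ν = -1 := by omega
  have hνr : ν ∈ Root Γ := by change form Γ ν ν = 2; omega
  rcases eq_or_ne x z with rfl | hxz
  · refine ⟨lieMonomial s w, ?_, rfl⟩
    rwa [← hw, add_sub_cancel_left]
  -- If `z` is adjacent to `x`, both pair to 1 with `μ`, so `μ = α_x + α_z` and antisymmetry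
  -- exchanges the letters. Otherwise `x` still pairs to 1 with `ν`, so it can be extracted from the
  -- shorter monomial and commuted past `z`.
  by_cases hadj : Γ.Adj x z
  · have hzμ : form Γ (simple z) μ = 1 := by rw [← hw, map_add, form_simple_self, hzν]; norm_num
    have hμe := hδ.eq_add_of_adj hμ hr hadj hx hzμ
    have hνe : ν = ((1 : ℕ) : ℤ) • simple x := by
      rw [← hw, add_comm] at hμe
      rw [add_right_cancel hμe]; simp
    rw [hνe] at hmem
    have h2 := weightSpace_nsmul_simple s x 1 hmem
    rw [if_pos rfl] at h2
    obtain ⟨c, hc⟩ := Submodule.mem_span_singleton.mp h2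
    refine ⟨-c • s z, Submodule.smul_mem _ _ ?_, ?_⟩
    · rw [hμe, add_sub_cancel_left]; exact gen_mem_weightSpace s simple z
    · rw [← hc, map_smul, LieAlgebra.ad_apply, lie_smul, ← lie_skew, smul_neg, neg_smul, neg_neg,
        ← lie_skew, smul_neg]
  · have hxν : form Γ (simple x) ν = 1 := by
      rw [← hw, map_add, form_simple_not_adj Γ hxz hadj, zero_add] at hx
      exact hx
    have hsum : ∑ y, μ y = 1 + ∑ y, ν y := by
      rw [← hw]; simp [Finset.sum_add_distrib]
    obtain ⟨l, hl, hl'⟩ := ih (n - 1) (by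
        have : 0 ≤ ∑ y, ν y := Finset.sum_nonneg fun y _ => hν.nonneg y
        omega) ν (by
        have : 0 ≤ ∑ y, ν y := Finset.sum_nonneg fun y _ => hν.nonneg y
        omega) hν hνr x hxν hmem
    refine ⟨⁅s z, l⁆, ?_, ?_⟩
    · have := lie_mem_weightSpace s simple z hl
      rwa [← add_sub_assoc, hw] at this
    · rw [LieAlgebra.ad_apply] at hl' ⊢
      rw [hs.lie_comm hadj, hl']

/-- `IsAffine.exists_sub_simple` descends to a simple root through real weights. By
`weightSpace_le_map`, each component is contained in the image of a line. -/
theorem exists_weightSpace_le_span (n : ℕ) : ∀ μ : V → ℤ, ∑ x, μ x = n →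
    IsSandwichWeight Γ δ μ → μ ∈ Root Γ → ∃ v, weightSpace K s simple μ ≤ K ∙ v := by
  induction n with
  | zero =>
    intro μ hn hμ hr
    refine absurd (funext fun x => ?_) hμ.ne_zero
    exact (Finset.sum_eq_zero_iff_of_nonneg fun x _ => hμ.nonneg x).mp hn x (Finset.mem_univ x)
  | succ n ih =>
    intro μ hn hμ hr
    by_cases hsimp : ∃ x, μ = simple x
    · obtain ⟨x, rfl⟩ := hsimp
      refine ⟨s x, ?_⟩
      simpa using weightSpace_nsmul_simple (K := K) s x 1
    · push Not at hsimp
      obtain ⟨x, hx, hx1, hx2⟩ := hδ.exists_sub_simple hμ hr hsimp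
      obtain ⟨v, hv⟩ := ih (μ - simple x) (by simp [Finset.sum_sub_distrib, hn]) hx1 hx2
      refine ⟨⁅s x, v⁆, (hs.weightSpace_le_map hK hδ _ μ hn hμ hr x hx).trans
        ((Submodule.map_mono hv).trans ?_)⟩
      rw [Submodule.map_span, Set.image_singleton, LieAlgebra.ad_apply]

omit hs hK hδ in
theorem lie_lieMonomial_mem {w : List V} : ∀ {ν : V → ℤ} {z : L},
    z ∈ weightSpace K s simple ν →
    ⁅lieMonomial s w, z⁆ ∈ weightSpace K s simple ((w.map simple).sum + ν) := by
  induction w with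
  | nil => intro ν z _; simp [lieMonomial]
  | cons y w ih =>
    intro ν z hz
    rcases eq_or_ne w [] with rfl | hw
    · simpa [lieMonomial] using lie_mem_weightSpace s simple y hz
    · rw [lieMonomial_cons s y hw, lie_lie, List.map_cons, List.sum_cons]
      refine Submodule.sub_mem _ ?_ ?_
      · rw [add_assoc]; exact lie_mem_weightSpace s simple y (ih hz)
      · have := ih (lie_mem_weightSpace s simple y hz)
        rwa [← add_assoc, add_comm _ (simple y)] at this

-- Rewriting `⁅⁅y, w⁆, z⁆` as `⁅y, ⁅w, z⁆⁆ - ⁅w, ⁅y, z⁆⁆` peels letters off `w`. None of them is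
-- `x₀`, so every resulting bracket has an allowed letter outermost.
omit hs hK hδ in
theorem lie_lieMonomial_mem_iSup {w : List V} (hw : w ≠ []) (hx : x₀ ∉ w) :
    ∀ {ν : V → ℤ} {z : L}, z ∈ weightSpace K s simple ν → (w.map simple).sum + ν = δ →
    ⁅lieMonomial s w, z⁆ ∈ ⨆ x : Removed x₀,
      (weightSpace K s simple (δ - simple x.1)).map (LieAlgebra.ad K L (s x.1)) := by
  induction w with
  | nil => exact absurd rfl hw
  | cons y w ih =>
    intro ν z hz hν
    have hy : y ≠ x₀ := fun h => hx (by simp [h])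
    rw [List.map_cons, List.sum_cons] at hν
    rcases eq_or_ne w [] with rfl | hw
    · refine Submodule.mem_iSup_of_mem ⟨y, hy⟩ ⟨z, ?_, rfl⟩
      rw [← hν]; simpa using hz
    · rw [lieMonomial_cons s y hw, lie_lie]
      refine Submodule.sub_mem _ ?_ ?_
      · refine Submodule.mem_iSup_of_mem ⟨y, hy⟩ ⟨⁅lieMonomial s w, z⁆, ?_, rfl⟩
        rw [← hν, add_assoc, add_sub_cancel_left]
        exact lie_lieMonomial_mem hz
      · refine ih hw (fun h => hx (List.mem_cons_of_mem _ h)) (lie_mem_weightSpace s simple y hz) ?_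
        rw [← hν]; abel

-- Because `δ x₀ = 1`, the letter `x₀` occurs once. If it leads the monomial, antisymmetry puts the
-- rest in front and `lie_lieMonomial_mem_iSup` applies. Excluding `x₀` as leading letter gives the
-- sharp count `|Π⁰|` in weight `δ`.
omit hs hK in
theorem weightSpace_delta_le : weightSpace K s simple δ ≤ ⨆ x : Removed x₀,
      (weightSpace K s simple (δ - simple x.1)).map (LieAlgebra.ad K L (s x.1)) := by
  refine Submodule.span_le.mpr ?_
  rintro _ ⟨w, hw, rfl⟩
  rcases w with _ | ⟨z, w⟩
  · exact Submodule.zero_mem _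
  rw [List.map_cons, List.sum_cons] at hw
  rcases eq_or_ne w [] with rfl | hne
  · exfalso
    have h1 := form_simple_self Γ z
    have h2 : simple z = δ := by simpa using hw
    rw [h2, hδ.form_left] at h1
    omega
  rw [lieMonomial_cons s z hne]
  by_cases hz : z = x₀
  · subst hz
    rw [← lie_skew]
    refine Submodule.neg_mem _ (lie_lieMonomial_mem_iSup hne ?_ (gen_mem_weightSpace s simple z)
      (by rw [add_comm, hw]))
    have h1 := congrFun hw z
    have h2 : simple z z = 1 := Pi.single_eq_same z 1
    rw [hδ.base, Pi.add_apply, sum_simple_apply, h2] at h1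
    exact List.count_eq_zero.mp (by omega)
  · refine Submodule.mem_iSup_of_mem ⟨z, hz⟩ ⟨lieMonomial s w, ?_, rfl⟩
    rw [← hw, add_sub_cancel_left]
    exact lieMonomial_mem_weightSpace s simple w

/-- A spanning family of the sandwich algebra. -/
theorem exists_spanning_family (hgen : Generates K s) :
    ∃ f : Removed x₀ ⊕ Root (removeVertex Γ x₀) → L, ⊤ ≤ Submodule.span K (Set.range f) := by
  classical
  have hline : ∀ μ : V → ℤ, ∃ v, IsSandwichWeight Γ δ μ → μ ∈ Root Γ →
      weightSpace K s simple μ ≤ K ∙ v := by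
    intro μ
    by_cases h : IsSandwichWeight Γ δ μ ∧ μ ∈ Root Γ
    · have hn : ∑ x, μ x = ((∑ x, μ x).toNat : ℤ) :=
        (Int.toNat_of_nonneg (Finset.sum_nonneg fun x _ => h.1.nonneg x)).symm
      obtain ⟨v, hv⟩ := hs.exists_weightSpace_le_span hK hδ _ μ hn h.1 h.2
      exact ⟨v, fun _ _ => hv⟩
    · exact ⟨0, fun h1 h2 => absurd ⟨h1, h2⟩ h⟩
  choose v hv using hline
  -- One vector for each real weight and one for each `x ≠ x₀` in weight `δ`: the index set has the
  -- size of a Chevalley basis.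
  let f : Removed x₀ ⊕ Root (removeVertex Γ x₀) → L
    | .inl x => ⁅s x.1, v (δ - simple x.1)⁆
    | .inr u => if 0 ≤ u.1 then v (extendWeight u.1) else v (δ + extendWeight u.1)
  refine ⟨f, ?_⟩
  rw [← hgen.iSup_weightSpace simple]
  refine iSup_le fun μ => ?_
  by_cases hμ : IsSandwichWeight Γ δ μ
  swap
  · rw [hs.weightSpace_eq_bot hK hδ hμ]; exact bot_le
  rcases hδ.sandwichWeight_cases hμ with hr | rfl
  · refine (hv μ hμ hr).trans ((Submodule.span_singleton_le_iff_mem _ _).mpr ?_)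
    rcases hδ.sandwichWeight_real hμ hr with ⟨u, hu, h0, rfl⟩ | ⟨u, hu, h0, rfl⟩
    · exact Submodule.subset_span ⟨.inr ⟨u, hu⟩, if_pos h0⟩
    · exact Submodule.subset_span ⟨.inr ⟨u, hu⟩, if_neg fun h1 =>
        ne_zero_of_mem_root hu (le_antisymm h0 h1)⟩
  · refine (weightSpace_delta_le hδ).trans (iSup_le fun x => ?_)
    have hxr : -simple x ∈ Root (removeVertex Γ x₀) := neg_mem_root (simple_mem_root x)
    have hx0 : -simple x ≤ 0 := neg_nonpos.mpr (Pi.single_nonneg.mpr zero_le_one)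
    have h1 := hδ.isSandwichWeight_delta_add hxr hx0
    have h2 := hδ.delta_add_mem_root hxr
    rw [extendWeight_neg, extendWeight_simple, ← sub_eq_add_neg] at h1 h2
    refine (Submodule.map_mono (hv _ h1 h2)).trans ?_
    rw [Submodule.map_span, Set.image_singleton, LieAlgebra.ad_apply,
      Submodule.span_singleton_le_iff_mem]
    exact Submodule.subset_span ⟨.inl x, rfl⟩

end Affine

end SandwichRelations

/-! ### The Chevalley algebra over a field -/

namespace ChevalleyBasis

variable {I : Type*} [DecidableEq I] [Fintype I] {Γ : SimpleGraph I} [DecidableRel Γ.Adj]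
  (B : ChevalleyBasis Γ) (K : Type*) [Field K]

theorem lie_ofZForm (y z : B.zForm) : ⁅B.ofZForm K y, B.ofZForm K z⁆ = B.ofZForm K ⁅y, z⁆ :=
  (LieHom.map_lie _ _ _).symm

theorem lie_E_E_of_root {α β γ : rootSystem Γ} (h : α.1 + β.1 = γ.1) :
    ⁅B.E K α, B.E K β⁆ = B.E K γ ∨ ⁅B.E K α, B.E K β⁆ = -B.E K γ := by
  rw [E, E, lie_ofZForm]
  rcases B.lie_root α β γ h with h' | h'
  · left
    have : ⁅B.zBasis (Sum.inr α), B.zBasis (Sum.inr β)⁆ = B.zBasis (Sum.inr γ) := Subtype.ext h'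
    rw [this]; rfl
  · right
    have : ⁅B.zBasis (Sum.inr α), B.zBasis (Sum.inr β)⁆ = -B.zBasis (Sum.inr γ) := Subtype.ext h'
    rw [this, map_neg]; rfl

theorem lie_E_E_of_notMem {α β : rootSystem Γ} (h0 : α.1 + β.1 ≠ 0)
    (h : α.1 + β.1 ∉ rootSystem Γ) : ⁅B.E K α, B.E K β⁆ = 0 := by
  have : ⁅B.zBasis (Sum.inr α), B.zBasis (Sum.inr β)⁆ = 0 :=
    Subtype.ext (B.lie_nonroot α β h0 h)
  rw [E, E, lie_ofZForm, this, map_zero]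

theorem lie_E_E_of_add_eq_zero {α β : rootSystem Γ} (h : α.1 + β.1 = 0) :
    ⁅B.E K α, B.E K β⁆ = ∑ x, α.1 x • B.H K x := by
  have : ⁅B.zBasis (Sum.inr α), B.zBasis (Sum.inr β)⁆ = ∑ x, α.1 x • B.zBasis (Sum.inl x) := by
    refine Subtype.ext ((B.lie_opposite α β h).trans ?_)
    simp [zBasis]
  rw [E, E, lie_ofZForm, this, map_sum]
  simp only [map_zsmul]; rfl

theorem lie_H_E_eq (x : I) (α : rootSystem Γ) :
    ⁅B.H K x, B.E K α⁆ = form Γ (simple x) α.1 • B.E K α := by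
  have : ⁅B.zBasis (Sum.inl x), B.zBasis (Sum.inr α)⁆ =
      form Γ (simple x) α.1 • B.zBasis (Sum.inr α) := by
    rw [form_simple_left]
    exact Subtype.ext (B.lie_H_E x α)
  rw [E, H, lie_ofZForm, this, map_zsmul]

/-- The Chevalley basis as a basis of the `ℤ`-form. -/
def zFormBasis : Module.Basis (I ⊕ rootSystem Γ) ℤ B.zForm :=
  Module.Basis.mk (v := B.zBasis) (by
    refine LinearIndependent.of_comp B.zForm.toSubmodule.subtype ?_
    have h : ⇑B.zForm.toSubmodule.subtype ∘ B.zBasis = B.basis := rfl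
    rw [h]
    exact B.basis.linearIndependent.restrict_scalars fun m n hmn => by simpa using hmn) (by
    rintro ⟨z, hz⟩ -
    change z ∈ Submodule.span ℤ (Set.range B.basis) at hz
    have h : Submodule.span ℤ (Set.range B.basis) =
        (Submodule.span ℤ (Set.range B.zBasis)).map B.zForm.toSubmodule.subtype := by
      rw [Submodule.map_span, ← Set.range_comp]; rfl
    have hz' := hz
    rw [h] at hz'
    obtain ⟨y, hy, hyz⟩ := hz'
    have : y = ⟨z, hz⟩ := Subtype.ext hyz
    rw [← this]; exact hy)

/-- The Chevalley basis as a basis of the Chevalley algebra. -/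
def algebraBasis : Module.Basis (I ⊕ rootSystem Γ) K (B.Algebra K) :=
  B.zFormBasis.baseChange K

theorem algebraBasis_inl (x : I) : B.algebraBasis K (.inl x) = B.H K x := by
  refine (Module.Basis.baseChange_apply K B.zFormBasis _).trans ?_
  simp [zFormBasis]; rfl

theorem algebraBasis_inr (α : rootSystem Γ) : B.algebraBasis K (.inr α) = B.E K α := by
  refine (Module.Basis.baseChange_apply K B.zFormBasis _).trans ?_
  simp [zFormBasis]; rfl

/-- A subspace containing the Chevalley basis is everything. -/
theorem mem_of_basis_mem {S : Submodule K (B.Algebra K)} (hH : ∀ x, B.H K x ∈ S)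
    (hE : ∀ α, B.E K α ∈ S) (z : B.Algebra K) : z ∈ S := by
  have h : Submodule.span K (Set.range (B.algebraBasis K)) ≤ S := by
    refine Submodule.span_le.mpr ?_
    rintro _ ⟨x | α, rfl⟩
    · rw [algebraBasis_inl]; exact hH x
    · rw [algebraBasis_inr]; exact hE α
  exact h ((B.algebraBasis K).mem_span z)

theorem E_mem_nPos {α : rootSystem Γ} (h : 0 ≤ α.1) : B.E K α ∈ B.nPos K :=
  Submodule.subset_span ⟨α, h, rfl⟩

/-- The root vector of a positive root, as an element of `n_+`. -/
def posE (α : rootSystem Γ) (h : 0 ≤ α.1) : B.nPos K := ⟨B.E K α, B.E_mem_nPos K h⟩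

/-- A subspace of `n_+` containing the root vectors is everything. -/
theorem mem_of_posE_mem {S : Submodule K (B.nPos K)} (h : ∀ α hα, B.posE K α hα ∈ S)
    (z : B.nPos K) : z ∈ S := by
  obtain ⟨z, hz⟩ := z
  have hle : Submodule.span K {z | ∃ α : rootSystem Γ, 0 ≤ α.1 ∧ z = B.E K α} ≤
      S.map (B.nPos K).toSubmodule.subtype := by
    refine Submodule.span_le.mpr ?_
    rintro _ ⟨α, hα, rfl⟩
    exact ⟨_, h α hα, rfl⟩
  obtain ⟨y, hy, hyz⟩ := hle hz
  have : y = ⟨z, hz⟩ := Subtype.ext hyz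
  rw [← this]; exact hy

theorem weightSpace_of_root {β : I → ℤ} (hβ : β ∈ rootSystem Γ) :
    B.weightSpace K β = K ∙ B.E K ⟨β, hβ⟩ := by
  rw [weightSpace]
  congr 1
  ext z
  constructor
  · rintro (⟨α, rfl, rfl⟩ | ⟨rfl, -⟩)
    · rfl
    · exact absurd rfl hβ.1
  · rintro rfl
    exact Or.inl ⟨⟨β, hβ⟩, rfl, rfl⟩

theorem weightSpace_zero : B.weightSpace K 0 = Submodule.span K (Set.range (B.H K)) := by
  rw [weightSpace]
  congr 1
  ext z
  constructor
  · rintro (⟨α, h, rfl⟩ | ⟨-, x, rfl⟩)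
    · exact absurd h α.2.1
    · exact ⟨x, rfl⟩
  · rintro ⟨x, rfl⟩
    exact Or.inr ⟨rfl, x, rfl⟩

end ChevalleyBasis

/-! ### The target algebra -/

section Target

variable {V : Type*} [Fintype V] [DecidableEq V] {Γ : SimpleGraph V} [DecidableRel Γ.Adj]
  {x₀ : V} (B : ChevalleyBasis (removeVertex Γ x₀)) (K : Type*) [Field K]

theorem lie_fromNPos_fromNPos (a b : B.nPos K) :
    ⁅fromNPos B K a, fromNPos B K b⁆ = fromNPos B K ⁅a, b⁆ :=
  (LieHom.map_lie (LieAlgebra.SemiDirectSum.inr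
    (TrivialLie.action K (B.nPos K) (ModNPos B K))) a b).symm

theorem lie_fromNPos_fromQuotient (a : B.nPos K) (z : B.Algebra K) :
    ⁅fromNPos B K a, fromQuotient B K z⁆ = fromQuotient B K ⁅(a : B.Algebra K), z⁆ := by
  change (⟨_, _⟩ : AffineTarget B K) = ⟨_, _⟩
  congr 1
  · change (0 : TrivialLie (ModNPos B K)) + TrivialLie.of K (ModNPos B K)
      ⁅a, (LieSubmodule.Quotient.mk z : ModNPos B K)⁆ -
      (TrivialLie.action K (B.nPos K) (ModNPos B K) 0) 0 =
      TrivialLie.of K (ModNPos B K) (LieSubmodule.Quotient.mk ⁅(a : B.Algebra K), z⁆)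
    rw [map_zero, sub_zero, zero_add]; rfl

theorem lie_fromQuotient_fromQuotient (y z : B.Algebra K) :
    ⁅fromQuotient B K y, fromQuotient B K z⁆ = 0 := by
  change (⟨_, _⟩ : AffineTarget B K) = ⟨_, _⟩
  congr 1
  · change (0 : TrivialLie (ModNPos B K)) +
      (TrivialLie.action K (B.nPos K) (ModNPos B K) 0) _ -
      (TrivialLie.action K (B.nPos K) (ModNPos B K) 0) _ = 0
    simp

theorem fromQuotient_eq_zero {z : B.Algebra K} (hz : z ∈ B.nPos K) : fromQuotient B K z = 0 := by
  have h : (LieSubmodule.Quotient.mk z : ModNPos B K) = 0 :=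
    (Submodule.Quotient.mk_eq_zero _).mpr hz
  change (⟨(LieSubmodule.Quotient.mk z : ModNPos B K), 0⟩ : AffineTarget B K) = ⟨_, _⟩
  rw [h]; rfl

theorem exists_eq_add (u : AffineTarget B K) :
    ∃ a z, u = fromNPos B K a + fromQuotient B K z := by
  obtain ⟨m, a⟩ := u
  obtain ⟨z, rfl⟩ := LieSubmodule.Quotient.surjective_mk' (B.nPos K).toLieSubmodule m
  refine ⟨a, z, ?_⟩
  change (⟨_, _⟩ : AffineTarget B K) = ⟨(0 : TrivialLie (ModNPos B K)) + _, a + 0⟩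
  rw [zero_add, add_zero]; rfl

variable {K} in
/-- A subspace containing the images of the basis elements is everything. -/
theorem mem_of_target_basis_mem {S : Submodule K (AffineTarget B K)}
    (h1 : ∀ α hα, fromNPos B K (B.posE K α hα) ∈ S) (h2 : ∀ x, fromQuotient B K (B.H K x) ∈ S)
    (h3 : ∀ α, fromQuotient B K (B.E K α) ∈ S) (u : AffineTarget B K) : u ∈ S := by
  obtain ⟨a, z, rfl⟩ := exists_eq_add B K u
  exact S.add_mem (B.mem_of_posE_mem K (S := S.comap (fromNPos B K)) h1 a)
    (B.mem_of_basis_mem K (S := S.comap (fromQuotient B K)) h2 h3 z)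

theorem finrank_target [Finite (rootSystem (removeVertex Γ x₀))] :
    Module.Finite K (AffineTarget B K) ∧
    Module.finrank K (AffineTarget B K) =
      Nat.card (Removed x₀ ⊕ rootSystem (removeVertex Γ x₀)) := by
  have hfin : Module.Finite K (B.Algebra K) := Module.Finite.of_basis (B.algebraBasis K)
  let e : AffineTarget B K ≃ₗ[K] (B.Algebra K ⧸ (B.nPos K).toSubmodule) × (B.nPos K).toSubmodule :=
    LieAlgebra.SemiDirectSum.toProdl (TrivialLie.action K (B.nPos K) (ModNPos B K))
  refine ⟨Module.Finite.equiv e.symm, ?_⟩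
  rw [LinearEquiv.finrank_eq e, Module.finrank_prod, Submodule.finrank_quotient_add_finrank,
    Module.finrank_eq_nat_card_basis (B.algebraBasis K)]

end Target

theorem IsAffine.rootSystem_eq {V : Type*} [Fintype V] [DecidableEq V] {Γ : SimpleGraph V}
    [DecidableRel Γ.Adj] {x₀ : V} {δ : V → ℤ} (h : IsAffine Γ x₀ δ) :
    rootSystem (removeVertex Γ x₀) = Root (removeVertex Γ x₀) :=
  have : Fact (IsPosDef (removeVertex Γ x₀)) := ⟨h.isPosDef⟩
  Extremal.rootSystem_eq

/-! ### The generators of the target algebra -/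

section Target

variable {V : Type*} [Fintype V] [DecidableEq V] {Γ : SimpleGraph V} [DecidableRel Γ.Adj]
  {x₀ : V} (B : ChevalleyBasis (removeVertex Γ x₀)) (K : Type*) [Field K]
  (θ : rootSystem (removeVertex Γ x₀))

/-- The images of the vertices in the target algebra. -/
def targetGen (x : V) : AffineTarget B K :=
  if h : x ≠ x₀ then fromNPos B K (B.simpleE K ⟨x, h⟩) else fromQuotient B K (B.E K θ)

theorem targetGen_coe (x : Removed x₀) :
    targetGen B K θ x.1 = fromNPos B K (B.simpleE K x) := by
  simp [targetGen, x.2]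

theorem targetGen_base : targetGen B K θ x₀ = fromQuotient B K (B.E K θ) := by
  simp [targetGen]

theorem coe_simpleE (x : Removed x₀) : (B.simpleE K x : B.Algebra K) = B.E K (B.simpleRoot x) := rfl

theorem simpleRoot_coe (x : Removed x₀) : (B.simpleRoot x).1 = simple x := rfl

variable {δ : V → ℤ} (hδ : IsAffine Γ x₀ δ) (hθ : extendWeight θ.1 = simple x₀ - δ)
include hδ

omit B in
theorem coe_mem_root (α : rootSystem (removeVertex Γ x₀)) : α.1 ∈ Root (removeVertex Γ x₀) :=
  hδ.rootSystem_eq.le α.2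

/-- If `α_x + α` is a root, then `⟨α_x, α⟩ = -1`. Hence `α_x` pairs to 1 with `α_x + α`, and `2α_x +
α` is neither a root nor zero. -/
theorem lie_simple_lie_simple_E (x : Removed x₀) (α : rootSystem (removeVertex Γ x₀)) :
    ⁅B.E K (B.simpleRoot x), ⁅B.E K (B.simpleRoot x), B.E K α⁆⁆ = 0 ∨
      ((B.simpleRoot x).1 + α.1 = 0) := by
  have hx := coe_mem_root hδ (B.simpleRoot x)
  have hα := coe_mem_root hδ α
  by_cases h0 : (B.simpleRoot x).1 + α.1 = 0
  · exact Or.inr h0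
  left
  by_cases hr : (B.simpleRoot x).1 + α.1 ∈ rootSystem (removeVertex Γ x₀)
  · have hr' := hδ.rootSystem_eq.le hr
    have hf := (add_mem_root_iff hx hα).mp hr'
    have hxx : form (removeVertex Γ x₀) (B.simpleRoot x).1 (B.simpleRoot x).1 = 2 := hx
    have hf2 : form (removeVertex Γ x₀) (B.simpleRoot x).1 ((B.simpleRoot x).1 + α.1) = 1 := by
      rw [map_add, hxx, hf]; norm_num
    have key : ⁅B.E K (B.simpleRoot x), B.E K ⟨_, hr⟩⁆ = 0 := by
      refine B.lie_E_E_of_notMem K (fun h => ?_) (fun h => ?_)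
      · have := (hδ.isPosDef.add_eq_zero_iff hx hr').mp h
        omega
      · have := (add_mem_root_iff hx hr').mp (hδ.rootSystem_eq.le h)
        omega
    rcases B.lie_E_E_of_root K (α := B.simpleRoot x) (β := α) (γ := ⟨_, hr⟩) rfl with h | h
    · rw [h, key]
    · rw [h, lie_neg, key, neg_zero]
  · rw [B.lie_E_E_of_notMem K h0 hr, lie_zero]

/-- The square of a simple root vector maps the Chevalley algebra to `n_+`. -/
theorem lie_simple_lie_simple_mem (x : Removed x₀) (z : B.Algebra K) :
    ⁅B.E K (B.simpleRoot x), ⁅B.E K (B.simpleRoot x), z⁆⁆ ∈ B.nPos K := by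
  have hxm := B.E_mem_nPos K (α := B.simpleRoot x) (Pi.single_nonneg.mpr zero_le_one)
  have hH : ∀ y, ⁅B.E K (B.simpleRoot x), B.H K y⁆ =
      -form (removeVertex Γ x₀) (simple y) (B.simpleRoot x).1 • B.E K (B.simpleRoot x) := by
    intro y
    rw [← lie_skew, B.lie_H_E_eq, neg_smul]
  let T : B.Algebra K →ₗ[K] B.Algebra K :=
    { toFun z := ⁅B.E K (B.simpleRoot x), ⁅B.E K (B.simpleRoot x), z⁆⁆
      map_add' y z := by rw [lie_add, lie_add]
      map_smul' c z := by rw [lie_smul, lie_smul]; rfl }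
  have hT : ∀ z, T z = ⁅B.E K (B.simpleRoot x), ⁅B.E K (B.simpleRoot x), z⁆⁆ := fun _ => rfl
  rw [← hT]
  refine B.mem_of_basis_mem K (S := (B.nPos K).toSubmodule.comap T) (fun y => ?_)
    (fun α => ?_) z <;> rw [Submodule.mem_comap, hT]
  · rw [hH, lie_zsmul, lie_self, smul_zero]
    exact Submodule.zero_mem _
  -- The only root vector not killed outright is that of `-α_x`; it goes to a multiple of `E_x`,
  -- which lies in `n_+`.
  · rcases lie_simple_lie_simple_E B K hδ x α with h | h
    · rw [h]; exact Submodule.zero_mem _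
    · rw [B.lie_E_E_of_add_eq_zero K h, lie_sum]
      refine Submodule.sum_mem _ fun y _ => ?_
      rw [lie_zsmul, hH]
      exact Submodule.smul_of_tower_mem _ _ (Submodule.smul_of_tower_mem _ _ hxm)

theorem lie_simpleE_lie_simpleE (x : Removed x₀) (a : B.nPos K) :
    ⁅B.simpleE K x, ⁅B.simpleE K x, a⁆⁆ = 0 := by
  let ad := LieAlgebra.ad K (B.nPos K) (B.simpleE K x)
  refine B.mem_of_posE_mem K (S := LinearMap.ker (ad ∘ₗ ad)) (fun α hα => ?_) a
  refine Subtype.ext ((lie_simple_lie_simple_E B K hδ x α).resolve_right fun h => ?_)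
  have h1 := congrFun h x
  have h2 : 0 ≤ α.1 x := hα x
  have h3 : simple x x = 1 := Pi.single_eq_same x 1
  rw [Pi.add_apply, simpleRoot_coe, h3, Pi.zero_apply] at h1
  omega

include hθ

/-- The images of the vertices satisfy the relations of the sandwich algebra. -/
theorem sandwichRelations_targetGen : SandwichRelations Γ (targetGen B K θ) where
  comm {x y} h := by
    have hbase : ∀ y : Removed x₀, ¬ Γ.Adj y.1 x₀ → ⁅B.E K (B.simpleRoot y), B.E K θ⁆ = 0 := by
      intro y hy
      -- Since `θ = α_{x₀} - δ` and `δ` is in the radical, pairing with `θ` is the same as pairing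
      -- with `α_{x₀}`.
      have hf : form (removeVertex Γ x₀) (B.simpleRoot y).1 θ.1 = 0 := by
        rw [← form_extendWeight, hθ, simpleRoot_coe, extendWeight_simple, map_sub, hδ.form_left,
          form_simple_not_adj Γ y.2 hy, sub_zero]
      refine B.lie_E_E_of_notMem K (fun h0 => ?_) (fun h0 => ?_)
      · have := (hδ.isPosDef.add_eq_zero_iff (coe_mem_root hδ _) (coe_mem_root hδ θ)).mp h0
        omega
      · have := (add_mem_root_iff (coe_mem_root hδ _) (coe_mem_root hδ θ)).mp
          (hδ.rootSystem_eq.le h0)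
        omega
    by_cases hx : x = x₀ <;> by_cases hy : y = x₀
    · rw [hx, hy, lie_self]
    · subst hx
      rw [targetGen_coe B K θ ⟨y, hy⟩, targetGen_base, ← lie_skew, lie_fromNPos_fromQuotient,
        coe_simpleE, hbase ⟨y, hy⟩ (fun h' => h h'.symm), map_zero, neg_zero]
    · subst hy
      rw [targetGen_coe B K θ ⟨x, hx⟩, targetGen_base, lie_fromNPos_fromQuotient,
        coe_simpleE, hbase ⟨x, hx⟩ h, map_zero]
    · rw [targetGen_coe B K θ ⟨x, hx⟩, targetGen_coe B K θ ⟨y, hy⟩, lie_fromNPos_fromNPos]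
      by_cases hxy : x = y
      · subst hxy; rw [lie_self, map_zero]
      have hne : (⟨x, hx⟩ : Removed x₀) ≠ ⟨y, hy⟩ := fun h' => hxy (congrArg Subtype.val h')
      have hf : form (removeVertex Γ x₀) (B.simpleRoot ⟨x, hx⟩).1 (B.simpleRoot ⟨y, hy⟩).1 = 0 :=
        form_simple_not_adj _ hne h
      have : ⁅B.simpleE K ⟨x, hx⟩, B.simpleE K ⟨y, hy⟩⁆ = 0 := by
        refine Subtype.ext (B.lie_E_E_of_notMem K (fun h0 => ?_) (fun h0 => ?_))
        · have := (hδ.isPosDef.add_eq_zero_iff (coe_mem_root hδ _) (coe_mem_root hδ _)).mp h0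
          omega
        · have := (add_mem_root_iff (coe_mem_root hδ _) (coe_mem_root hδ _)).mp
            (hδ.rootSystem_eq.le h0)
          omega
      rw [this, map_zero]
  sandwich x u := by
    obtain ⟨a, z, rfl⟩ := exists_eq_add B K u
    by_cases hx : x = x₀
    -- The generator at `x₀` lies in the abelian ideal `g/n_+`, so its double bracket vanishes.
    · subst hx
      rw [targetGen_base, lie_add, lie_fromQuotient_fromQuotient, ← lie_skew _ (fromNPos B K a),
        lie_fromNPos_fromQuotient, add_zero, lie_neg, lie_fromQuotient_fromQuotient, neg_zero]
    · rw [targetGen_coe B K θ ⟨x, hx⟩, lie_add, lie_add, lie_fromNPos_fromNPos,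
        lie_fromNPos_fromNPos, lie_fromNPos_fromQuotient, lie_fromNPos_fromQuotient, coe_simpleE,
        fromQuotient_eq_zero B K (lie_simple_lie_simple_mem B K hδ ⟨x, hx⟩ z),
        lie_simpleE_lie_simpleE B K hδ, map_zero, add_zero]

omit hδ hθ

/-- `z` is the basis element of weight `μ` of the target, for a real weight `μ`. -/
def IsRootVector (δ μ : V → ℤ) (z : AffineTarget B K) : Prop :=
  (∃ (α : rootSystem (removeVertex Γ x₀)) (hα : 0 ≤ α.1), extendWeight α.1 = μ ∧
    z = fromNPos B K (B.posE K α hα)) ∨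
  ∃ α : rootSystem (removeVertex Γ x₀), α.1 ≤ 0 ∧ δ + extendWeight α.1 = μ ∧
    z = fromQuotient B K (B.E K α)

include hδ

variable {K}

theorem IsRootVector.unique {μ : V → ℤ} {y z : AffineTarget B K} (hy : IsRootVector B K δ μ y)
    (hz : IsRootVector B K δ μ z) : y = z := by
  have hb : ∀ α β : rootSystem (removeVertex Γ x₀), extendWeight α.1 ≠ δ + extendWeight β.1 := by
    intro α β h
    have := congrFun h x₀
    simp [hδ.base] at this
  rcases hy with ⟨α, hα, h1, rfl⟩ | ⟨α, hα, h1, rfl⟩ <;>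
    rcases hz with ⟨β, hβ, h2, rfl⟩ | ⟨β, hβ, h2, rfl⟩
  · obtain rfl : α = β := Subtype.ext (extendWeight_injective (h1.trans h2.symm))
    rfl
  · exact absurd (h1.trans h2.symm) (hb α β)
  · exact absurd (h2.trans h1.symm) (hb β α)
  · obtain rfl : α = β :=
      Subtype.ext (extendWeight_injective (add_left_cancel (h1.trans h2.symm)))
    rfl

theorem exists_isRootVector {μ : V → ℤ} (hμ : IsSandwichWeight Γ δ μ) (hr : μ ∈ Root Γ) :
    ∃ z, IsRootVector B K δ μ z := by
  rcases hδ.sandwichWeight_real hμ hr with ⟨u, hu, h0, rfl⟩ | ⟨u, hu, h0, rfl⟩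
  · exact ⟨_, Or.inl ⟨⟨u, hδ.rootSystem_eq.ge hu⟩, h0, rfl, rfl⟩⟩
  · exact ⟨_, Or.inr ⟨⟨u, hδ.rootSystem_eq.ge hu⟩, h0, rfl, rfl⟩⟩

include hθ

theorem IsRootVector.eq_targetGen {x : V} {z : AffineTarget B K}
    (hz : IsRootVector B K δ (simple x) z) : z = targetGen B K θ x := by
  refine IsRootVector.unique B hδ hz ?_
  by_cases hx : x = x₀
  · subst hx
    refine Or.inr ⟨θ, ?_, by rw [hθ]; abel, targetGen_base B K θ⟩
    rw [← extendWeight_nonpos, hθ, sub_nonpos]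
    exact hδ.simple_le x
  · refine Or.inl ⟨B.simpleRoot ⟨x, hx⟩, Pi.single_nonneg.mpr zero_le_one, ?_,
      targetGen_coe B K θ ⟨x, hx⟩⟩
    rw [simpleRoot_coe, extendWeight_simple]

/-- Adding `α_{x₀} = δ + θ` to a weight in `n_+` corresponds to adding `θ` to the finite root and
passing to `g/n_+`. In every case the structure constant is that of the Chevalley basis, up to sign.
-/
theorem IsRootVector.lie {μ : V → ℤ} {x : V} {z : AffineTarget B K}
    (hz : IsRootVector B K δ μ z) (hμ : IsSandwichWeight Γ δ (μ + simple x))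
    (hr : μ + simple x ∈ Root Γ) : ∃ z', IsRootVector B K δ (μ + simple x) z' ∧
      (⁅targetGen B K θ x, z⁆ = z' ∨ ⁅targetGen B K θ x, z⁆ = -z') := by
  have hge := hδ.rootSystem_eq.ge
  by_cases hx : x = x₀
  · subst hx
    rcases hz with ⟨α, hα, rfl, rfl⟩ | ⟨α, hα, rfl, rfl⟩
    · have hw : extendWeight α.1 + simple x = δ + extendWeight (α.1 + θ.1) := by
        rw [extendWeight_add, hθ]; abel
      rw [hw] at hμ hr ⊢
      have hγ : α.1 + θ.1 ∈ Root (removeVertex Γ x) := by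
        rw [← extendWeight_mem_root, ← neg_neg (extendWeight _)]
        refine neg_mem_root (hδ.sub_mem_root.mp ?_)
        rwa [sub_neg_eq_add]
      have h0 : α.1 + θ.1 ≤ 0 := by
        rw [← extendWeight_nonpos]
        simpa using hμ.le
      refine ⟨_, Or.inr ⟨⟨_, hge hγ⟩, h0, rfl, rfl⟩, ?_⟩
      rw [targetGen_base, ← lie_skew, lie_fromNPos_fromQuotient]
      change -fromQuotient B K ⁅B.E K α, B.E K θ⁆ = _ ∨ -fromQuotient B K ⁅B.E K α, B.E K θ⁆ = _
      rcases B.lie_E_E_of_root K (α := α) (β := θ) (γ := ⟨_, hge hγ⟩) rfl with h | h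
      · right; rw [h]
      · left; rw [h, map_neg, neg_neg]
    -- A weight in `g/n_+` already has coordinate 1 at `x₀`, so adding `α_{x₀}` would exceed `δ`.
    · have := hμ.le x
      simp [hδ.base] at this
  · rcases hz with ⟨α, hα, rfl, rfl⟩ | ⟨α, hα, rfl, rfl⟩
    · have hw : extendWeight α.1 + simple x =
          extendWeight ((B.simpleRoot ⟨x, hx⟩).1 + α.1) := by
        rw [extendWeight_add, simpleRoot_coe, extendWeight_simple, add_comm]
      rw [hw] at hμ hr ⊢
      have hγ := hge (extendWeight_mem_root.mp hr)
      refine ⟨_, Or.inl ⟨⟨_, hγ⟩, extendWeight_nonneg.mp hμ.nonneg, rfl, rfl⟩, ?_⟩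
      rw [targetGen_coe B K θ ⟨x, hx⟩, lie_fromNPos_fromNPos]
      rcases B.lie_E_E_of_root K (α := B.simpleRoot ⟨x, hx⟩) (β := α) (γ := ⟨_, hγ⟩) rfl with h | h
      · left; exact congrArg _ (Subtype.ext h)
      · right
        rw [← map_neg]
        exact congrArg _ (Subtype.ext h)
    · have hw : δ + extendWeight α.1 + simple x =
          δ + extendWeight ((B.simpleRoot ⟨x, hx⟩).1 + α.1) := by
        rw [extendWeight_add, simpleRoot_coe, extendWeight_simple, add_assoc, add_comm (extendWeight _)]
      rw [hw] at hμ hr ⊢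
      have hγ : (B.simpleRoot ⟨x, hx⟩).1 + α.1 ∈ Root (removeVertex Γ x₀) := by
        rw [← extendWeight_mem_root, ← neg_neg (extendWeight _)]
        refine neg_mem_root (hδ.sub_mem_root.mp ?_)
        rwa [sub_neg_eq_add]
      have h0 : (B.simpleRoot ⟨x, hx⟩).1 + α.1 ≤ 0 := by
        rw [← extendWeight_nonpos]
        simpa using hμ.le
      refine ⟨_, Or.inr ⟨⟨_, hge hγ⟩, h0, rfl, rfl⟩, ?_⟩
      rw [targetGen_coe B K θ ⟨x, hx⟩, lie_fromNPos_fromQuotient, coe_simpleE]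
      rcases B.lie_E_E_of_root K (α := B.simpleRoot ⟨x, hx⟩) (β := α) (γ := ⟨_, hge hγ⟩) rfl with
        h | h
      · left; rw [h]
      · right; rw [h, map_neg]

omit hθ in
theorem IsRootVector.lie_delta {x : Removed x₀} {z : AffineTarget B K}
    (hz : IsRootVector B K δ (δ - simple x.1) z) :
    ⁅targetGen B K θ x.1, z⁆ = fromQuotient B K (B.H K x) := by
  rcases hz with ⟨α, hα, h1, rfl⟩ | ⟨α, hα, h1, rfl⟩
  · have := congrFun h1 x₀
    simp [hδ.base, Ne.symm x.2] at this
  · have h2 : (B.simpleRoot x).1 + α.1 = 0 := by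
      apply extendWeight_injective
      rw [sub_eq_add_neg] at h1
      rw [extendWeight_add, add_left_cancel h1, simpleRoot_coe, extendWeight_simple]
      simp
    rw [targetGen_coe, lie_fromNPos_fromQuotient, coe_simpleE, B.lie_E_E_of_add_eq_zero K h2]
    simp [simpleRoot_coe, Pi.single_apply, ite_smul]

theorem IsRootVector.lie_delta_mem {x : V} {z : AffineTarget B K}
    (hz : IsRootVector B K δ (δ - simple x) z) :
    ⁅targetGen B K θ x, z⁆ ∈ (B.weightSpace K 0).map (fromQuotient B K) := by
  rw [B.weightSpace_zero]
  by_cases hx : x = x₀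
  · subst hx
    rcases hz with ⟨α, hα, h1, rfl⟩ | ⟨α, hα, h1, rfl⟩
    · have h2 : α.1 + θ.1 = 0 := by
        apply extendWeight_injective
        rw [extendWeight_add, h1, hθ, extendWeight_zero]; abel
      rw [targetGen_base, ← lie_skew, lie_fromNPos_fromQuotient]
      refine neg_mem ⟨_, ?_, rfl⟩
      change ⁅B.E K α, B.E K θ⁆ ∈ Submodule.span K (Set.range (B.H K))
      rw [B.lie_E_E_of_add_eq_zero K h2]
      exact Submodule.sum_mem _ fun y _ =>
        Submodule.smul_of_tower_mem _ _ (Submodule.subset_span (Set.mem_range_self y))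
    · have := congrFun h1 x
      simp [hδ.base] at this
  · rw [IsRootVector.lie_delta B θ hδ (x := ⟨x, hx⟩) hz]
    exact Submodule.mem_map_of_mem (Submodule.subset_span (Set.mem_range_self _))

omit hδ hθ in
theorem IsRootVector.mem_targetWeightSpace {μ : V → ℤ} {z : AffineTarget B K}
    (hz : IsRootVector B K δ μ z) : z ∈ targetWeightSpace B K δ μ := by
  rcases hz with ⟨α, hα, h1, rfl⟩ | ⟨α, hα, h1, rfl⟩
  · refine Submodule.mem_sup_left ?_
    refine Submodule.mem_iSup_of_mem α.1 (Submodule.mem_iSup_of_mem ⟨α.2, hα⟩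
      (Submodule.mem_iSup_of_mem h1 ⟨B.posE K α hα, ?_, rfl⟩))
    exact Submodule.subset_span (Or.inl ⟨α, rfl, rfl⟩)
  · refine Submodule.mem_sup_right ?_
    refine Submodule.mem_iSup_of_mem α.1 (Submodule.mem_iSup_of_mem (Or.inr ⟨α.2, hα⟩)
      (Submodule.mem_iSup_of_mem h1 ⟨B.E K α, ?_, rfl⟩))
    exact Submodule.subset_span (Or.inl ⟨α, rfl, rfl⟩)

omit hδ hθ in
theorem map_weightSpace_zero_le :
    (B.weightSpace K 0).map (fromQuotient B K) ≤ targetWeightSpace B K δ δ :=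
  le_sup_of_le_right (le_iSup_of_le 0 (le_iSup_of_le (Or.inl rfl)
    (le_iSup_of_le (by simp) le_rfl)))

omit hδ hθ in
theorem targetWeightSpace_le {μ : V → ℤ} {S : Submodule K (AffineTarget B K)}
    (h1 : ∀ z, IsRootVector B K δ μ z → z ∈ S)
    (h2 : μ = δ → ∀ x, fromQuotient B K (B.H K x) ∈ S) : targetWeightSpace B K δ μ ≤ S := by
  refine sup_le (iSup_le fun β => iSup_le fun hβ => iSup_le fun hμ => ?_)
    (iSup_le fun β => iSup_le fun hβ => iSup_le fun hμ => ?_)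
  · rintro _ ⟨a, ha, rfl⟩
    have ha' : (a : B.Algebra K) ∈ B.weightSpace K β := ha
    rw [B.weightSpace_of_root K hβ.1] at ha'
    obtain ⟨c, hc⟩ := Submodule.mem_span_singleton.mp ha'
    have : a = c • B.posE K ⟨β, hβ.1⟩ hβ.2 := Subtype.ext hc.symm
    rw [this, map_smul]
    exact S.smul_mem _ (h1 _ (Or.inl ⟨⟨β, hβ.1⟩, hβ.2, hμ, rfl⟩))
  · rcases hβ with rfl | hβ
    · rw [B.weightSpace_zero, Submodule.map_span, Submodule.span_le]
      rintro _ ⟨_, ⟨x, rfl⟩, rfl⟩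
      exact h2 (by rw [← hμ]; simp) x
    · rw [B.weightSpace_of_root K hβ.1, Submodule.map_span, Submodule.span_le]
      rintro _ ⟨_, rfl, rfl⟩
      exact h1 _ (Or.inr ⟨⟨β, hβ.1⟩, hβ.2, hμ, rfl⟩)

end Target

/-! ### The sandwich algebra -/

section Sandwich

variable {V : Type*} (Γ : SimpleGraph V) (K : Type*) [Field K]

theorem sandwichRelations_of : SandwichRelations Γ (ExtremalAlgebra.of Γ K 0) where
  comm {x y} h := by
    have h1 : ⁅FreeCommuting.of Γ K x, FreeCommuting.of Γ K y⁆ = 0 :=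
      (Submodule.Quotient.mk_eq_zero _).mpr (LieSubmodule.subset_lieSpan ⟨x, y, h, rfl⟩)
    have h2 := congrArg (quotientMk (LieSubmodule.lieSpan K (FreeCommuting Γ K)
      {z | ∃ (x : V) (y : FreeCommuting Γ K),
        z = ⁅FreeCommuting.of Γ K x, ⁅FreeCommuting.of Γ K x, y⁆⁆ -
          (0 : V → Module.Dual K (FreeCommuting Γ K)) x y • FreeCommuting.of Γ K x})) h1
    rw [map_zero, LieHom.map_lie] at h2
    exact h2
  sandwich x z := by
    obtain ⟨y, rfl⟩ := quotientMk_surjective _ z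
    refine (Submodule.Quotient.mk_eq_zero _).mpr (LieSubmodule.subset_lieSpan ⟨x, y, ?_⟩)
    simp

theorem generates_of : Generates K (ExtremalAlgebra.of Γ K 0) :=
  ((generates_freeLieAlgebra V).map (quotientMk _) (quotientMk_surjective _)).map (quotientMk _)
    (quotientMk_surjective _)

variable {Γ} {L : Type*} [LieRing L] [LieAlgebra K L] {s : V → L}

/-- The universal property of the sandwich algebra. -/
theorem SandwichRelations.exists_lieHom (hs : SandwichRelations Γ s) :
    ∃ φ : SandwichAlgebra Γ K →ₗ⁅K⁆ L, ∀ x, φ (ExtremalAlgebra.of Γ K 0 x) = s x := by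
  let φ₁ : FreeCommuting Γ K →ₗ⁅K⁆ L := quotientLift _ (FreeLieAlgebra.lift K s) (by
    rintro _ ⟨x, y, h, rfl⟩
    rw [LieHom.map_lie, FreeLieAlgebra.lift_of_apply, FreeLieAlgebra.lift_of_apply, hs.comm h])
  have h1 : ∀ x, φ₁ (FreeCommuting.of Γ K x) = s x := fun x => by
    rw [FreeCommuting.of, quotientLift_mk, FreeLieAlgebra.lift_of_apply]
  let φ : SandwichAlgebra Γ K →ₗ⁅K⁆ L := quotientLift _ φ₁ (by
    rintro _ ⟨x, y, rfl⟩
    rw [map_sub, LieHom.map_lie, LieHom.map_lie, h1, hs.sandwich]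
    simp)
  exact ⟨φ, fun x => by rw [ExtremalAlgebra.of, quotientLift_mk, h1]⟩

end Sandwich

/-! ### The isomorphism -/

section Isomorphism

variable {V : Type*} [Fintype V] [DecidableEq V] {Γ : SimpleGraph V} [DecidableRel Γ.Adj]
  {x₀ : V} (B : ChevalleyBasis (removeVertex Γ x₀)) {K : Type*} [Field K]
  (θ : rootSystem (removeVertex Γ x₀)) {δ : V → ℤ} (hδ : IsAffine Γ x₀ δ)
  (hθ : extendWeight θ.1 = simple x₀ - δ)
include hδ hθ

/-- Descending by simple roots, each bracket gives the next root vector up to sign. The coefficients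
are units in every field, so the generators reach every root vector. -/
theorem IsRootVector.mem_weightSpace (n : ℕ) : ∀ {μ : V → ℤ} {z : AffineTarget B K},
    ∑ x, μ x = n → IsSandwichWeight Γ δ μ → μ ∈ Root Γ → IsRootVector B K δ μ z →
    z ∈ weightSpace K (targetGen B K θ) simple μ := by
  induction n with
  | zero =>
    intro μ z hn hμ
    refine absurd (funext fun x => ?_) hμ.ne_zero
    exact (Finset.sum_eq_zero_iff_of_nonneg fun x _ => hμ.nonneg x).mp hn x (Finset.mem_univ x)
  | succ n ih =>
    intro μ z hn hμ hr hz
    by_cases hs : ∃ x, μ = simple x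
    · obtain ⟨x, rfl⟩ := hs
      rw [IsRootVector.eq_targetGen B θ hδ hθ hz]
      exact gen_mem_weightSpace _ simple x
    · obtain ⟨x, -, h1, h2⟩ := hδ.exists_sub_simple hμ hr (not_exists.mp hs)
      obtain ⟨y, hy⟩ := exists_isRootVector B hδ (K := K) h1 h2
      have e : μ - simple x + simple x = μ := sub_add_cancel _ _
      obtain ⟨z', hz', h⟩ := IsRootVector.lie B θ hδ hθ hy (e.symm ▸ hμ) (e.symm ▸ hr)
      rw [e] at hz'
      rw [IsRootVector.unique B hδ hz hz']
      have hmem := lie_mem_weightSpace (targetGen B K θ) simple x (ih (by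
        simp only [Pi.sub_apply, Finset.sum_sub_distrib, hn, Finset.sum_pi_single',
          Finset.mem_univ, if_true]
        push_cast; ring) h1 h2 hy)
      rw [add_sub_cancel] at hmem
      rcases h with h | h <;> rw [h] at hmem
      · exact hmem
      · exact neg_mem_iff.mp hmem

theorem targetWeightSpace_le_weightSpace (μ : V → ℤ) :
    targetWeightSpace B K δ μ ≤ weightSpace K (targetGen B K θ) simple μ := by
  have key : ∀ {μ : V → ℤ} {z : AffineTarget B K}, IsRootVector B K δ μ z →
      z ∈ weightSpace K (targetGen B K θ) simple μ := by
    intro μ z hz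
    obtain ⟨hμ, hr⟩ : IsSandwichWeight Γ δ μ ∧ μ ∈ Root Γ := by
      rcases hz with ⟨α, hα, rfl, -⟩ | ⟨α, hα, rfl, -⟩
      · exact ⟨hδ.isSandwichWeight_extendWeight (coe_mem_root hδ α) hα,
          extendWeight_mem_root.mpr (coe_mem_root hδ α)⟩
      · exact ⟨hδ.isSandwichWeight_delta_add (coe_mem_root hδ α) hα,
          hδ.delta_add_mem_root (coe_mem_root hδ α)⟩
    exact IsRootVector.mem_weightSpace B θ hδ hθ (∑ x, μ x).toNat
      (Int.toNat_of_nonneg (Finset.sum_nonneg fun x _ => hμ.nonneg x)).symm hμ hr hz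
  refine targetWeightSpace_le B (fun z hz => key hz) ?_
  rintro rfl x
  -- Bracketing the image of `E_{-α_x}`, of weight `δ - α_x`, with the generator at `x` yields the
  -- image of `H_x`.
  have hz : IsRootVector B K μ (μ - simple x.1) (fromQuotient B K (B.E K ⟨-simple x,
      hδ.rootSystem_eq.ge (neg_mem_root (simple_mem_root x))⟩)) := by
    refine Or.inr ⟨⟨-simple x, _⟩, neg_nonpos.mpr (Pi.single_nonneg.mpr zero_le_one), ?_, rfl⟩
    rw [extendWeight_neg, extendWeight_simple, sub_eq_add_neg]
  have h := lie_mem_weightSpace (targetGen B K θ) simple x.1 (key hz)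
  rwa [IsRootVector.lie_delta B θ hδ hz, add_sub_cancel] at h

theorem lieMonomial_mem_targetWeightSpace (hK : (2 : K) ≠ 0) (w : List V) :
    lieMonomial (targetGen B K θ) w ∈ targetWeightSpace B K δ (w.map simple).sum := by
  have hs := sandwichRelations_targetGen B K θ hδ hθ
  induction w with
  | nil => exact Submodule.zero_mem _
  | cons x w ih =>
    rcases eq_or_ne (lieMonomial (targetGen B K θ) (x :: w)) 0 with h0 | h0
    · rw [h0]; exact Submodule.zero_mem _
    have hμ := hs.isSandwichWeight_of_lieMonomial_ne_zero K hK hδ h0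
    rcases eq_or_ne w [] with rfl | hw
    · rw [List.map_singleton, List.sum_singleton] at hμ ⊢
      obtain ⟨z, hz⟩ := exists_isRootVector B hδ (K := K) hμ (simple_mem_root x)
      have := hz.mem_targetWeightSpace B
      rwa [IsRootVector.eq_targetGen B θ hδ hθ hz] at this
    rw [lieMonomial_cons _ x hw] at h0 ⊢
    rw [List.map_cons, List.sum_cons, add_comm] at hμ ⊢
    have hf := (hs.lieMonomial_pairing K hK x w).1 h0
    set ν := (w.map simple).sum
    have hle : targetWeightSpace B K δ ν ≤ (targetWeightSpace B K δ (ν + simple x)).comap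
        (LieAlgebra.ad K (AffineTarget B K) (targetGen B K θ x) : Module.End K _) := by
      refine targetWeightSpace_le B (fun z hz => ?_) fun h => ?_
      · rw [Submodule.mem_comap, LieAlgebra.ad_apply]
        rcases hδ.sandwichWeight_cases hμ with hr | h
        · obtain ⟨z', hz', h | h⟩ := IsRootVector.lie B θ hδ hθ hz hμ hr <;> rw [h]
          · exact hz'.mem_targetWeightSpace B
          · exact neg_mem (hz'.mem_targetWeightSpace B)
        · rw [h]
          rw [eq_sub_of_add_eq h] at hz
          exact map_weightSpace_zero_le B (IsRootVector.lie_delta_mem B θ hδ hθ hz)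
      -- No nonzero monomial extends one of weight `δ`, because every simple root pairs to 0 with
      -- `δ`.
      · rw [h, hδ.form_simple] at hf
        omega
    exact hle ih

theorem weightSpace_targetGen (hK : (2 : K) ≠ 0) (μ : V → ℤ) :
    weightSpace K (targetGen B K θ) simple μ = targetWeightSpace B K δ μ := by
  refine le_antisymm (Submodule.span_le.mpr ?_) (targetWeightSpace_le_weightSpace B θ hδ hθ μ)
  rintro _ ⟨w, rfl, rfl⟩
  exact lieMonomial_mem_targetWeightSpace B θ hδ hθ hK w

/-- The sandwich algebra of an affine diagram. -/
theorem exists_lieEquiv (hK : (2 : K) ≠ 0) :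
    ∃ φ : SandwichAlgebra Γ K ≃ₗ⁅K⁆ AffineTarget B K,
      (∀ x, φ (ExtremalAlgebra.of Γ K 0 x) = targetGen B K θ x) ∧
      ∀ μ : V → ℤ, (SandwichAlgebra.weightSpace Γ K μ).map
        (φ : SandwichAlgebra Γ K →ₗ[K] AffineTarget B K) = targetWeightSpace B K δ μ := by
  obtain ⟨φ, hφ⟩ := (sandwichRelations_targetGen B K θ hδ hθ).exists_lieHom K
  have hmap : ∀ μ : V → ℤ, (SandwichAlgebra.weightSpace Γ K μ).map
      (φ : SandwichAlgebra Γ K →ₗ[K] AffineTarget B K) = targetWeightSpace B K δ μ := by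
    intro μ
    rw [← weightSpace_targetGen B θ hδ hθ hK, SandwichAlgebra.weightSpace, weightSpace, weightSpace,
      Submodule.map_span]
    congr 1
    ext z
    have hw : ∀ w, φ (lieMonomial (ExtremalAlgebra.of Γ K 0) w) =
        lieMonomial (targetGen B K θ) w := fun w => by
      rw [map_lieMonomial]
      exact congrArg (lieMonomial · w) (funext hφ)
    constructor
    · rintro ⟨_, ⟨w, h, rfl⟩, rfl⟩
      exact ⟨w, h, hw w⟩
    · rintro ⟨w, h, rfl⟩
      exact ⟨_, ⟨w, h, rfl⟩, hw w⟩
  have hrange : ∀ μ, targetWeightSpace B K δ μ ≤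
      LinearMap.range (φ : SandwichAlgebra Γ K →ₗ[K] AffineTarget B K) := fun μ => by
    rw [← hmap]; exact LinearMap.map_le_range
  have hsurj : Function.Surjective (φ : SandwichAlgebra Γ K →ₗ[K] AffineTarget B K) := by
    rw [← LinearMap.range_eq_top, eq_top_iff]
    rintro u -
    refine mem_of_target_basis_mem B (fun α hα => ?_) (fun x => ?_) (fun α => ?_) u
    · exact hrange _ (IsRootVector.mem_targetWeightSpace B (Or.inl ⟨α, hα, rfl, rfl⟩))
    · refine hrange _ (map_weightSpace_zero_le B (Submodule.mem_map_of_mem ?_))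
      rw [B.weightSpace_zero]
      exact Submodule.subset_span (Set.mem_range_self x)
    · rcases hδ.isPosDef.root_nonneg_or_nonpos (coe_mem_root hδ α) with h | h
      -- Positive root vectors die in `g/n_+`; only their copies in `n_+` have to be reached.
      · rw [fromQuotient_eq_zero B K (B.E_mem_nPos K h)]
        exact Submodule.zero_mem _
      · exact hrange _ (IsRootVector.mem_targetWeightSpace B (Or.inr ⟨α, h, rfl, rfl⟩))
  have hfin : Finite (Root (removeVertex Γ x₀)) := hδ.finite_root
  have hfin' : Finite (rootSystem (removeVertex Γ x₀)) := by rw [hδ.rootSystem_eq]; exact hfin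
  obtain ⟨f, hf⟩ := (sandwichRelations_of Γ K).exists_spanning_family hK hδ (generates_of Γ K)
  obtain ⟨hfd, hdim⟩ := finrank_target B K
  have := Fintype.ofFinite (Removed x₀ ⊕ Root (removeVertex Γ x₀))
  have hL : Module.Finite K (SandwichAlgebra Γ K) :=
    ⟨⟨(Set.finite_range f).toFinset, by rw [Set.Finite.coe_toFinset]; exact top_le_iff.mp hf⟩⟩
  -- The spanning family of the sandwich algebra and the dimension of the target are counted by the
  -- same index set, so the surjection has to be injective.
  have hle : Module.finrank K (SandwichAlgebra Γ K) ≤ Module.finrank K (AffineTarget B K) := by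
    rw [hdim, hδ.rootSystem_eq, Nat.card_eq_fintype_card, ← finrank_top, ← top_le_iff.mp hf]
    exact finrank_range_le_card f
  have hinj : Function.Injective (φ : SandwichAlgebra Γ K →ₗ[K] AffineTarget B K) :=
    (LinearMap.injective_iff_surjective_of_finrank_eq_finrank
      (le_antisymm hle (LinearMap.finrank_le_finrank_of_surjective hsurj))).mpr hsurj
  exact ⟨LieEquiv.ofBijective φ ⟨hinj, hsurj⟩, hφ, hmap⟩

end Isomorphism

/-! ### The affine diagrams -/

section Diagrams

theorem IsAffine.of_iso {V W : Type*} [Fintype V] [DecidableEq V] [Fintype W] [DecidableEq W]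
    {Γ : SimpleGraph V} [DecidableRel Γ.Adj] {G : SimpleGraph W} [DecidableRel G.Adj] {x₀ : V}
    {w₀ : W} {d : W → ℤ} (h : IsAffine G w₀ d) (φ : Γ ≃g G) (hφ : φ x₀ = w₀) :
    IsAffine Γ x₀ (d ∘ φ) where
  pos x := h.pos _
  form_simple x := by
    have hsum : ∑ z, (if G.Adj (φ x) z then d z else 0) =
        ∑ y, if Γ.Adj x y then d (φ y) else 0 := by
      rw [← Equiv.sum_comp φ.toEquiv]
      refine Finset.sum_congr rfl fun y _ => ?_
      simp only [← φ.map_adj_iff (v := x) (w := y)]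
      rfl
    have h0 := h.form_simple (φ x)
    rw [form_simple_eq, hsum] at h0
    rw [form_simple_eq]
    exact h0
  base := by rw [Function.comp_apply, hφ, h.base]
  preconnected := (SimpleGraph.Iso.connected_iff φ |>.mpr
    (haveI : Nonempty W := ⟨w₀⟩; ⟨h.preconnected⟩)).preconnected

/-- A graph is connected if every vertex other than a root has a neighbor of smaller rank. -/
theorem preconnected_of_rank {W : Type*} {G : SimpleGraph W} {w₀ : W} (r : W → ℕ)
    (h : ∀ x, x ≠ w₀ → ∃ y, G.Adj x y ∧ r y < r x) : G.Preconnected := by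
  have key : ∀ n x, r x = n → G.Reachable x w₀ := by
    intro n
    induction n using Nat.strong_induction_on with
    | _ n ih =>
      rintro x rfl
      by_cases hx : x = w₀
      · rw [hx]
      · obtain ⟨y, hy, hr⟩ := h x hx
        exact hy.reachable.trans (ih _ hr y rfl)
  exact fun x y => (key _ x rfl).trans (key _ y rfl).symm

theorem isAffine_cycleGraph (n : ℕ) :
    IsAffine (SimpleGraph.cycleGraph (n + 3)) 0 (fun _ => 1) where
  pos _ := one_pos
  form_simple x := by
    -- Every vertex of the cycle has degree 2, so the all-ones vector is in the kernel.
    rw [form_simple_eq, ← Finset.sum_filter, Finset.sum_const,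
      ← SimpleGraph.neighborFinset_eq_filter,
      SimpleGraph.card_neighborFinset_eq_degree, SimpleGraph.cycleGraph_degree_three_le]
    rfl
  base := rfl
  preconnected := SimpleGraph.cycleGraph_preconnected

/-- The coefficients of the null root of `D_n^(1)`. -/
def deltaD (n : ℕ) (i : Fin (n + 1)) : ℤ := if i.val ≤ 1 ∨ n - 1 ≤ i.val then 1 else 2

/-- The diagram `D_n^(1)`. -/
abbrev graphD (n : ℕ) : SimpleGraph (Fin (n + 1)) :=
  SimpleGraph.fromRel fun i j : Fin (n + 1) =>
    (i.val = 0 ∧ j.val = 2) ∨ (1 ≤ i.val ∧ j.val = i.val + 1 ∧ j.val ≤ n - 1) ∨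
      (i.val = n - 2 ∧ j.val = n)

theorem isAffine_graphD (n : ℕ) (hn : 4 ≤ n) : IsAffine (graphD n) 0 (deltaD n) where
  pos x := by rw [deltaD]; split_ifs <;> norm_num
  form_simple x := by
    have hadj : ∀ x y : Fin (n + 1), (graphD n).Adj x y ↔
        ((x.val = 0 ∧ y.val = 2) ∨ (1 ≤ x.val ∧ y.val = x.val + 1 ∧ y.val ≤ n - 1) ∨
        (x.val = n - 2 ∧ y.val = n)) ∨
        ((y.val = 0 ∧ x.val = 2) ∨ (1 ≤ y.val ∧ x.val = y.val + 1 ∧ x.val ≤ n - 1) ∨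
        (y.val = n - 2 ∧ x.val = n)) := by
      intro x y
      refine ⟨fun h => h.2, fun h => ⟨?_, h⟩⟩
      rintro rfl
      omega
    -- This reduces the kernel equation to an explicit finite set of neighbors as natural numbers,
    -- so that each case is arithmetic.
    have key : ∀ s : Finset ℕ, (∀ j, j ∈ s ↔ j < n + 1 ∧
        (((x.val = 0 ∧ j = 2) ∨ (1 ≤ x.val ∧ j = x.val + 1 ∧ j ≤ n - 1) ∨
        (x.val = n - 2 ∧ j = n)) ∨
        ((j = 0 ∧ x.val = 2) ∨ (1 ≤ j ∧ x.val = j + 1 ∧ x.val ≤ n - 1) ∨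
        (j = n - 2 ∧ x.val = n)))) →
        2 * (if x.val ≤ 1 ∨ n - 1 ≤ x.val then 1 else 2 : ℤ) =
          ∑ j ∈ s, (if j ≤ 1 ∨ n - 1 ≤ j then 1 else 2 : ℤ) →
        form (graphD n) (simple x) (deltaD n) = 0 := by
      intro s hs h
      rw [form_simple_eq, sub_eq_zero]
      refine h.trans ?_
      have hs' : s = (Finset.range (n + 1)).filter (· ∈ s) := by
        ext j
        simp only [Finset.mem_filter, Finset.mem_range]
        exact ⟨fun hj => ⟨((hs j).mp hj).1, hj⟩, fun hj => hj.2⟩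
      rw [hs', Finset.sum_filter, ← Fin.sum_univ_eq_sum_range
        (fun j => if j ∈ s then (if j ≤ 1 ∨ n - 1 ≤ j then 1 else 2 : ℤ) else 0)]
      refine Finset.sum_congr rfl fun y _ => ?_
      have : (y : ℕ) ∈ s ↔ (graphD n).Adj x y := by
        rw [hs, hadj]
        exact and_iff_right y.isLt
      simp only [this, deltaD]
    have hx := x.isLt
    -- The two branch vertices are `2` and `n - 2`. They coincide for `n = 4`, where the vertex `2`
    -- has four neighbors.
    obtain h | h | h | h | h | h | h : x.val = 0 ∨ x.val = 1 ∨ (x.val = 2 ∧ n = 4) ∨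
      (x.val = 2 ∧ 5 ≤ n) ∨ (3 ≤ x.val ∧ x.val + 3 ≤ n) ∨ (5 ≤ n ∧ x.val + 2 = n) ∨
      (x.val + 1 = n ∨ x.val = n) := by omega
    · refine key {2} (fun j => ?_) ?_
      · rw [Finset.mem_singleton]; omega
      · rw [Finset.sum_singleton]; split_ifs <;> omega
    · refine key {2} (fun j => ?_) ?_
      · rw [Finset.mem_singleton]; omega
      · rw [Finset.sum_singleton]; split_ifs <;> omega
    · refine key {0, 1, 3, 4} (fun j => ?_) ?_
      · simp only [Finset.mem_singleton, Finset.mem_insert]; omega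
      · obtain ⟨hx2, rfl⟩ := h
        rw [hx2]; decide
    · refine key {0, 1, 3} (fun j => ?_) ?_
      · simp only [Finset.mem_singleton, Finset.mem_insert]; omega
      · rw [Finset.sum_insert (by decide), Finset.sum_insert (by decide), Finset.sum_singleton]
        split_ifs <;> omega
    · refine key {x.val - 1, x.val + 1} (fun j => ?_) ?_
      · simp only [Finset.mem_singleton, Finset.mem_insert]; omega
      · rw [Finset.sum_pair (by omega)]
        split_ifs <;> omega
    · refine key {x.val - 1, n - 1, n} (fun j => ?_) ?_
      · simp only [Finset.mem_singleton, Finset.mem_insert]; omega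
      · rw [Finset.sum_insert (by simp only [Finset.mem_singleton, Finset.mem_insert]; omega),
          Finset.sum_pair (by omega)]
        split_ifs <;> omega
    · refine key {n - 2} (fun j => ?_) ?_
      · rw [Finset.mem_singleton]; omega
      · rw [Finset.sum_singleton]; split_ifs <;> omega
  base := by simp [deltaD]
  preconnected := by
    -- The vertex `1` is attached to `2` and not to `0`, so it receives a rank above all others to
    -- make its neighbor smaller.
    refine preconnected_of_rank (w₀ := (0 : Fin (n + 1)))
      (fun x : Fin (n + 1) => if x.val = 1 then n + 1 else x.val) fun x hx => ?_
    have hlt := x.isLt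
    have hx0 : x.val ≠ 0 := fun h => hx (Fin.ext h)
    have key : ∀ j : ℕ, j < n + 1 → x.val ≠ j → (((x.val = 0 ∧ j = 2) ∨
        (1 ≤ x.val ∧ j = x.val + 1 ∧ j ≤ n - 1) ∨ (x.val = n - 2 ∧ j = n)) ∨
        ((j = 0 ∧ x.val = 2) ∨ (1 ≤ j ∧ x.val = j + 1 ∧ x.val ≤ n - 1) ∨
        (j = n - 2 ∧ x.val = n))) →
        (if j = 1 then n + 1 else j) < (if x.val = 1 then n + 1 else x.val) →
        ∃ y : Fin (n + 1), (graphD n).Adj x y ∧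
          (if y.val = 1 then n + 1 else y.val) < (if x.val = 1 then n + 1 else x.val) :=
      fun j hj hne h hr => ⟨⟨j, hj⟩, ⟨fun he => hne (congrArg Fin.val he), h⟩, hr⟩
    obtain h | h | h | h : x.val = 1 ∨ x.val = 2 ∨ (3 ≤ x.val ∧ x.val + 1 ≤ n) ∨ x.val = n := by
      omega
    · exact key 2 (by omega) (by omega) (by omega) (by split_ifs <;> omega)
    · exact key 0 (by omega) (by omega) (by omega)
        (by rw [if_neg (by omega), if_neg (by omega)]; omega)
    · exact key (x.val - 1) (by omega) (by omega) (by omega) (by split_ifs <;> omega)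
    · exact key (n - 2) (by omega) (by omega) (by omega) (by split_ifs <;> omega)

theorem isAffine_E6 : IsAffine (SimpleGraph.fromRel fun i j : Fin 7 =>
    (1 ≤ i.val ∧ j.val = i.val + 1 ∧ j.val ≤ 5) ∨ (i.val = 3 ∧ j.val = 6) ∨
      (i.val = 6 ∧ j.val = 0)) 0
    ![1, 1, 2, 3, 2, 1, 2] where
  pos := by decide
  form_simple x := by rw [form_simple_eq]; revert x; decide
  base := rfl
  -- The ranks are the distances from the vertex `0`.
  preconnected := preconnected_of_rank (w₀ := 0) ![0, 4, 3, 2, 3, 4, 1] (by decide)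

theorem isAffine_E7 : IsAffine (SimpleGraph.fromRel fun i j : Fin 8 =>
    (j.val = i.val + 1 ∧ j.val ≤ 6) ∨ (i.val = 3 ∧ j.val = 7)) 0
    ![1, 2, 3, 4, 3, 2, 1, 2] where
  pos := by decide
  form_simple x := by rw [form_simple_eq]; revert x; decide
  base := rfl
  preconnected := preconnected_of_rank (w₀ := 0) ![0, 1, 2, 3, 4, 5, 6, 4] (by decide)

theorem isAffine_E8 : IsAffine (SimpleGraph.fromRel fun i j : Fin 9 =>
    (j.val = i.val + 1 ∧ j.val ≤ 7) ∨ (i.val = 5 ∧ j.val = 8)) 0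
    ![1, 2, 3, 4, 5, 6, 4, 2, 3] where
  pos := by decide
  form_simple x := by rw [form_simple_eq]; revert x; decide
  base := rfl
  preconnected := preconnected_of_rank (w₀ := 0) ![0, 1, 2, 3, 4, 5, 6, 7, 6] (by decide)

theorem IsSimplyLacedAffine.exists_isAffine {V : Type*} [Fintype V] [DecidableEq V]
    {Γ : SimpleGraph V} [DecidableRel Γ.Adj] {x₀ : V} (h : IsSimplyLacedAffine Γ x₀) :
    ∃ δ, IsAffine Γ x₀ δ := by
  obtain ⟨t, φ, hφ⟩ := h
  cases t with
  | A n hn =>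
    match n, hn with
    | n + 2, _ => exact ⟨_, (isAffine_cycleGraph n).of_iso φ hφ⟩
  | D n hn => exact ⟨_, (isAffine_graphD n hn).of_iso φ hφ⟩
  | E6 => exact ⟨_, isAffine_E6.of_iso φ hφ⟩
  | E7 => exact ⟨_, isAffine_E7.of_iso φ hφ⟩
  | E8 => exact ⟨_, isAffine_E8.of_iso φ hφ⟩

end Diagrams

end Extremal

end

theorem mainTheorem3 {V : Type*} [Fintype V] [DecidableEq V] (Γ : SimpleGraph V)
    [DecidableRel Γ.Adj] (x₀ : V) (hΓ : Extremal.IsSimplyLacedAffine Γ x₀)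
    (K : Type*) [Field K] (hK : ringChar K ≠ 2) :
    Nonempty (Extremal.ChevalleyBasis (Extremal.removeVertex Γ x₀)) ∧
    ∀ B : Extremal.ChevalleyBasis (Extremal.removeVertex Γ x₀),
      ∃ δ : V → ℤ, Extremal.IsNullRoot Γ δ ∧
      ∃ θ : Extremal.rootSystem (Extremal.removeVertex Γ x₀),
        IsLeast (Extremal.rootSystem (Extremal.removeVertex Γ x₀)) θ.1 ∧
      ∃ φ : Extremal.SandwichAlgebra Γ K ≃ₗ⁅K⁆ Extremal.AffineTarget B K,
        (∀ x : Extremal.Removed x₀,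
          φ (Extremal.ExtremalAlgebra.of Γ K 0 x.1) =
            Extremal.fromNPos B K (B.simpleE K x)) ∧
        φ (Extremal.ExtremalAlgebra.of Γ K 0 x₀) = Extremal.fromQuotient B K (B.E K θ) ∧
        ∀ μ : V → ℤ,
          (Extremal.SandwichAlgebra.weightSpace Γ K μ).map
              (φ : Extremal.SandwichAlgebra Γ K →ₗ[K] Extremal.AffineTarget B K) =
            Extremal.targetWeightSpace B K δ μ := by
  obtain ⟨δ, hδ⟩ := hΓ.exists_isAffine
  have : Fact (Extremal.IsPosDef (Extremal.removeVertex Γ x₀)) := ⟨hδ.isPosDef⟩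
  refine ⟨⟨Extremal.chevalleyBasis _⟩, fun B => ⟨δ, hδ.isNullRoot, ?_⟩⟩
  obtain ⟨θ, hθ, hleast⟩ := hδ.exists_lowest
  rw [← hδ.rootSystem_eq] at hleast
  obtain ⟨φ, h1, h2⟩ := Extremal.exists_lieEquiv B ⟨θ, hleast.1⟩ hδ hθ (Ring.two_ne_zero hK)
  exact ⟨⟨θ, hleast.1⟩, hleast, φ, fun x => by rw [h1, Extremal.targetGen_coe],
    by rw [h1, Extremal.targetGen_base], h2⟩
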